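/- Let $n\ge 3$. A generalized $n$-gon is a bipartite graph of diameter $n$ and girth $2n$ in which every vertex has valency at least $3$. In a graph $G$, a loose end is a vertex of valency at most $1$, and a clean arc is the interior $(x_1,\dots,x_{n-2})$ of a path $(x_0,x_1,\dots,x_{n-1})$ without repeated vertices such that $x_1,\dots,x_{n-2}$ all have valency $2$ in $G$; $x_0$ and $x_{n-1}$ are its endpoints. A generalized $n$-gon is open if each of its nonempty finite (induced) subgraphs contains a loose end or a clean arc of that subgraph. Let $T_n$ be the first-order theory of open generalized $n$-gons in the language of graphs expanded by two unary predicates for the bipartition. Let $B\models T_n$ and let $A, D\subseteq B$ be disjoint. We say that $D$ is closed over $A$ if, in the subgraph of $B$ induced on $A\cup D$, the set $D$ contains no loose end and no clean arc (with endpoints in $A\cup D$). For $A\subseteq C\subseteq B$ write $A\leq_o C$ if no nonempty finite subset of $C\setminus A$ is closed over $A$. For $A\subseteq B$ let $\hat A$ be the union of $A$ and of all finite subsets of $B$ that are closed over $A$; let $\langle A\rangle_B$ be the intersection of all generalized sub-$n$-gons of $B$ that contain $A$; put $\mathrm{Cl}_0(A)=A$, $\mathrm{Cl}_{i+1}(A)=\widehat{\langle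 \mathrm{Cl}_i(A)\rangle_B}$ and $\mathrm{Cl}_B(A)=\bigcup_{i<\omega}\mathrm{Cl}_i(A)$. Let $\mathrm{acl}_B(A)$ be the model-theoretic algebraic closure of $A$ in $B$, i.e. the union of all finite subsets of $B$ that are definable with parameters from $A$. **Theorem.** Let $A,B\models T_n$ with $A$ a substructure of $B$. The following are equivalent: 1. $A=\mathrm{acl}_B(A)$; 2. $A=\mathrm{Cl}_B(A)$; 3. $A\leq_o B$; 4. $A\preccurlyeq B$, i.e. $A$ is an elementary substructure of $B$. -/

import Mathlib

namespace GenPolygon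

open FirstOrder

universe u

section Graphs

variable {V : Type u}

/-- A generalized `n`-gon: a bipartite graph of diameter `n` and girth `2n` in which every vertex
has valency at least `3`. -/
structure IsGeneralizedPolygon (n : ℕ) (G : SimpleGraph V) : Prop where
  isBipartite : G.IsBipartite
  ediam_eq : G.ediam = n
  egirth_eq : G.egirth = ((2 * n : ℕ) : ℕ∞)
  thick : ∀ v : V, 3 ≤ (G.neighborSet v).encard

/-- The valency of `v` in the subgraph of `G` induced on `S`. -/
noncomputable def valencyIn (G : SimpleGraph V) (S : Set V) (v : V) : ℕ∞ :=
  (G.neighborSet v ∩ S).encard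

/-- `v` is a loose end of the subgraph of `G` induced on `S`. -/
def IsLooseEndIn (G : SimpleGraph V) (S : Set V) (v : V) : Prop :=
  v ∈ S ∧ valencyIn G S v ≤ 1

/-- `x = (x₀, …, xₙ₋₁)` is a (simple) path in the subgraph of `G` induced on `S`, and each interior
vertex `x₁, …, xₙ₋₂` has valency `2` in that subgraph; so `(x₁, …, xₙ₋₂)` is a clean arc of that
subgraph, with endpoints `x₀` and `xₙ₋₁`. -/
structure IsCleanArcPathIn (n : ℕ) (G : SimpleGraph V) (S : Set V) (x : Fin n → V) : Prop where
  injective : Function.Injective x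
  mem : ∀ i, x i ∈ S
  adj : ∀ i j : Fin n, i.val + 1 = j.val → G.Adj (x i) (x j)
  valency_eq : ∀ i : Fin n, 0 < i.val → i.val + 1 < n → valencyIn G S (x i) = 2

/-- A graph is open if every nonempty finite (induced) subgraph contains a loose end or a
clean arc. -/
def IsOpenGraph (n : ℕ) (G : SimpleGraph V) : Prop :=
  ∀ S : Set V, S.Finite → S.Nonempty →
    (∃ v, IsLooseEndIn G S v) ∨ ∃ x, IsCleanArcPathIn n G S x

/-- `D` is closed over `A` (where `A ∩ D = ∅`): in the subgraph induced on `A ∪ D`, the set `D`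
contains neither a loose end nor a clean arc (whose endpoints may lie in `A ∪ D`). -/
structure IsClosedOver (n : ℕ) (G : SimpleGraph V) (A D : Set V) : Prop where
  disjoint : Disjoint A D
  no_looseEnd : ¬ ∃ v ∈ D, IsLooseEndIn G (A ∪ D) v
  no_cleanArc : ¬ ∃ x : Fin n → V, IsCleanArcPathIn n G (A ∪ D) x ∧
    ∀ i : Fin n, 0 < i.val → i.val + 1 < n → x i ∈ D

/-- `D` is open over `A`: no nonempty finite subset of `D` is closed over `A`. -/
def IsOpenOver (n : ℕ) (G : SimpleGraph V) (A D : Set V) : Prop :=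
  Disjoint A D ∧ ∀ D₀ ⊆ D, D₀.Finite → D₀.Nonempty → ¬ IsClosedOver n G A D₀

/-- `A ≤ₒ C` (inside the ambient graph `G`). -/
def IsStrong (n : ℕ) (G : SimpleGraph V) (A C : Set V) : Prop :=
  A ⊆ C ∧ IsOpenOver n G A (C \ A)

/-- `Â`: the union of `A` and all finite sets of vertices that are closed over `A`. -/
def hat (n : ℕ) (G : SimpleGraph V) (A : Set V) : Set V :=
  A ∪ ⋃₀ {D | D.Finite ∧ IsClosedOver n G A D}

/-- `⟨A⟩`: the intersection of all generalized sub-`n`-gons of `G` that contain `A`. -/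
def generated (n : ℕ) (G : SimpleGraph V) (A : Set V) : Set V :=
  ⋂₀ {S | A ⊆ S ∧ IsGeneralizedPolygon n (G.induce S)}

/-- `Cl₀(A) = A`, and `Clᵢ₊₁(A)` is the hat of `⟨Clᵢ(A)⟩`. -/
def clStage (n : ℕ) (G : SimpleGraph V) (A : Set V) : ℕ → Set V
  | 0 => A
  | i + 1 => hat n G (generated n G (clStage n G A i))

/-- `Cl(A) = ⋃ᵢ Clᵢ(A)`. -/
def Cl (n : ℕ) (G : SimpleGraph V) (A : Set V) : Set V :=
  ⋃ i, clStage n G A i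

end Graphs

section Theory

/-- Relation symbols for graphs with a named bipartition. -/
inductive PolygonRel : ℕ → Type
  | point : PolygonRel 1
  | line : PolygonRel 1
  | adj : PolygonRel 2

/-- The language of graphs expanded by two predicates for the bipartition. -/
def polygonLang : FirstOrder.Language.{0, 0} := ⟨fun _ => Empty, PolygonRel⟩

variable {M : Type u} [polygonLang.Structure M]

def IsPoint (x : M) : Prop :=
  FirstOrder.Language.Structure.RelMap (L := polygonLang) PolygonRel.point ![x]

def IsLine (x : M) : Prop :=
  FirstOrder.Language.Structure.RelMap (L := polygonLang) PolygonRel.line ![x]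

def Incident (x y : M) : Prop :=
  FirstOrder.Language.Structure.RelMap (L := polygonLang) PolygonRel.adj ![x, y]

/-- The underlying graph of a structure (whose edge relation will be symmetric and irreflexive). -/
def incidenceGraph (M : Type u) [polygonLang.Structure M] : SimpleGraph M :=
  SimpleGraph.fromRel (Incident (M := M))

/-- A structure that is an open generalized `n`-gon, the unary predicates naming a
bipartition of it. -/
structure IsOpenGeneralizedPolygon (n : ℕ) (M : Type u) [polygonLang.Structure M] : Prop where
  point_or_line : ∀ x : M, IsPoint x ∨ IsLine x
  not_point_and_line : ∀ x : M, ¬ (IsPoint x ∧ IsLine x)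
  incident_symm : ∀ x y : M, Incident x y → Incident y x
  incident_cross : ∀ x y : M, Incident x y → (IsPoint x ↔ IsLine y)
  isGeneralizedPolygon : IsGeneralizedPolygon n (incidenceGraph M)
  isOpenGraph : IsOpenGraph n (incidenceGraph M)

/-- `Tₙ`, the first-order theory of open generalized `n`-gons: all sentences that hold in every
open generalized `n`-gon. -/
def openPolygonTheory (n : ℕ) : polygonLang.Theory :=
  {φ | ∀ (M : Type) [polygonLang.Structure M], IsOpenGeneralizedPolygon n M → M ⊨ φ}

end Theory

/-- The model-theoretic algebraic closure of `A` in `M`: the union of all finite subsets of `M`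
that are definable with parameters from `A`. -/
def acl (L : FirstOrder.Language) {M : Type*} [L.Structure M] (A : Set M) : Set M :=
  {b | ∃ S : Set M, A.Definable₁ L S ∧ S.Finite ∧ b ∈ S}

section Models

open FirstOrder FirstOrder.Language

/-- Indices for the atomic formulas in variables indexed by `ι`. -/
abbrev AtomIdx (ι : Type) : Type := (ι × ι) ⊕ (ι × ι) ⊕ ι ⊕ ι

/-- The atomic formulas in variables indexed by `ι`. -/
def atomFormula {ι : Type} : AtomIdx ι → polygonLang.Formula ι
  | .inl (i, j) => (Term.var i).equal (Term.var j)
  | .inr (.inl (i, j)) =>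
      Relations.formula₂ (L := polygonLang) PolygonRel.adj (Term.var i) (Term.var j)
  | .inr (.inr (.inl i)) => Relations.formula₁ (L := polygonLang) PolygonRel.point (Term.var i)
  | .inr (.inr (.inr i)) => Relations.formula₁ (L := polygonLang) PolygonRel.line (Term.var i)

/-- The quantifier-free type of a tuple. -/
def diag {ι : Type} {M : Type u} [polygonLang.Structure M] (v : ι → M) : AtomIdx ι → Prop
  | .inl (i, j) => v i = v j
  | .inr (.inl (i, j)) => Incident (v i) (v j)
  | .inr (.inr (.inl i)) => IsPoint (v i)
  | .inr (.inr (.inr i)) => IsLine (v i)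

theorem realize_atomFormula {ι : Type} {M : Type u} [polygonLang.Structure M] (v : ι → M)
    (a : AtomIdx ι) : (atomFormula a).Realize v ↔ diag v a := by
  rcases a with ⟨i, j⟩ | ⟨i, j⟩ | i | i
  · simp [atomFormula, diag, Formula.realize_equal]
  · exact Formula.realize_rel₂
  · exact Formula.realize_rel₁
  · exact Formula.realize_rel₁

open Classical in
/-- A formula saying that the tuple of variables has quantifier-free type in `Q`. -/
noncomputable def typeFormula {ι : Type} [Finite ι] (Q : Set (AtomIdx ι → Prop)) :
    polygonLang.Formula ι :=
  Formula.iSup fun q : Q =>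
    Formula.iInf fun a => if q.1 a then atomFormula a else (atomFormula a).not

theorem realize_typeFormula {ι : Type} [Finite ι] (Q : Set (AtomIdx ι → Prop))
    {M : Type u} [polygonLang.Structure M] (v : ι → M) :
    (typeFormula Q).Realize v ↔ diag v ∈ Q := by
  classical
  simp only [typeFormula, Formula.realize_iSup, Formula.realize_iInf]
  constructor
  · rintro ⟨q, hq⟩
    have : diag v = q.1 := by
      funext a
      have := hq a
      by_cases h : q.1 a <;> simpa [h, realize_atomFormula] using this
    rw [this]; exact q.2
  · intro h
    refine ⟨⟨_, h⟩, fun a => ?_⟩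
    by_cases h : diag v a <;> simp [h, realize_atomFormula]

/-- A sentence saying: for all `v` there is `w` such that `(v, w)` has quantifier-free type
in `Q`. -/
noncomputable def aeSentence {α β : Type} [Finite α] [Finite β]
    (Q : Set (AtomIdx (α ⊕ β) → Prop)) : polygonLang.Sentence :=
  ((((typeFormula Q).iExs β).relabel (Sum.inr : α → Empty ⊕ α)).iAlls α)

theorem realize_aeSentence {α β : Type} [Finite α] [Finite β]
    (Q : Set (AtomIdx (α ⊕ β) → Prop)) {M : Type u} [polygonLang.Structure M] :
    M ⊨ aeSentence Q ↔ ∀ v : α → M, ∃ w : β → M, diag (Sum.elim v w) ∈ Q := by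
  simp only [aeSentence, Sentence.Realize, Formula.realize_iAlls, Formula.realize_relabel,
    Formula.realize_iExs, realize_typeFormula]
  rfl

theorem ae_transfer {n : ℕ} {M : Type u} [polygonLang.Structure M]
    (hM : M ⊨ openPolygonTheory n) {α β : Type} [Finite α] [Finite β]
    (Q : Set (AtomIdx (α ⊕ β) → Prop))
    (h : ∀ (N : Type) [polygonLang.Structure N], IsOpenGeneralizedPolygon n N →
      ∀ v : α → N, ∃ w : β → N, diag (Sum.elim v w) ∈ Q) (v : α → M) :
    ∃ w : β → M, diag (Sum.elim v w) ∈ Q :=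
  (realize_aeSentence Q).1 (hM.realize_of_mem _ fun N _ hN =>
    (realize_aeSentence Q).2 (h N hN)) v

theorem ea_transfer {n : ℕ} {M : Type u} [polygonLang.Structure M]
    (hM : M ⊨ openPolygonTheory n) {α β : Type} [Finite α] [Finite β]
    (Q : Set (AtomIdx (α ⊕ β) → Prop))
    (h : ∀ (N : Type) [polygonLang.Structure N], IsOpenGeneralizedPolygon n N →
      ∃ v : α → N, ∀ w : β → N, diag (Sum.elim v w) ∉ Q) :
    ∃ v : α → M, ∀ w : β → M, diag (Sum.elim v w) ∉ Q := by
  have := hM.realize_of_mem (aeSentence Q).not fun N _ hN => by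
    rw [Sentence.realize_not, realize_aeSentence]
    push Not
    exact h N hN
  rw [Sentence.realize_not, realize_aeSentence] at this
  push Not at this
  exact this

/-- Every finite tuple of a model of `Tₙ` has the quantifier-free type of a tuple of some
open generalized `n`-gon. -/
theorem exists_diag_eq {n : ℕ} {M : Type u} [polygonLang.Structure M]
    (hM : M ⊨ openPolygonTheory n) {α : Type} [Finite α] (v : α → M) :
    ∃ (N : Type) (_ : polygonLang.Structure N) (_ : IsOpenGeneralizedPolygon n N) (w : α → N),
      diag v = diag w := by
  obtain ⟨w, N, _, hN, v', hv⟩ := ae_transfer hM (β := Empty)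
    {d | ∃ (N : Type) (_ : polygonLang.Structure N) (_ : IsOpenGeneralizedPolygon n N)
      (u : α ⊕ Empty → N), d = diag u}
    (fun N _ hN v => ⟨Empty.elim, N, _, hN, _, rfl⟩) v
  refine ⟨N, _, hN, v' ∘ Sum.inl, ?_⟩
  funext a
  rcases a with ⟨i, j⟩ | ⟨i, j⟩ | i | i
  · exact congrFun hv (.inl (.inl i, .inl j))
  · exact congrFun hv (.inr (.inl (.inl i, .inl j)))
  · exact congrFun hv (.inr (.inr (.inl (.inl i))))
  · exact congrFun hv (.inr (.inr (.inr (.inl i))))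

theorem adj_of_diag_eq {ι : Type} {M : Type*} [polygonLang.Structure M] {N : Type*}
    [polygonLang.Structure N] {v : ι → M} {w : ι → N} (h : diag v = diag w) (i j : ι) :
    (incidenceGraph M).Adj (v i) (v j) ↔ (incidenceGraph N).Adj (w i) (w j) := by
  have h1 : (v i = v j) = (w i = w j) := congrFun h (.inl (i, j))
  have h2 : Incident (v i) (v j) = Incident (w i) (w j) := congrFun h (.inr (.inl (i, j)))
  have h3 : Incident (v j) (v i) = Incident (w j) (w i) := congrFun h (.inr (.inl (j, i)))
  simp only [incidenceGraph, SimpleGraph.fromRel_adj, ne_eq, h1, h2, h3]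

/-- There is a walk of length at most `k` iff there is a lazy walk of length `k`. -/
theorem edist_le_iff_lazy {V : Type*} (G : SimpleGraph V) (k : ℕ) (x y : V) :
    G.edist x y ≤ k ↔ ∃ w : Fin (k + 1) → V, w 0 = x ∧ w (Fin.last k) = y ∧
      ∀ i : Fin k, w i.castSucc = w i.succ ∨ G.Adj (w i.castSucc) (w i.succ) := by
  constructor
  · intro h
    obtain ⟨p, hp⟩ := G.exists_walk_of_edist_ne_top
      (ne_of_lt (lt_of_le_of_lt h (ENat.natCast_lt_top k)))
    have hpk : p.length ≤ k := by rw [← hp] at h; exact_mod_cast h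
    refine ⟨fun i => p.getVert i, by simp, by simpa using p.getVert_of_length_le hpk, fun i => ?_⟩
    by_cases hi : i.val < p.length
    · exact Or.inr (p.adj_getVert_succ hi)
    · left
      have h1 := p.getVert_of_length_le (i := i.val) (by omega)
      have h2 := p.getVert_of_length_le (i := i.val + 1) (by omega)
      simp [h1, h2]
  · rintro ⟨w, rfl, rfl, hw⟩
    have : ∀ i : ℕ, ∀ hi : i < k + 1, G.edist (w 0) (w ⟨i, hi⟩) ≤ i := by
      intro i
      induction i with
      | zero => intro _; simp
      | succ i ih =>
        intro hi
        refine (SimpleGraph.edist_triangle (v := w ⟨i, by omega⟩)).trans ?_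
        push_cast
        refine add_le_add (ih _) ?_
        rw [SimpleGraph.edist_le_one_iff_adj_or_eq]
        exact (hw ⟨i, by omega⟩).symm
    exact this k (by omega)

theorem exists_three {V : Type*} {S : Set V} (h : 3 ≤ S.encard) :
    ∃ w : Fin 3 → V, Function.Injective w ∧ ∀ i, w i ∈ S := by
  obtain ⟨t, ht, htc⟩ := Set.exists_subset_encard_eq h
  obtain ⟨a, b, c, hab, hac, hbc, rfl⟩ := Set.encard_eq_three.1 htc
  refine ⟨![a, b, c], ?_, ?_⟩
  · intro i j hij
    fin_cases i <;> fin_cases j <;>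
      first
        | rfl
        | exact absurd hij hab
        | exact absurd hij.symm hab
        | exact absurd hij hac
        | exact absurd hij.symm hac
        | exact absurd hij hbc
        | exact absurd hij.symm hbc
  · intro i
    fin_cases i <;> exact ht (by simp)

/-- The models of `Tₙ` are open generalized `n`-gons. -/
theorem isOpenGeneralizedPolygon_of_model {n : ℕ} (hn : 3 ≤ n) {M : Type u}
    [polygonLang.Structure M] (hM : M ⊨ openPolygonTheory n) :
    IsOpenGeneralizedPolygon n M := by
  have hcross : ∀ x y : M, Incident x y → (IsPoint x ↔ IsLine y) := by
    intro x y h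
    obtain ⟨N, _, hN, w, hw⟩ := exists_diag_eq hM ![x, y]
    have e : Incident x y = _ := congrFun hw (.inr (.inl (0, 1)))
    have e1 : IsPoint x = _ := congrFun hw (.inr (.inr (.inl 0)))
    have e2 : IsLine y = _ := congrFun hw (.inr (.inr (.inr 1)))
    rw [e] at h
    rw [e1, e2]
    exact hN.incident_cross _ _ h
  have hpl : ∀ x : M, IsPoint x ∨ IsLine x := by
    intro x
    obtain ⟨N, _, hN, w, hw⟩ := exists_diag_eq hM (fun _ : Unit => x)
    have e1 : IsPoint x = _ := congrFun hw (.inr (.inr (.inl ())))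
    have e2 : IsLine x = _ := congrFun hw (.inr (.inr (.inr ())))
    rw [e1, e2]
    exact hN.point_or_line _
  have hnpl : ∀ x : M, ¬ (IsPoint x ∧ IsLine x) := by
    intro x
    obtain ⟨N, _, hN, w, hw⟩ := exists_diag_eq hM (fun _ : Unit => x)
    have e1 : IsPoint x = _ := congrFun hw (.inr (.inr (.inl ())))
    have e2 : IsLine x = _ := congrFun hw (.inr (.inr (.inr ())))
    rw [e1, e2]
    exact hN.not_point_and_line _
  have hsymm : ∀ x y : M, Incident x y → Incident y x := by
    intro x y h
    obtain ⟨N, _, hN, w, hw⟩ := exists_diag_eq hM ![x, y]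
    have e : Incident x y = _ := congrFun hw (.inr (.inl (0, 1)))
    have e' : Incident y x = _ := congrFun hw (.inr (.inl (1, 0)))
    rw [e] at h
    rw [e']
    exact hN.incident_symm _ _ h
  have hemb : ∀ {ι : Type} [Finite ι] (v : ι → M), Function.Injective v →
      ∃ (N : Type) (_ : polygonLang.Structure N) (_ : IsOpenGeneralizedPolygon n N) (w : ι → N),
        Function.Injective w ∧ ∀ i j, (incidenceGraph M).Adj (v i) (v j) ↔
          (incidenceGraph N).Adj (w i) (w j) := by
    intro ι _ v hv
    obtain ⟨N, _, hN, w, hw⟩ := exists_diag_eq hM v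
    refine ⟨N, _, hN, w, fun i j hij => hv ?_, adj_of_diag_eq hw⟩
    have : (v i = v j) = (w i = w j) := congrFun hw (.inl (i, j))
    rw [this]; exact hij
  refine ⟨hpl, hnpl, hsymm, hcross, ⟨?_, ?_, ?_, ?_⟩, ?_⟩
  · -- bipartite
    classical
    refine ⟨SimpleGraph.Coloring.mk (fun x => if IsPoint x then 0 else 1) ?_⟩
    intro x y hxy
    have key : ∀ x y : M, Incident x y → (IsPoint x ↔ ¬ IsPoint y) := by
      intro x y h
      have h1 := hcross _ _ h
      have h2 := hnpl y
      have h3 := hpl y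
      tauto
    have h' : IsPoint x ↔ ¬ IsPoint y := by
      rcases (SimpleGraph.fromRel_adj _ _ _).1 hxy with ⟨-, h | h⟩
      · exact key _ _ h
      · have := key _ _ h; tauto
    by_cases hx : IsPoint x
    · simp [hx, h'.1 hx]
    · have : IsPoint y := by tauto
      simp [hx, this]
  · -- diameter
    apply le_antisymm
    · rw [SimpleGraph.ediam_le_iff]
      intro x y
      rw [edist_le_iff_lazy]
      obtain ⟨w, hw⟩ := ae_transfer hM (α := Fin 2) (β := Fin (n + 1))
        {d | d (.inl (.inr 0, .inl 0)) ∧ d (.inl (.inr (Fin.last n), .inl 1)) ∧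
          ∀ i : Fin n, d (.inl (.inr i.castSucc, .inr i.succ)) ∨
            d (.inr (.inl (.inr i.castSucc, .inr i.succ)))} (by
          intro N _ hN v
          have h := (SimpleGraph.ediam_le_iff.1 hN.isGeneralizedPolygon.ediam_eq.le) (v 0) (v 1)
          rw [edist_le_iff_lazy] at h
          obtain ⟨w, h0, h1, h2⟩ := h
          refine ⟨w, h0, h1, fun i => (h2 i).imp id fun h => ?_⟩
          rcases (SimpleGraph.fromRel_adj _ _ _).1 h with ⟨-, h | h⟩
          · exact h
          · exact hN.incident_symm _ _ h) ![x, y]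
      obtain ⟨h0, h1, h2⟩ := hw
      refine ⟨w, h0, h1, fun i => ?_⟩
      by_cases hi : w i.castSucc = w i.succ
      · exact Or.inl hi
      · exact Or.inr ((SimpleGraph.fromRel_adj _ _ _).2
          ⟨hi, Or.inl ((h2 i).resolve_left hi)⟩)
    · obtain ⟨k, rfl⟩ : ∃ k, n = k + 1 := ⟨n - 1, by omega⟩
      obtain ⟨v, hv⟩ := ea_transfer hM (α := Fin 2) (β := Fin (k + 1))
        {d | d (.inl (.inr 0, .inl 0)) ∧ d (.inl (.inr (Fin.last k), .inl 1)) ∧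
          ∀ i : Fin k, d (.inl (.inr i.castSucc, .inr i.succ)) ∨
            d (.inr (.inl (.inr i.castSucc, .inr i.succ)))} (by
          intro N _ hN
          have h : ¬ (incidenceGraph N).ediam ≤ (k : ℕ∞) := by
            rw [hN.isGeneralizedPolygon.ediam_eq]
            exact_mod_cast Nat.not_succ_le_self k
          rw [SimpleGraph.ediam_le_iff] at h
          push Not at h
          obtain ⟨x, y, hxy⟩ := h
          refine ⟨![x, y], fun w hw => hxy.not_ge ?_⟩
          rw [edist_le_iff_lazy]
          obtain ⟨h0, h1, h2⟩ := hw
          refine ⟨w, h0, h1, fun i => ?_⟩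
          by_cases hi : w i.castSucc = w i.succ
          · exact Or.inl hi
          · exact Or.inr ((SimpleGraph.fromRel_adj _ _ _).2
              ⟨hi, Or.inl ((h2 i).resolve_left hi)⟩))
      by_contra hlt
      rw [not_le] at hlt
      have hle : (incidenceGraph M).ediam ≤ (k : ℕ∞) := by
        push_cast at hlt
        exact Order.le_of_lt_add_one hlt
      have h := SimpleGraph.ediam_le_iff.1 hle (v 0) (v 1)
      rw [edist_le_iff_lazy] at h
      obtain ⟨w, h0, h1, h2⟩ := h
      refine hv w ⟨h0, h1, fun i => (h2 i).imp id fun h => ?_⟩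
      rcases (SimpleGraph.fromRel_adj _ _ _).1 h with ⟨-, h | h⟩
      · exact h
      · exact hsymm _ _ h
  · -- girth
    apply le_antisymm
    · obtain ⟨w, hw⟩ := ae_transfer hM (α := Empty) (β := Fin (2 * n))
        {d | ∀ i j : Fin (2 * n), (d (.inl (.inr i, .inr j)) → i = j) ∧
          ((SimpleGraph.cycleGraph (2 * n)).Adj i j → d (.inr (.inl (.inr i, .inr j))))} (by
          intro N _ hN v
          have hg := hN.isGeneralizedPolygon.egirth_eq
          have hac : ¬ (incidenceGraph N).IsAcyclic := by
            intro hac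
            rw [hac.egirth_eq_top] at hg
            exact ENat.natCast_ne_top _ hg.symm
          obtain ⟨a, p, hp, hpl⟩ := SimpleGraph.exists_egirth_eq_length.2 hac
          have hlen : p.length = 2 * n := by
            rw [hg] at hpl; exact_mod_cast hpl.symm
          obtain ⟨f⟩ := (SimpleGraph.cycleGraph_isContained_iff (by omega)).2
            ⟨a, p, hp, hlen⟩
          refine ⟨f, fun i j => ⟨fun h => f.injective h, fun h => ?_⟩⟩
          rcases (SimpleGraph.fromRel_adj _ _ _).1 (f.toHom.map_adj h) with ⟨-, h | h⟩
          · exact h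
          · exact hN.incident_symm _ _ h) Empty.elim
      have hc : (SimpleGraph.cycleGraph (2 * n)).IsContained (incidenceGraph M) := by
        refine ⟨⟨⟨w, fun {i j} hij => ?_⟩, fun i j h => (hw i j).1 h⟩⟩
        refine (SimpleGraph.fromRel_adj _ _ _).2 ⟨fun h => hij.ne ((hw i j).1 h), Or.inl ?_⟩
        exact (hw i j).2 hij
      obtain ⟨a, p, hp, hlen⟩ := (SimpleGraph.cycleGraph_isContained_iff (by omega)).1 hc
      rw [← hlen]
      exact SimpleGraph.egirth_le_length hp
    · rw [SimpleGraph.le_egirth]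
      intro a p hp
      have h3 := hp.three_le_length
      obtain ⟨f⟩ := (SimpleGraph.cycleGraph_isContained_iff (by omega)).2 ⟨a, p, hp, rfl⟩
      obtain ⟨N, _, hN, w, hwi, hwa⟩ := hemb f f.injective
      have hc : (SimpleGraph.cycleGraph p.length).IsContained (incidenceGraph N) :=
        ⟨⟨⟨w, fun {i j} hij => (hwa i j).1 (f.toHom.map_adj hij)⟩, hwi⟩⟩
      obtain ⟨b, q, hq, hlen⟩ := (SimpleGraph.cycleGraph_isContained_iff (by omega)).1 hc
      rw [← hN.isGeneralizedPolygon.egirth_eq, ← hlen]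
      exact SimpleGraph.egirth_le_length hq
  · -- thick
    intro x
    obtain ⟨w, hw⟩ := ae_transfer hM (α := Unit) (β := Fin 3)
      {d | ∀ i j : Fin 3, (d (.inl (.inr i, .inr j)) → i = j) ∧
        d (.inr (.inl (.inl (), .inr i))) ∧ ¬ d (.inl (.inl (), .inr i))} (by
        intro N _ hN v
        obtain ⟨w, hwi, hw⟩ := exists_three (hN.isGeneralizedPolygon.thick (v ()))
        refine ⟨w, fun i j => ⟨fun h => hwi h, ?_⟩⟩
        rcases (SimpleGraph.fromRel_adj _ _ _).1 (hw i) with ⟨hne, h | h⟩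
        · exact ⟨h, hne⟩
        · exact ⟨hN.incident_symm _ _ h, hne⟩) (fun _ => x)
    have hinj : Function.Injective w := fun i j h => (hw i j).1 h
    calc (3 : ℕ∞) = (Set.range w).encard := by
          rw [← Set.image_univ, hinj.encard_image]; simp
      _ ≤ _ := by
        apply Set.encard_le_encard
        rintro _ ⟨i, rfl⟩
        exact (SimpleGraph.fromRel_adj _ _ _).2 ⟨(hw i i).2.2, Or.inl (hw i i).2.1⟩
  · -- open
    intro S hS hne
    obtain ⟨k, f, hfi, rfl⟩ : ∃ (k : ℕ) (f : Fin k → M), Function.Injective f ∧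
        Set.range f = S := by
      obtain ⟨k, f, hf⟩ := hS.fin_param
      exact ⟨k, f, hf⟩
    obtain ⟨N, _, hN, w, hwi, hwa⟩ := hemb f hfi
    have hrne : (Set.range w).Nonempty := by
      obtain ⟨_, i, rfl⟩ := hne
      exact ⟨_, i, rfl⟩
    have hval : ∀ i, valencyIn (incidenceGraph M) (Set.range f) (f i) =
        valencyIn (incidenceGraph N) (Set.range w) (w i) := by
      intro i
      have e1 : (incidenceGraph M).neighborSet (f i) ∩ Set.range f =
          f '' {j | (incidenceGraph M).Adj (f i) (f j)} := by
        ext y; constructor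
        · rintro ⟨h, j, rfl⟩; exact ⟨j, h, rfl⟩
        · rintro ⟨j, h, rfl⟩; exact ⟨h, j, rfl⟩
      have e2 : (incidenceGraph N).neighborSet (w i) ∩ Set.range w =
          w '' {j | (incidenceGraph M).Adj (f i) (f j)} := by
        ext y; constructor
        · rintro ⟨h, j, rfl⟩; exact ⟨j, (hwa i j).2 h, rfl⟩
        · rintro ⟨j, h, rfl⟩; exact ⟨(hwa i j).1 h, j, rfl⟩
      rw [valencyIn, valencyIn, e1, e2, hfi.encard_image, hwi.encard_image]
    rcases hN.isOpenGraph _ (Set.finite_range w) hrne with ⟨_, ⟨i, rfl⟩, hv⟩ | ⟨x, hx⟩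
    · exact Or.inl ⟨f i, ⟨i, rfl⟩, by rw [hval]; exact hv⟩
    · right
      choose g hg using hx.mem
      refine ⟨f ∘ g, ⟨fun i j h => hx.injective ?_, fun i => ⟨_, rfl⟩, fun i j hij => ?_,
        fun i h0 h1 => ?_⟩⟩
      · rw [← hg i, ← hg j, hfi h]
      · exact (hwa _ _).2 (by rw [hg, hg]; exact hx.adj i j hij)
      · rw [Function.comp, hval, hg]; exact hx.valency_eq i h0 h1

end Models

end GenPolygon

namespace GenPolygon

open Set

/-! ### Valencies, and sets closed over a base -/

section ClosedSets

universe u v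

variable {V : Type u} {W : Type v} {n : ℕ} {G : SimpleGraph V} {H : SimpleGraph W}

/-! The cycle of implications is 1 → 3 → 4 → 1, together with 2 ↔ 3. The last equivalence is nearly
formal: `A` is itself a generalized polygon, so `⟨A⟩ = A`, and both conditions say that no nonempty
finite set is closed over `A`. That elementary substructures are algebraically closed holds in any
language.

1 → 3. A finite set `D` closed over `A` is closed over a finite `A₀ ⊆ A` each of whose vertices is
adjacent to `D`. Three pairwise disjoint sets of this kind, together with `A₀`, would contradict
openness, so finitely many vertices meet all of them (`IsOpenGraph.exists_finite_hitting`). The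
union of the smallest systems of such vertices is finite and definable over `A₀`, and it meets `D`;
thus `D` meets `acl A` (`exists_mem_acl`).

3 → 4. The core is `exists_extension`: if `A ≤ₒ B` are models, then `B` embeds strongly over `A`
into some elementary extension `N` of `A`. Given this, strong embeddings preserve formulas by
induction. For a universal quantifier, truth passes from `A` up to `N` by elementarity, and from `N`
down to `B` by the induction hypothesis for `B ≤ₒ N`.

To embed `A ∪ D` with `D` finite, note that `D` is not closed over `A`; remove a loose end or a
clean arc, embed the rest, and put the removed part back. An arc is replaced by a geodesic of length
`n - 1`. A loose end requires a new vertex `x` in an elementary extension of a model `M`, with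
prescribed neighbour in `M` or with none, such that `M ∪ {x}` is strong (`hasGenericNeighbor`,
`exists_generic_isolated`). The finite stages are glued by an ultraproduct, whose strongness again
follows from the hitting sets.

The vertex `x` comes from an ultrapower. By `IsOpenGraph.exists_generic`, an open polygon has, over
any large finite set, loose ends `z` such that every finite closed set attached to `z` has at least
`m` elements. They are found by adding clean arcs one after another, each starting at the first
interior vertex of the one before: a closed set attached to the end must run back through the whole
tower. -/

theorem valencyIn_mono {S T : Set V} (h : S ⊆ T) (v : V) : valencyIn G S v ≤ valencyIn G T v :=
  encard_le_encard (inter_subset_inter_right _ h)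

theorem one_lt_valencyIn {S : Set V} {v a b : V} (ha : a ∈ S) (hb : b ∈ S) (hab : a ≠ b)
    (hva : G.Adj v a) (hvb : G.Adj v b) : 1 < valencyIn G S v :=
  one_lt_encard_iff.2 ⟨a, b, ⟨hva, ha⟩, ⟨hvb, hb⟩, hab⟩

theorem exists_of_one_lt_valencyIn {S : Set V} {v : V} (h : 1 < valencyIn G S v) :
    ∃ a ∈ S, ∃ b ∈ S, a ≠ b ∧ G.Adj v a ∧ G.Adj v b := by
  obtain ⟨a, b, ha, hb, hab⟩ := one_lt_encard_iff.1 h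
  exact ⟨a, ha.2, b, hb.2, hab, ha.1, hb.1⟩

theorem three_le_valencyIn {S : Set V} {v a b c : V} (ha : a ∈ S) (hb : b ∈ S) (hc : c ∈ S)
    (hab : a ≠ b) (hac : a ≠ c) (hbc : b ≠ c)
    (hva : G.Adj v a) (hvb : G.Adj v b) (hvc : G.Adj v c) : 3 ≤ valencyIn G S v := by
  have h : ({a, b, c} : Set V).encard = 3 := encard_eq_three.2 ⟨a, b, c, hab, hac, hbc, rfl⟩
  rw [← h]
  refine encard_le_encard ?_
  rintro _ (rfl | rfl | rfl)
  exacts [⟨hva, ha⟩, ⟨hvb, hb⟩, ⟨hvc, hc⟩]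

theorem two_le_iff_one_lt {k : ℕ∞} : 2 ≤ k ↔ 1 < k := by
  rw [← one_add_one_eq_two, ENat.add_one_le_iff (by simp)]

theorem mem_of_valencyIn_eq_two {S T : Set V} {v w : V} (hST : S ⊆ T) (hS : 1 < valencyIn G S v)
    (hT : valencyIn G T v = 2) (hw : w ∈ T) (hvw : G.Adj v w) : w ∈ S := by
  have hfin : (G.neighborSet v ∩ T).Finite := finite_of_encard_eq_coe (k := 2) hT
  have : G.neighborSet v ∩ S = G.neighborSet v ∩ T :=
    hfin.eq_of_subset_of_encard_le' (inter_subset_inter_right _ hST)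
      (hT.trans_le (two_le_iff_one_lt.2 hS))
  exact (this.symm ▸ (⟨hvw, hw⟩ : w ∈ G.neighborSet v ∩ T) : w ∈ G.neighborSet v ∩ S).2

theorem valencyIn_eq_two {S : Set V} {v a b : V} (ha : a ∈ S) (hb : b ∈ S) (hab : a ≠ b)
    (hva : G.Adj v a) (hvb : G.Adj v b) (h : ∀ w ∈ S, G.Adj v w → w = a ∨ w = b) :
    valencyIn G S v = 2 := by
  refine encard_eq_two.2 ⟨a, b, hab, ?_⟩
  ext w
  constructor
  · rintro ⟨h1, h2⟩; exact h w h2 h1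
  · rintro (rfl | rfl)
    exacts [⟨hva, ha⟩, ⟨hvb, hb⟩]

theorem eq_or_eq_of_valencyIn_eq_two {S : Set V} {v a b w : V} (h : valencyIn G S v = 2)
    (ha : a ∈ S) (hb : b ∈ S) (hab : a ≠ b) (hva : G.Adj v a) (hvb : G.Adj v b)
    (hw : w ∈ S) (hvw : G.Adj v w) : w = a ∨ w = b := by
  by_contra! hne
  have := three_le_valencyIn ha hb hw hab hne.1.symm hne.2.symm hva hvb hvw
  rw [h] at this
  exact absurd this (by decide)

theorem IsClosedOver.one_lt_valencyIn {A D : Set V} (h : IsClosedOver n G A D) {v : V}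
    (hv : v ∈ D) : 1 < valencyIn G (A ∪ D) v := by
  by_contra! hle
  exact h.no_looseEnd ⟨v, hv, Or.inr hv, hle⟩

theorem IsClosedOver.mem_of_adj {A D P : Set V} (h : IsClosedOver n G A D) (hP : A ∪ D ⊆ P)
    {v w : V} (hv : v ∈ D) (hval : valencyIn G P v = 2) (hw : w ∈ P) (hvw : G.Adj v w) :
    w ∈ A ∪ D :=
  mem_of_valencyIn_eq_two hP (h.one_lt_valencyIn hv) hval hw hvw

/-- The interior of a clean arc of a larger graph that avoids `A` does not meet a set closed
over `A`. -/
theorem IsClosedOver.notMem_of_isCleanArcPathIn {A D P : Set V} (h : IsClosedOver n G A D)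
    (hP : A ∪ D ⊆ P) {x : Fin n → V} (hx : IsCleanArcPathIn n G P x)
    (hxA : ∀ i : Fin n, 0 < i.val → i.val + 1 < n → x i ∉ A) (i : Fin n) (h0 : 0 < i.val)
    (h1 : i.val + 1 < n) : x i ∉ D := by
  intro hi
  -- An interior vertex in `D` has two neighbours in `A ∪ D` and only two in `P`, so both its
  -- neighbours on the arc lie in `A ∪ D`. Interior vertices avoid `A`, hence `D` swallows the whole
  -- interior, which is then a clean arc of `A ∪ D`.
  have step : ∀ j k : Fin n, 0 < j.val → j.val + 1 < n → x j ∈ D →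
      (j.val + 1 = k.val ∨ k.val + 1 = j.val) → x k ∈ A ∪ D := by
    intro j k hj0 hj1 hj hjk
    refine h.mem_of_adj hP hj (hx.valency_eq j hj0 hj1) (hx.mem k) ?_
    rcases hjk with hjk | hjk
    · exact hx.adj _ _ hjk
    · exact (hx.adj _ _ hjk).symm
  have up : ∀ k : ℕ, ∀ hk : i.val + k + 1 < n, x ⟨i.val + k, by omega⟩ ∈ D := by
    intro k
    induction k with
    | zero => intro _; exact hi
    | succ k ih =>
      intro hk
      have := step ⟨i.val + k, by omega⟩ ⟨i.val + (k + 1), by omega⟩ (by simp; omega)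
        (by simp; omega) (ih (by omega)) (Or.inl (by simp; omega))
      exact this.resolve_left (hxA _ (by simp) (by simp; omega))
  have down : ∀ k : ℕ, ∀ hk : k < i.val, x ⟨i.val - k, by omega⟩ ∈ D := by
    intro k
    induction k with
    | zero => intro _; exact hi
    | succ k ih =>
      intro hk
      have := step ⟨i.val - k, by omega⟩ ⟨i.val - (k + 1), by omega⟩ (by simp; omega)
        (by simp; omega) (ih (by omega)) (Or.inr (by simp; omega))
      exact this.resolve_left (hxA _ (by simp; omega) (by simp; omega))
  have all : ∀ j : Fin n, 0 < j.val → j.val + 1 < n → x j ∈ D := by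
    intro j hj0 hj1
    rcases le_total i.val j.val with hij | hij
    · have := up (j.val - i.val) (by omega)
      convert this using 2
      ext; simp; omega
    · have := down (i.val - j.val) (by omega)
      convert this using 2
      ext; simp; omega
  refine h.no_cleanArc ⟨x, ⟨hx.injective, fun j => ?_, hx.adj, fun j hj0 hj1 => ?_⟩, all⟩
  · by_cases hj0 : 0 < j.val
    · by_cases hj1 : j.val + 1 < n
      · exact Or.inr (all j hj0 hj1)
      · exact step ⟨j.val - 1, by omega⟩ j (by simp; omega) (by simp; omega)
          (all _ (by simp; omega) (by simp; omega)) (Or.inl (by simp; omega))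
    · exact step ⟨1, by omega⟩ j (by simp) (by simp; omega)
        (all _ (by simp) (by simp; omega)) (Or.inr (by simp; omega))
  · refine le_antisymm ?_ (two_le_iff_one_lt.2 (h.one_lt_valencyIn (all j hj0 hj1)))
    exact (valencyIn_mono hP _).trans_eq (hx.valency_eq j hj0 hj1)

/-- Enlarging the base only increases valencies, so no loose end appears. A new clean arc would have
its interior in `D` and off `A`, which `IsClosedOver.notMem_of_isCleanArcPathIn` excludes. -/
theorem IsClosedOver.diff (hn : 3 ≤ n) {A C D : Set V} (h : IsClosedOver n G A D) (hAC : A ⊆ C) :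
    IsClosedOver n G C (D \ C) := by
  have hsub : A ∪ D ⊆ C ∪ D \ C := by
    rw [union_sdiff_self]; exact union_subset_union_left _ hAC
  refine ⟨disjoint_sdiff_right, ?_, ?_⟩
  · rintro ⟨v, hv, -, hle⟩
    exact absurd ((h.one_lt_valencyIn hv.1).trans_le (valencyIn_mono hsub v)) (not_lt.2 hle)
  · rintro ⟨x, hx, hxD⟩
    exact h.notMem_of_isCleanArcPathIn hsub hx (fun i h0 h1 hA => (hxD i h0 h1).2 (hAC hA))
      ⟨1, by omega⟩ (by simp) (by simp; omega) (hxD _ (by simp) (by simp; omega)).1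

/-- As for `IsClosedOver.diff`: adding further sets increases valencies, and a clean arc of the
union cannot meet any single member. -/
theorem IsClosedOver.sUnion (hn : 3 ≤ n) {A : Set V} {F : Set (Set V)}
    (h : ∀ D ∈ F, IsClosedOver n G A D) : IsClosedOver n G A (⋃₀ F) := by
  have hsub : ∀ D ∈ F, A ∪ D ⊆ A ∪ ⋃₀ F := fun D hD =>
    union_subset_union_right _ (subset_sUnion_of_mem hD)
  have hdisj : Disjoint A (⋃₀ F) := disjoint_sUnion_right.2 fun D hD => (h D hD).disjoint
  refine ⟨hdisj, ?_, ?_⟩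
  · rintro ⟨v, ⟨D, hD, hv⟩, -, hle⟩
    exact absurd (((h D hD).one_lt_valencyIn hv).trans_le (valencyIn_mono (hsub D hD) v))
      (not_lt.2 hle)
  · rintro ⟨x, hx, hxD⟩
    obtain ⟨D, hD, hv⟩ := hxD ⟨1, by omega⟩ (by simp) (by simp; omega)
    exact (h D hD).notMem_of_isCleanArcPathIn (hsub D hD) hx
      (fun i h0 h1 hA => hdisj.le_bot ⟨hA, hxD i h0 h1⟩) ⟨1, by omega⟩ (by simp)
      (by simp; omega) hv

/-- A finite set closed over `A` is closed over a finite subset of `A` of vertices adjacent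
to it. -/
theorem IsClosedOver.exists_finite {A D : Set V} (h : IsClosedOver n G A D) (hD : D.Finite) :
    ∃ A₀ ⊆ A, A₀.Finite ∧ IsClosedOver n G A₀ D ∧ ∀ a ∈ A₀, ∃ d ∈ D, G.Adj a d := by
  -- Keep every neighbour of `v` in `A` if there are fewer than three, and exactly three otherwise:
  -- three suffice to keep `v` from being a loose end or interior to a clean arc.
  have key : ∀ v : V, ∃ Q ⊆ G.neighborSet v ∩ A, Q.Finite ∧
      (Q = G.neighborSet v ∩ A ∨ 3 ≤ Q.encard) := by
    intro v
    by_cases h3 : 3 ≤ (G.neighborSet v ∩ A).encard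
    · obtain ⟨Q, hQ, hQc⟩ := exists_subset_encard_eq h3
      exact ⟨Q, hQ, finite_of_encard_eq_coe (k := 3) hQc, Or.inr hQc.ge⟩
    · exact ⟨_, Subset.rfl, finite_of_encard_le_coe (k := 3) (not_le.1 h3).le, Or.inl rfl⟩
  choose Q hQ hQf hQc using key
  have hsub : (⋃ v ∈ D, Q v) ⊆ A := iUnion₂_subset fun v _ => (hQ v).trans inter_subset_right
  have hval : ∀ v ∈ D, valencyIn G ((⋃ v ∈ D, Q v) ∪ D) v ≤ 2 →
      valencyIn G (A ∪ D) v = valencyIn G ((⋃ v ∈ D, Q v) ∪ D) v := by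
    intro v hv hle
    refine le_antisymm ?_ (valencyIn_mono (union_subset_union_left _ hsub) v)
    have hQs : Q v ⊆ G.neighborSet v ∩ ((⋃ v ∈ D, Q v) ∪ D) := fun w hw =>
      ⟨(hQ v hw).1, Or.inl (mem_biUnion hv hw)⟩
    rcases hQc v with hc | hc
    · refine encard_le_encard ?_
      rintro w ⟨hvw, hw | hw⟩
      · exact hQs (hc ▸ ⟨hvw, hw⟩)
      · exact ⟨hvw, Or.inr hw⟩
    · exact absurd ((hc.trans (encard_le_encard hQs)).trans hle) (by decide)
  refine ⟨⋃ v ∈ D, Q v, hsub, hD.biUnion fun v _ => hQf v,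
    ⟨h.disjoint.mono_left hsub, ?_, ?_⟩, ?_⟩
  · rintro ⟨v, hv, -, hle⟩
    have := h.one_lt_valencyIn hv
    rw [hval v hv (hle.trans (by decide))] at this
    exact absurd this (not_lt.2 hle)
  · rintro ⟨x, hx, hxD⟩
    refine h.no_cleanArc ⟨x, ⟨hx.injective,
      fun i => union_subset_union_left _ hsub (hx.mem i), hx.adj, fun i h0 h1 => ?_⟩, hxD⟩
    rw [hval _ (hxD i h0 h1) (hx.valency_eq i h0 h1).le, hx.valency_eq i h0 h1]
  · intro a ha
    simp only [mem_iUnion] at ha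
    obtain ⟨v, hv, hav⟩ := ha
    exact ⟨v, hv, (hQ v hav).1.symm⟩

/-- Base vertices without neighbours in `D` do not contribute to the valencies of vertices of `D`.
-/
theorem IsClosedOver.of_not_adj {A S D : Set V} (h : IsClosedOver n G (A ∪ S) D)
    (hS : ∀ s ∈ S, ∀ d ∈ D, ¬ G.Adj s d) : IsClosedOver n G A D := by
  have hsub : A ∪ D ⊆ A ∪ S ∪ D := union_subset_union_left _ subset_union_left
  have hval : ∀ v ∈ D, valencyIn G (A ∪ D) v = valencyIn G (A ∪ S ∪ D) v := by
    intro v hv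
    refine le_antisymm (valencyIn_mono hsub v) (encard_le_encard ?_)
    rintro w ⟨hvw, (hw | hw) | hw⟩
    · exact ⟨hvw, Or.inl hw⟩
    · exact absurd hvw.symm (hS w hw v hv)
    · exact ⟨hvw, Or.inr hw⟩
  refine ⟨h.disjoint.mono_left subset_union_left, ?_, ?_⟩
  · rintro ⟨v, hv, -, hle⟩
    rw [hval v hv] at hle
    exact absurd (h.one_lt_valencyIn hv) (not_lt.2 hle)
  · rintro ⟨x, hx, hxD⟩
    refine h.no_cleanArc ⟨x, ⟨hx.injective, fun i => hsub (hx.mem i), hx.adj,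
      fun i h0 h1 => ?_⟩, hxD⟩
    rw [← hval _ (hxD i h0 h1), hx.valency_eq i h0 h1]

/-- In an open graph, finitely many vertices hit all finite sets that are closed over a fixed
finite set `A` and are adjacent to every vertex of `A`. -/
theorem IsOpenGraph.exists_finite_hitting (hn : 3 ≤ n) (hG : IsOpenGraph n G) {A : Set V}
    (hA : A.Finite) : ∃ K : Set V, K.Finite ∧ ∀ D : Set V, D.Finite → D.Nonempty →
      IsClosedOver n G A D → (∀ a ∈ A, ∃ d ∈ D, G.Adj a d) → (D ∩ K).Nonempty := by
  set F : Set (Set V) := {D | D.Finite ∧ D.Nonempty ∧ IsClosedOver n G A D ∧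
    ∀ a ∈ A, ∃ d ∈ D, G.Adj a d} with hF
  suffices h : ∃ K : Set V, K.Finite ∧ ∀ D ∈ F, (D ∩ K).Nonempty by
    obtain ⟨K, hK, h⟩ := h
    exact ⟨K, hK, fun D h1 h2 h3 h4 => h D ⟨h1, h2, h3, h4⟩⟩
  -- Without a finite hitting set there are three pairwise disjoint members of `F`. Each vertex of
  -- `A` then has valency at least 3 in the union `P`, so a loose end or clean arc of `P` would
  -- belong to the three sets, whose union is closed over `A`.
  by_contra! hno
  obtain ⟨D₁, hD₁, -⟩ := hno ∅ finite_empty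
  obtain ⟨D₂, hD₂, h12⟩ := hno D₁ hD₁.1
  obtain ⟨D₃, hD₃, h3⟩ := hno (D₁ ∪ D₂) (hD₁.1.union hD₂.1)
  rw [inter_union_distrib_left, union_empty_iff] at h3
  obtain ⟨h13, h23⟩ := h3
  have d12 : Disjoint D₂ D₁ := disjoint_iff_inter_eq_empty.2 h12
  have d13 : Disjoint D₃ D₁ := disjoint_iff_inter_eq_empty.2 h13
  have d23 : Disjoint D₃ D₂ := disjoint_iff_inter_eq_empty.2 h23
  set P := A ∪ ⋃₀ {D₁, D₂, D₃} with hP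
  have hcl : IsClosedOver n G A (⋃₀ {D₁, D₂, D₃}) := IsClosedOver.sUnion hn (by
    rintro D (rfl | rfl | rfl)
    exacts [hD₁.2.2.1, hD₂.2.2.1, hD₃.2.2.1])
  have hfin : P.Finite := by
    refine hA.union ?_
    rw [sUnion_insert, sUnion_insert, sUnion_singleton]
    exact hD₁.1.union (hD₂.1.union hD₃.1)
  have hA3 : ∀ a ∈ A, 3 ≤ valencyIn G P a := by
    intro a ha
    obtain ⟨d₁, h1, a1⟩ := hD₁.2.2.2 a ha
    obtain ⟨d₂, h2, a2⟩ := hD₂.2.2.2 a ha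
    obtain ⟨d₃, h3, a3⟩ := hD₃.2.2.2 a ha
    refine three_le_valencyIn (a := d₁) (b := d₂) (c := d₃) (Or.inr ⟨D₁, by simp, h1⟩)
      (Or.inr ⟨D₂, by simp, h2⟩) (Or.inr ⟨D₃, by simp, h3⟩) ?_ ?_ ?_ a1 a2 a3
    · rintro rfl; exact d12.le_bot ⟨h2, h1⟩
    · rintro rfl; exact d13.le_bot ⟨h3, h1⟩
    · rintro rfl; exact d23.le_bot ⟨h3, h2⟩
  obtain ⟨d, hd⟩ := hD₁.2.1
  rcases hG P hfin ⟨d, Or.inr ⟨D₁, by simp, hd⟩⟩ with ⟨v, hv | hv, hle⟩ | ⟨x, hx⟩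
  · exact absurd ((hA3 v hv).trans hle) (by decide)
  · exact absurd (hcl.one_lt_valencyIn hv) (not_lt.2 hle)
  · refine hcl.no_cleanArc ⟨x, hx, fun i h0 h1 => (hx.mem i).resolve_left fun hi => ?_⟩
    have := hA3 _ hi
    rw [hx.valency_eq i h0 h1] at this
    exact absurd this (by decide)

section Transport

variable {f : V → W} {X A D S : Set V}

theorem valencyIn_image (hf : InjOn f X) (hadj : ∀ x ∈ X, ∀ y ∈ X, G.Adj x y ↔ H.Adj (f x) (f y))
    (hS : S ⊆ X) {v : V} (hv : v ∈ X) : valencyIn H (f '' S) (f v) = valencyIn G S v := by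
  have : H.neighborSet (f v) ∩ f '' S = f '' (G.neighborSet v ∩ S) := by
    ext w
    constructor
    · rintro ⟨hw, s, hs, rfl⟩
      exact ⟨s, ⟨(hadj v hv s (hS hs)).2 hw, hs⟩, rfl⟩
    · rintro ⟨s, ⟨hvs, hs⟩, rfl⟩
      exact ⟨(hadj v hv s (hS hs)).1 hvs, s, hs, rfl⟩
  rw [valencyIn, valencyIn, this]
  exact (hf.mono (inter_subset_right.trans hS)).encard_image

theorem isClosedOver_image_iff (hf : InjOn f X)
    (hadj : ∀ x ∈ X, ∀ y ∈ X, G.Adj x y ↔ H.Adj (f x) (f y)) (hX : A ∪ D ⊆ X) :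
    IsClosedOver n H (f '' A) (f '' D) ↔ IsClosedOver n G A D := by
  have hD : D ⊆ X := subset_union_right.trans hX
  have hA : A ⊆ X := subset_union_left.trans hX
  have hval : ∀ v ∈ X, valencyIn H (f '' A ∪ f '' D) (f v) = valencyIn G (A ∪ D) v := by
    intro v hv
    rw [← image_union]; exact valencyIn_image hf hadj hX hv
  constructor
  · intro h
    refine ⟨?_, ?_, ?_⟩
    · rw [Set.disjoint_left]
      intro a ha ha'
      exact h.disjoint.le_bot ⟨mem_image_of_mem f ha, mem_image_of_mem f ha'⟩
    · rintro ⟨v, hv, -, hle⟩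
      refine h.no_looseEnd ⟨f v, mem_image_of_mem f hv, Or.inr (mem_image_of_mem f hv), ?_⟩
      rwa [hval v (hD hv)]
    · rintro ⟨x, hx, hxD⟩
      have hxX := fun i => hX (hx.mem i)
      refine h.no_cleanArc ⟨f ∘ x, ⟨fun i j hij => hx.injective (hf (hxX i) (hxX j) hij),
        fun i => ?_, fun i j hij => (hadj _ (hxX i) _ (hxX j)).1 (hx.adj i j hij),
        fun i h0 h1 => ?_⟩, fun i h0 h1 => mem_image_of_mem f (hxD i h0 h1)⟩
      · rw [← image_union]; exact mem_image_of_mem f (hx.mem i)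
      · rw [Function.comp, hval _ (hxX i), hx.valency_eq i h0 h1]
  · intro h
    refine ⟨?_, ?_, ?_⟩
    · rw [Set.disjoint_left]
      rintro _ ⟨a, ha, rfl⟩ ⟨d, hd, hda⟩
      rw [hf (hD hd) (hA ha) hda] at hd
      exact h.disjoint.le_bot ⟨ha, hd⟩
    · rintro ⟨_, ⟨v, hv, rfl⟩, -, hle⟩
      rw [hval v (hD hv)] at hle
      exact h.no_looseEnd ⟨v, hv, Or.inr hv, hle⟩
    · rintro ⟨x, hx, hxD⟩
      have : ∀ i, ∃ y ∈ A ∪ D, f y = x i := by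
        intro i
        have := hx.mem i
        rwa [← image_union] at this
      choose y hy hyx using this
      obtain rfl : f ∘ y = x := funext hyx
      have hyX := fun i => hX (hy i)
      refine h.no_cleanArc ⟨y, ⟨fun i j hij => hx.injective (congrArg f hij),
        hy, fun i j hij => (hadj _ (hyX i) _ (hyX j)).2 (hx.adj i j hij),
        fun i h0 h1 => ?_⟩, fun i h0 h1 => ?_⟩
      · rw [← hval _ (hyX i)]; exact hx.valency_eq i h0 h1
      · obtain ⟨d, hd, hdy⟩ := hxD i h0 h1
        rwa [← hf (hD hd) (hyX i) hdy]

end Transport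

end ClosedSets

end GenPolygon

namespace GenPolygon

open Set

/-! ### Free vertices and the addition of ears -/

section Ears

universe u

variable {V : Type u} {n : ℕ} {G : SimpleGraph V}

/-- No finite set closed over `A` is adjacent to the vertex `s` of `A`. -/
def IsFreeIn (n : ℕ) (G : SimpleGraph V) (A : Set V) (s : V) : Prop :=
  s ∈ A ∧ ∀ D : Set V, D.Finite → IsClosedOver n G A D → ∀ d ∈ D, ¬ G.Adj s d

/-- A path of length `k ≥ 2` with endpoints in `A` and interior outside `A`. -/
structure IsEar (G : SimpleGraph V) (A : Set V) (k : ℕ) (p : ℕ → V) : Prop where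
  two_le : 2 ≤ k
  injOn : InjOn p (Iic k)
  adj : ∀ i < k, G.Adj (p i) (p (i + 1))
  zero_mem : p 0 ∈ A
  last_mem : p k ∈ A
  notMem : ∀ i, 0 < i → i < k → p i ∉ A

theorem isStrong_univ_iff {C : Set V} : IsStrong n G C univ ↔
    ∀ D : Set V, D.Finite → D.Nonempty → ¬ IsClosedOver n G C D := by
  constructor
  · intro h D hD hne hcl
    refine h.2.2 D (fun d hd => ⟨trivial, fun hC => hcl.disjoint.le_bot ⟨hC, hd⟩⟩) hD hne hcl
  · intro h
    exact ⟨subset_univ _, disjoint_sdiff_right, fun D _ hD hne => h D hD hne⟩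

theorem IsStrong.isFreeIn {C : Set V} (h : IsStrong n G C univ) {s : V} (hs : s ∈ C) :
    IsFreeIn n G C s :=
  ⟨hs, fun D hD hcl d hd => absurd hcl (isStrong_univ_iff.1 h D hD ⟨d, hd⟩)⟩

namespace IsEar

variable {A : Set V} {k : ℕ} {p : ℕ → V}

theorem mem_union (h : IsEar G A k p) {i : ℕ} (hi : i ≤ k) : p i ∈ A ∪ p '' Ioo 0 k := by
  rcases Nat.eq_zero_or_pos i with rfl | h0
  · exact Or.inl h.zero_mem
  · rcases hi.eq_or_lt with rfl | h1
    · exact Or.inl h.last_mem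
    · exact Or.inr ⟨i, ⟨h0, h1⟩, rfl⟩

theorem disjoint (h : IsEar G A k p) : Disjoint A (p '' Ioo 0 k) := by
  rw [Set.disjoint_left]
  rintro _ ha ⟨i, hi, rfl⟩
  exact h.notMem i hi.1 hi.2 ha

theorem one_lt_valencyIn (h : IsEar G A k p) {v : V} (hv : v ∈ p '' Ioo 0 k) :
    1 < valencyIn G (A ∪ p '' Ioo 0 k) v := by
  obtain ⟨i, ⟨h0, h1⟩, rfl⟩ := hv
  refine GenPolygon.one_lt_valencyIn (h.mem_union (i := i - 1) (by omega))
    (h.mem_union (i := i + 1) (by omega)) (fun he => ?_) ?_ (h.adj i h1)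
  · have := h.injOn (by simp; omega) (by simp; omega) he
    omega
  · have := h.adj (i - 1) (by omega)
    rw [Nat.sub_add_cancel h0] at this
    exact this.symm

/-- Counting: the `n - 2` distinct interior vertices of `x` lie among the `k - 1 ≤ n - 2` interior
vertices of the ear. -/
theorem interior_eq (h : IsEar G A k p) {x : Fin n → V} (hx : Function.Injective x)
    (hk : k + 1 ≤ n) (hxS : ∀ i : Fin n, 0 < i.val → i.val + 1 < n → x i ∈ p '' Ioo 0 k) :
    k + 1 = n ∧ ∀ v ∈ p '' Ioo 0 k, ∃ i : Fin n, 0 < i.val ∧ i.val + 1 < n ∧ x i = v := by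
  have h2 := h.two_le
  have hS : (p '' Ioo 0 k).ncard = k - 1 := by
    rw [(h.injOn.mono fun i hi => hi.2.le).ncard_image, ← Finset.coe_Ioo,
      ncard_coe_finset, Nat.card_Ioo]
    omega
  set I : Set (Fin n) := {i | 0 < i.val ∧ i.val + 1 < n} with hI
  have hIc : I.ncard = n - 2 := by
    have : Fin.val '' I = Ioo 0 (n - 1) := by
      ext i
      constructor
      · rintro ⟨j, ⟨h0, h1⟩, rfl⟩; exact ⟨h0, by omega⟩
      · rintro ⟨h0, h1⟩; exact ⟨⟨i, by omega⟩, ⟨h0, by simp; omega⟩, rfl⟩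
    rw [← ncard_image_of_injective I Fin.val_injective, this, ← Finset.coe_Ioo,
      ncard_coe_finset, Nat.card_Ioo]
    omega
  have hfin : (p '' Ioo 0 k).Finite := (finite_Ioo 0 k).image p
  have hsub : x '' I ⊆ p '' Ioo 0 k := by
    rintro _ ⟨i, hi, rfl⟩; exact hxS i hi.1 hi.2
  have hxI : (x '' I).ncard = n - 2 := by rw [ncard_image_of_injective I hx, hIc]
  have hle := ncard_le_ncard hsub hfin
  have heq : x '' I = p '' Ioo 0 k := eq_of_subset_of_ncard_le hsub (by omega) hfin
  refine ⟨by omega, fun v hv => ?_⟩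
  rw [← heq] at hv
  obtain ⟨i, hi, rfl⟩ := hv
  exact ⟨i, hi.1, hi.2, rfl⟩

/-- Every interior vertex has two neighbours on the ear, and there are too few of them for a clean
arc. -/
theorem isClosedOver_of_lt (h : IsEar G A k p) (hk : k + 1 < n) :
    IsClosedOver n G A (p '' Ioo 0 k) := by
  refine ⟨h.disjoint, ?_, ?_⟩
  · rintro ⟨v, hv, -, hle⟩
    exact absurd (h.one_lt_valencyIn hv) (not_lt.2 hle)
  · rintro ⟨x, hx, hxS⟩
    have := (h.interior_eq hx.injective hk.le hxS).1
    omega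

/-- Interior vertices are not loose ends, so a failure of closedness must come from a clean arc. By
`interior_eq` that arc occupies the same vertices as the ear, whence all their valencies are 2. -/
theorem isCleanArcPathIn (h : IsEar G A k p) (hk : k + 1 = n)
    (hcl : ¬ IsClosedOver n G A (p '' Ioo 0 k)) :
    IsCleanArcPathIn n G (A ∪ p '' Ioo 0 k) (fun i => p i) := by
  obtain ⟨x, hx, hxS⟩ : ∃ x : Fin n → V, IsCleanArcPathIn n G (A ∪ p '' Ioo 0 k) x ∧
      ∀ i : Fin n, 0 < i.val → i.val + 1 < n → x i ∈ p '' Ioo 0 k := by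
    by_contra hno
    refine hcl ⟨h.disjoint, ?_, hno⟩
    rintro ⟨v, hv, -, hle⟩
    exact absurd (h.one_lt_valencyIn hv) (not_lt.2 hle)
  have hS := (h.interior_eq hx.injective hk.le hxS).2
  refine ⟨fun i j hij => Fin.ext (h.injOn (by simp; omega) (by simp; omega) hij),
    fun i => h.mem_union (by omega), fun i j hij => ?_, fun i h0 h1 => ?_⟩
  · have := h.adj i.val (by omega)
    rwa [hij] at this
  · obtain ⟨j, hj0, hj1, hj⟩ := hS (p i) ⟨i, ⟨h0, by omega⟩, rfl⟩
    rw [← hj]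
    exact hx.valency_eq j hj0 hj1

/-- A set closed over `A` together with an ear of length `n - 1`, and adjacent to the interior of
that ear, is closed over `A` when the interior is added to it. -/
theorem isClosedOver_union (h : IsEar G A k p) (hk : k + 1 = n) {D : Set V}
    (hD : IsClosedOver n G (A ∪ p '' Ioo 0 k) D) {s d : V} (hs : s ∈ p '' Ioo 0 k) (hd : d ∈ D)
    (hsd : G.Adj s d) : IsClosedOver n G A (p '' Ioo 0 k ∪ D) := by
  have h2 := h.two_le
  -- A vertex of the ear with a neighbour in `D` is no longer interior to a clean arc. Consequently
  -- a clean arc with interior in the union cannot pass between the ear and `D`. If it lies in the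
  -- ear, it covers the ear and in particular `s`; if it lies in `D`, it contradicts `hD`.
  have h3 : ∀ t ∈ p '' Ioo 0 k, ∀ d ∈ D, G.Adj t d →
      3 ≤ valencyIn G (A ∪ (p '' Ioo 0 k ∪ D)) t := by
    rintro _ ⟨i, ⟨h0, h1⟩, rfl⟩ d hd hid
    have hne : ∀ j ≤ k, p j ≠ d := by
      rintro j hj rfl
      exact hD.disjoint.le_bot ⟨h.mem_union hj, hd⟩
    have hmem : ∀ j ≤ k, p j ∈ A ∪ (p '' Ioo 0 k ∪ D) := fun j hj => by
      rw [← union_assoc]; exact Or.inl (h.mem_union hj)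
    refine three_le_valencyIn (a := p (i - 1)) (b := p (i + 1)) (c := d) (hmem _ (by omega))
      (hmem _ (by omega)) (Or.inr (Or.inr hd)) (fun he => ?_) (hne _ (by omega))
      (hne _ (by omega)) ?_ (h.adj i h1) hid
    · have := h.injOn (by simp; omega) (by simp; omega) he
      omega
    · have := h.adj (i - 1) (by omega)
      rw [Nat.sub_add_cancel h0] at this
      exact this.symm
  have hdisj : Disjoint A (p '' Ioo 0 k ∪ D) := disjoint_union_right.2
    ⟨h.disjoint, hD.disjoint.mono_left subset_union_left⟩
  refine ⟨hdisj, ?_, ?_⟩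
  · rintro ⟨v, hv | hv, -, hle⟩
    · refine absurd ((h.one_lt_valencyIn hv).trans_le (valencyIn_mono ?_ v)) (not_lt.2 hle)
      exact union_subset_union_right _ subset_union_left
    · refine absurd ((hD.one_lt_valencyIn hv).trans_le (valencyIn_mono ?_ v)) (not_lt.2 hle)
      exact (union_assoc _ _ _).subset
  · rintro ⟨x, hx, hxS⟩
    have cross : ∀ i j : Fin n, 0 < i.val → i.val + 1 < n → 0 < j.val → j.val + 1 < n →
        G.Adj (x i) (x j) → x i ∈ p '' Ioo 0 k → x j ∈ p '' Ioo 0 k := by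
      intro i j hi0 hi1 hj0 hj1 hij hi
      refine (hxS j hj0 hj1).resolve_right fun hj => ?_
      have := h3 _ hi _ hj hij
      rw [hx.valency_eq i hi0 hi1] at this
      exact absurd this (by decide)
    have step : ∀ i : ℕ, ∀ hi : i + 2 < n,
        (x ⟨1, by omega⟩ ∈ p '' Ioo 0 k ↔ x ⟨i + 1, by omega⟩ ∈ p '' Ioo 0 k) := by
      intro i
      induction i with
      | zero => intro _; rfl
      | succ i ih =>
        intro hi
        rw [ih (by omega)]
        have hadj := hx.adj ⟨i + 1, by omega⟩ ⟨i + 1 + 1, by omega⟩ (by simp)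
        exact ⟨cross _ _ (by simp) (by simp; omega) (by simp) (by simp; omega) hadj,
          cross _ _ (by simp) (by simp; omega) (by simp) (by simp; omega) hadj.symm⟩
    have all : ∀ i : Fin n, 0 < i.val → i.val + 1 < n →
        (x ⟨1, by omega⟩ ∈ p '' Ioo 0 k ↔ x i ∈ p '' Ioo 0 k) := by
      intro i h0 h1
      have := step (i.val - 1) (by omega)
      convert this using 3
      ext; simp; omega
    by_cases h1 : x ⟨1, by omega⟩ ∈ p '' Ioo 0 k
    · obtain ⟨i, h0, h1, rfl⟩ := (h.interior_eq hx.injective hk.le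
        fun i hi0 hi1 => (all i hi0 hi1).1 h1).2 s hs
      have := h3 _ hs _ hd hsd
      rw [hx.valency_eq i h0 h1] at this
      exact absurd this (by decide)
    · rw [← union_assoc] at hx
      exact hD.no_cleanArc ⟨x, hx, fun i hi0 hi1 =>
        (hxS i hi0 hi1).resolve_left fun hi => h1 ((all i hi0 hi1).2 hi)⟩

theorem finite_interior : (p '' Ioo 0 k).Finite := (finite_Ioo 0 k).image p

theorem adj_one (h : IsEar G A k p) : G.Adj (p 0) (p 1) :=
  h.adj 0 (by have := h.two_le; omega)

theorem one_mem (h : IsEar G A k p) : p 1 ∈ p '' Ioo 0 k :=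
  ⟨1, ⟨by omega, by have := h.two_le; omega⟩, rfl⟩

theorem not_isClosedOver (h : IsEar G A k p) (hf : IsFreeIn n G A (p 0)) :
    ¬ IsClosedOver n G A (p '' Ioo 0 k) := fun hcl =>
  hf.2 _ finite_interior hcl _ h.one_mem h.adj_one

/-- A shorter ear would have an interior closed over `A` and adjacent to the free vertex `p 0`. -/
theorem le_of_isFreeIn (h : IsEar G A k p) (hf : IsFreeIn n G A (p 0)) : n ≤ k + 1 := by
  by_contra! hlt
  exact h.not_isClosedOver hf (h.isClosedOver_of_lt hlt)

/-- Otherwise `D` together with the interior would be closed over `A` and adjacent to the free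
vertex `p 0`. Thus attaching an arc of length `n - 1` at a free vertex creates no new closed sets:
what is closed over `A` and the arc was already closed over `A`. Preservation of freeness and of
strongness follows. -/
theorem not_adj_interior (h : IsEar G A k p) (hf : IsFreeIn n G A (p 0)) (hk : k + 1 = n)
    {D : Set V} (hD : D.Finite) (hcl : IsClosedOver n G (A ∪ p '' Ioo 0 k) D) :
    ∀ s ∈ p '' Ioo 0 k, ∀ d ∈ D, ¬ G.Adj s d := fun _ hs _ hd hsd =>
  hf.2 _ (finite_interior.union hD) (h.isClosedOver_union hk hcl hs hd hsd) _ (Or.inl h.one_mem)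
    h.adj_one

theorem isFreeIn_interior (h : IsEar G A k p) (hf : IsFreeIn n G A (p 0)) (hk : k + 1 = n)
    {s : V} (hs : s ∈ p '' Ioo 0 k) : IsFreeIn n G (A ∪ p '' Ioo 0 k) s :=
  ⟨Or.inr hs, fun _ hD hcl => h.not_adj_interior hf hk hD hcl s hs⟩

theorem isFreeIn_union (h : IsEar G A k p) (hf : IsFreeIn n G A (p 0)) (hk : k + 1 = n)
    {t : V} (ht : IsFreeIn n G A t) : IsFreeIn n G (A ∪ p '' Ioo 0 k) t :=
  ⟨Or.inl ht.1, fun _ hD hcl =>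
    ht.2 _ hD (hcl.of_not_adj (h.not_adj_interior hf hk hD hcl))⟩

theorem isStrong_union (h : IsEar G A k p) (hA : IsStrong n G A univ) (hk : k + 1 = n) :
    IsStrong n G (A ∪ p '' Ioo 0 k) univ := by
  rw [isStrong_univ_iff]
  intro D hD hne hcl
  exact isStrong_univ_iff.1 hA D hD hne
    (hcl.of_not_adj (h.not_adj_interior (hA.isFreeIn h.zero_mem) hk hD hcl))

/-- A path leaving `A` at once and ending in `A` starts with an ear. -/
theorem exists_of_path {l : ℕ} (hp : InjOn p (Iic l)) (hadj : ∀ i < l, G.Adj (p i) (p (i + 1)))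
    (hl0 : 0 < l) (h0 : p 0 ∈ A) (h1 : p 1 ∉ A) (hl : p l ∈ A) : ∃ k ≤ l, IsEar G A k p := by
  classical
  have hex : ∃ k, 0 < k ∧ p k ∈ A := ⟨l, hl0, hl⟩
  have hle : Nat.find hex ≤ l := Nat.find_min' hex ⟨hl0, hl⟩
  obtain ⟨hk0, hk⟩ := Nat.find_spec hex
  refine ⟨Nat.find hex, hle, ?_, hp.mono (Iic_subset_Iic.2 hle),
    fun i hi => hadj i (hi.trans_le hle), h0, hk,
    fun i hi0 hi hiA => Nat.find_min hex hi ⟨hi0, hiA⟩⟩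
  by_contra hlt
  have : Nat.find hex = 1 := by omega
  rw [this] at hk
  exact h1 hk

/-- A path with endpoints in `A` that is not contained in `A` has a segment that is an ear. -/
theorem exists_of_path_of_notMem {l i : ℕ} (hp : InjOn p (Iic l))
    (hadj : ∀ i < l, G.Adj (p i) (p (i + 1))) (h0 : p 0 ∈ A) (hl : p l ∈ A) (hil : i ≤ l)
    (hi : p i ∉ A) : ∃ a k, a + k ≤ l ∧ IsEar G A k (fun j => p (a + j)) := by
  classical
  have ha := Nat.findGreatest_spec (P := fun j => p j ∈ A) (Nat.zero_le i) h0
  have hai := Nat.findGreatest_le (P := fun j => p j ∈ A) i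
  have hmax : ∀ j, Nat.findGreatest (fun j => p j ∈ A) i < j → j ≤ i → p j ∉ A :=
    fun j => Nat.findGreatest_is_greatest
  set a := Nat.findGreatest (fun j => p j ∈ A) i
  have hne : a ≠ i := fun h => hi (h ▸ ha)
  have hil' : i ≠ l := fun h => hi (h ▸ hl)
  obtain ⟨k, hk, hear⟩ := exists_of_path (G := G) (A := A) (p := fun j => p (a + j)) (l := l - a)
    (fun x hx y hy hxy => by
      simp only [mem_Iic] at hx hy
      have := hp (by simp; omega) (by simp; omega) hxy
      omega)
    (fun j hj => hadj (a + j) (by omega)) (by omega) ha (hmax _ (by omega) (by omega))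
    (by rwa [Nat.add_sub_cancel' (by omega)])
  exact ⟨a, k, by omega, hear⟩

end IsEar

/-- In an open graph every finite nonempty set of vertices lies in a finite set with a free vertex
of valency at most two. -/
theorem IsOpenGraph.exists_isFreeIn (hn : 3 ≤ n) (hG : IsOpenGraph n G) {A₀ : Set V}
    (hA₀ : A₀.Finite) (hne : A₀.Nonempty) :
    ∃ A, A₀ ⊆ A ∧ A.Finite ∧ ∃ s, IsFreeIn n G A s ∧ valencyIn G A s ≤ 2 := by
  -- Otherwise every finite `A ⊇ A₀` has a finite set closed over it and adjacent to all its
  -- vertices of valency at most 2. Adding such a set raises each valency below 3; after three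
  -- rounds only the last set `D₃` could contain a loose end or the interior of a clean arc, and it
  -- is closed.
  by_contra! hno
  have hstep : ∀ A, A₀ ⊆ A → A.Finite → ∃ D : Set V, D.Finite ∧ IsClosedOver n G A D ∧
      ∀ s ∈ A, valencyIn G A s ≤ 2 → ∃ d ∈ D, G.Adj s d := by
    intro A hA hfin
    have : ∀ s ∈ A, valencyIn G A s ≤ 2 → ∃ D : Set V, D.Finite ∧ IsClosedOver n G A D ∧
        ∃ d ∈ D, G.Adj s d := by
      intro s hs hle
      by_contra! h
      exact absurd (hno A hA hfin s ⟨hs, fun D h1 h2 d hd => h D h1 h2 d hd⟩) (not_lt.2 hle)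
    choose! D hDf hDc hDa using this
    refine ⟨⋃₀ (D '' {s ∈ A | valencyIn G A s ≤ 2}), ?_, IsClosedOver.sUnion hn ?_, ?_⟩
    · refine ((hfin.subset (sep_subset _ _)).image D).sUnion ?_
      rintro _ ⟨s, ⟨hs, hle⟩, rfl⟩; exact hDf s hs hle
    · rintro _ ⟨s, ⟨hs, hle⟩, rfl⟩; exact hDc s hs hle
    · intro s hs hle
      obtain ⟨d, hd, hsd⟩ := hDa s hs hle
      exact ⟨d, ⟨D s, ⟨s, ⟨hs, hle⟩, rfl⟩, hd⟩, hsd⟩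
  have hinc : ∀ A D : Set V, IsClosedOver n G A D →
      (∀ s ∈ A, valencyIn G A s ≤ 2 → ∃ d ∈ D, G.Adj s d) → ∀ s ∈ A, ∀ k : ℕ, k ≤ 2 →
      (k : ℕ∞) ≤ valencyIn G A s → ((k + 1 : ℕ) : ℕ∞) ≤ valencyIn G (A ∪ D) s := by
    intro A D hcl h s hs k hk hks
    by_cases hle : valencyIn G A s ≤ 2
    · obtain ⟨d, hd, hsd⟩ := h s hs hle
      have hd' : d ∉ G.neighborSet s ∩ A := fun h => hcl.disjoint.le_bot ⟨h.2, hd⟩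
      calc ((k + 1 : ℕ) : ℕ∞) = k + 1 := by push_cast; rfl
        _ ≤ (G.neighborSet s ∩ A).encard + 1 := by gcongr; exact hks
        _ = (insert d (G.neighborSet s ∩ A)).encard := (encard_insert_of_notMem hd').symm
        _ ≤ _ := by
          refine encard_le_encard ?_
          rintro w (rfl | hw)
          · exact ⟨hsd, Or.inr hd⟩
          · exact ⟨hw.1, Or.inl hw.2⟩
    · have h3 : ((k + 1 : ℕ) : ℕ∞) ≤ 2 + 1 := by
        have : k + 1 ≤ 3 := by omega
        exact_mod_cast this
      exact (h3.trans (Order.add_one_le_of_lt (not_le.1 hle))).trans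
        (valencyIn_mono subset_union_left s)
  obtain ⟨D₁, hf₁, hc₁, h₁⟩ := hstep A₀ Subset.rfl hA₀
  have hs₁ : A₀ ⊆ A₀ ∪ D₁ := subset_union_left
  have hA₁ := hA₀.union hf₁
  set A₁ := A₀ ∪ D₁ with hA₁def
  obtain ⟨D₂, hf₂, hc₂, h₂⟩ := hstep A₁ hs₁ hA₁
  have hs₂ : A₀ ⊆ A₁ ∪ D₂ := hs₁.trans subset_union_left
  have hA₂ := hA₁.union hf₂
  set A₂ := A₁ ∪ D₂ with hA₂def
  obtain ⟨D₃, hf₃, hc₃, h₃⟩ := hstep A₂ hs₂ hA₂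
  -- Vertices of `A₀` gain an edge in each of three rounds; those of `D₁` and `D₂` enter with
  -- valency at least 2 and gain one more.
  have hval : ∀ s ∈ A₂, 3 ≤ valencyIn G (A₂ ∪ D₃) s := by
    have two : ∀ {A D : Set V} {s : V}, IsClosedOver n G A D → s ∈ D →
        ((2 : ℕ) : ℕ∞) ≤ valencyIn G (A ∪ D) s := fun hcl hs =>
      two_le_iff_one_lt.2 (hcl.one_lt_valencyIn hs)
    rintro s ((hs | hs) | hs)
    · exact hinc _ _ hc₃ h₃ s (Or.inl (Or.inl hs)) 2 le_rfl (hinc _ _ hc₂ h₂ s (Or.inl hs) 1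
        (by omega) (hinc _ _ hc₁ h₁ s hs 0 (by omega) (by simp)))
    · exact hinc _ _ hc₃ h₃ s (Or.inl (Or.inr hs)) 2 le_rfl
        ((two hc₁ hs).trans (valencyIn_mono subset_union_left s))
    · exact hinc _ _ hc₃ h₃ s (Or.inr hs) 2 le_rfl (two hc₂ hs)
  rcases hG _ (hA₂.union hf₃) (hne.mono (hs₂.trans subset_union_left)) with
    ⟨v, hv | hv, hle⟩ | ⟨x, hx⟩
  · exact absurd ((hval v hv).trans hle) (by decide)
  · exact absurd (hc₃.one_lt_valencyIn hv) (not_lt.2 hle)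
  · refine hc₃.no_cleanArc ⟨x, hx, fun i h0 h1 => (hx.mem i).resolve_left fun hi => ?_⟩
    have := hval _ hi
    rw [hx.valency_eq i h0 h1] at this
    exact absurd this (by decide)

end Ears

end GenPolygon

namespace GenPolygon

open Set

/-! ### Distances, projections and opposite vertices in generalized polygons -/

section Metric

universe u

variable {V : Type u} {n : ℕ} {G : SimpleGraph V}

theorem exists_walk_of_path {p : ℕ → V} (k : ℕ) (hadj : ∀ i < k, G.Adj (p i) (p (i + 1))) :
    ∃ w : G.Walk (p 0) (p k), w.length = k ∧ ∀ i ≤ k, w.getVert i = p i := by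
  induction k with
  | zero => exact ⟨.nil, rfl, fun i hi => by
      obtain rfl : i = 0 := Nat.le_zero.1 hi
      simp⟩
  | succ k ih =>
    obtain ⟨w, hw, hv⟩ := ih fun i hi => hadj i (Nat.lt_succ_of_lt hi)
    refine ⟨w.concat (hadj k k.lt_succ_self), by simp [hw], fun i hi => ?_⟩
    rw [SimpleGraph.Walk.concat_eq_append, SimpleGraph.Walk.getVert_append]
    split_ifs with h
    · exact hv i (by omega)
    · rcases (by omega : i = k ∨ i = k + 1) with rfl | rfl <;> simp [hw]

theorem dist_le_of_path {p : ℕ → V} (k : ℕ) (hadj : ∀ i < k, G.Adj (p i) (p (i + 1))) :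
    G.dist (p 0) (p k) ≤ k := by
  obtain ⟨w, hw, -⟩ := exists_walk_of_path k hadj
  exact (SimpleGraph.dist_le w).trans_eq hw

/-- In a graph of girth at least `m`, paths with common endpoints and total length less than `m`
are equal. -/
theorem path_eq_of_lt_egirth {m : ℕ} (hG : (m : ℕ∞) ≤ G.egirth) {p q : ℕ → V} {k l : ℕ}
    (hp : InjOn p (Iic k)) (hpa : ∀ i < k, G.Adj (p i) (p (i + 1)))
    (hq : InjOn q (Iic l)) (hqa : ∀ i < l, G.Adj (q i) (q (i + 1)))
    (h0 : p 0 = q 0) (hk : p k = q l) (hlt : k + l < m) : k = l ∧ ∀ i ≤ k, p i = q i := by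
  obtain ⟨w, hw, hwv⟩ := exists_walk_of_path k hpa
  obtain ⟨w', hw', hwv'⟩ := exists_walk_of_path l hqa
  have hwp : w.IsPath := by
    rw [← SimpleGraph.Walk.IsPath.getVert_injOn_iff, hw]
    intro i hi j hj hij
    rw [hwv i hi, hwv j hj] at hij
    exact hp hi hj hij
  have hwp' : w'.IsPath := by
    rw [← SimpleGraph.Walk.IsPath.getVert_injOn_iff, hw']
    intro i hi j hj hij
    rw [hwv' i hi, hwv' j hj] at hij
    exact hq hi hj hij
  have heq : w = w'.copy h0.symm hk.symm := by
    by_contra hne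
    have hwp'' : (w'.copy h0.symm hk.symm).IsPath := by simpa using hwp'
    obtain ⟨x, -, -, c, hc, hle⟩ := hwp.exists_isCycle_length_le_add_of_ne hwp'' hne
    have h1 := hG.trans (SimpleGraph.egirth_le_length hc)
    rw [SimpleGraph.Walk.length_copy, hw, hw'] at hle
    have h2 : m ≤ c.length := by exact_mod_cast h1
    omega
  have hkl : k = l := by rw [← hw, heq, SimpleGraph.Walk.length_copy, hw']
  refine ⟨hkl, fun i hi => ?_⟩
  rw [← hwv i hi, heq, SimpleGraph.Walk.getVert_copy, hwv' i (hkl ▸ hi)]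

theorem exists_geodesic {a b : V} (h : G.Reachable a b) : ∃ p : ℕ → V, p 0 = a ∧
    p (G.dist a b) = b ∧ (∀ i < G.dist a b, G.Adj (p i) (p (i + 1))) ∧
    (∀ i ≤ G.dist a b, G.dist (p i) b = G.dist a b - i) ∧ InjOn p (Iic (G.dist a b)) := by
  obtain ⟨w, hw⟩ := h.exists_walk_length_eq_dist
  have hd : ∀ i ≤ G.dist a b, G.dist (w.getVert i) b = G.dist a b - i := by
    intro i hi
    have h1 := SimpleGraph.dist_le (w.drop i)
    have h2 := SimpleGraph.dist_le (w.take i)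
    rw [SimpleGraph.Walk.drop_length] at h1
    rw [SimpleGraph.Walk.take_length] at h2
    have h3 := (w.take i).reachable.dist_triangle_left b
    omega
  refine ⟨w.getVert, by simp, by rw [← hw]; simp, fun i hi => w.adj_getVert_succ (by omega), hd, ?_⟩
  intro i hi j hj hij
  have h1 := hd i hi
  have h2 := hd j hj
  rw [hij] at h1
  simp only [mem_Iic] at hi hj
  omega

namespace IsGeneralizedPolygon

theorem reachable (hG : IsGeneralizedPolygon n G) (a b : V) : G.Reachable a b :=
  SimpleGraph.preconnected_of_ediam_ne_top (by rw [hG.ediam_eq]; simp) a b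

theorem dist_le (hG : IsGeneralizedPolygon n G) (a b : V) : G.dist a b ≤ n := by
  have h : G.edist a b ≤ n := SimpleGraph.edist_le_ediam.trans_eq hG.ediam_eq
  have h' := ENat.toNat_le_toNat h (by simp)
  simpa [SimpleGraph.dist] using h'

/-- The colours of two vertices determine the parity of their distance, so the distances of adjacent
vertices to `p` differ in parity; they differ by at most 1. -/
theorem dist_adj (hG : IsGeneralizedPolygon n G) {a b : V} (hab : G.Adj a b) (p : V) :
    G.dist b p = G.dist a p + 1 ∨ G.dist a p = G.dist b p + 1 := by
  obtain ⟨c⟩ := hG.isBipartite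
  set c' := SimpleGraph.recolorOfEquiv G finTwoEquiv c
  obtain ⟨w, hw⟩ := (hG.reachable a p).exists_walk_length_eq_dist
  obtain ⟨w', hw'⟩ := (hG.reachable b p).exists_walk_length_eq_dist
  have h1 := c'.even_length_iff_congr w
  have h2 := c'.even_length_iff_congr w'
  have h3 : c' a ≠ c' b := c'.valid hab
  rw [hw] at h1
  rw [hw'] at h2
  have h4 := hab.diff_dist_adj (u := p)
  rw [SimpleGraph.dist_comm (u := p), SimpleGraph.dist_comm (u := p)] at h4
  have h5 : ¬ (Even (G.dist a p) ↔ Even (G.dist b p)) := by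
    rw [h1, h2, ← Bool.eq_iff_iff, ← Bool.eq_iff_iff]
    cases ha : c' a <;> cases hb : c' b <;> cases hp : c' p <;> simp_all
  rcases h4 with h4 | h4 | h4
  · rw [h4] at h5; exact absurd Iff.rfl h5
  · exact Or.inl h4
  · right
    by_cases h0 : G.dist a p = 0
    · rw [h0] at h4; rw [h4, h0] at h5; exact absurd Iff.rfl h5
    · omega

theorem even_dist_iff (hG : IsGeneralizedPolygon n G) (c : G.Coloring Bool) (a b : V) :
    Even (G.dist a b) ↔ c a = c b := by
  obtain ⟨w, hw⟩ := (hG.reachable a b).exists_walk_length_eq_dist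
  rw [← hw, c.even_length_iff_congr w, ← Bool.eq_iff_iff]

/-- Geodesics from `a` to `p` through `b` and through `b'` have total length below the girth `2n`,
so they coincide. -/
theorem eq_of_closer (hG : IsGeneralizedPolygon n G) {a b b' p : V} (hab : G.Adj a b)
    (hab' : G.Adj a b') (hlt : G.dist a p < n) (hb : G.dist a p = G.dist b p + 1)
    (hb' : G.dist a p = G.dist b' p + 1) : b = b' := by
  have key : ∀ b, G.Adj a b → G.dist a p = G.dist b p + 1 → ∃ q : ℕ → V, q 0 = a ∧ q 1 = b ∧
      q (G.dist a p) = p ∧ (∀ i < G.dist a p, G.Adj (q i) (q (i + 1))) ∧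
      InjOn q (Iic (G.dist a p)) := by
    intro b hab hb
    obtain ⟨q, h0, hk, hadj, hd, hinj⟩ := exists_geodesic (hG.reachable b p)
    refine ⟨fun i => if i = 0 then a else q (i - 1), by simp, by simp [h0], by simp [hb, hk],
      fun i hi => ?_, fun i hi j hj hij => ?_⟩
    · rcases Nat.eq_zero_or_pos i with rfl | hi0
      · simpa [h0] using hab
      · have := hadj (i - 1) (by omega)
        rw [Nat.sub_add_cancel hi0] at this
        simpa [hi0.ne'] using this
    · simp only [mem_Iic] at hi hj
      have hne : ∀ m < G.dist a p, a ≠ q m := by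
        intro m hm he
        have := hd m (by omega)
        rw [← he] at this
        omega
      by_cases hi0 : i = 0 <;> by_cases hj0 : j = 0
      · omega
      · simp only [hi0, hj0, if_true, if_false] at hij
        exact absurd hij (hne _ (by omega))
      · simp only [hi0, hj0, if_true, if_false] at hij
        exact absurd hij.symm (hne _ (by omega))
      · simp only [hi0, hj0, if_false] at hij
        have := hinj (by simp; omega) (by simp; omega) hij
        omega
  obtain ⟨q, h0, h1, hk, hadj, hinj⟩ := key b hab hb
  obtain ⟨q', h0', h1', hk', hadj', hinj'⟩ := key b' hab' hb'
  have := (path_eq_of_lt_egirth (m := 2 * n) hG.egirth_eq.ge hinj hadj hinj' hadj'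
    (h0.trans h0'.symm) (hk.trans hk'.symm) (by omega)).2 1 (by omega)
  rw [← h1, this, h1']

theorem exists_three_adj (hG : IsGeneralizedPolygon n G) (v : V) :
    ∃ w : Fin 3 → V, Function.Injective w ∧ ∀ i, G.Adj v (w i) :=
  exists_three (hG.thick v)

/-- At most one neighbour of `v` is closer to `p` and at most one is closer to `q`, which leaves one
of any three. -/
theorem exists_farther (hG : IsGeneralizedPolygon n G) {v : V} {w : Fin 3 → V}
    (hw : Function.Injective w) (hvw : ∀ i, G.Adj v (w i)) {p q : V} (hp : G.dist v p < n)
    (hq : G.dist v q < n) :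
    ∃ i, G.dist (w i) p = G.dist v p + 1 ∧ G.dist (w i) q = G.dist v q + 1 := by
  by_contra! hno
  have h : ∀ i, G.dist v p = G.dist (w i) p + 1 ∨ G.dist v q = G.dist (w i) q + 1 := by
    intro i
    rcases hG.dist_adj (hvw i) p with h | h
    · exact Or.inr ((hG.dist_adj (hvw i) q).resolve_left (hno i h))
    · exact Or.inl h
  have hP : ∀ i j, i ≠ j → G.dist v p = G.dist (w i) p + 1 →
      G.dist v p ≠ G.dist (w j) p + 1 := fun i j hij h1 h2 =>
    hij (hw (hG.eq_of_closer (hvw i) (hvw j) hp h1 h2))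
  have hQ : ∀ i j, i ≠ j → G.dist v q = G.dist (w i) q + 1 →
      G.dist v q ≠ G.dist (w j) q + 1 := fun i j hij h1 h2 =>
    hij (hw (hG.eq_of_closer (hvw i) (hvw j) hq h1 h2))
  have p01 := hP 0 1 (by decide)
  have p02 := hP 0 2 (by decide)
  have p12 := hP 1 2 (by decide)
  have q01 := hQ 0 1 (by decide)
  have q02 := hQ 0 2 (by decide)
  have q12 := hQ 1 2 (by decide)
  have h0 := h 0
  have h1 := h 1
  have h2 := h 2
  tauto

/-- Some finite set contains a vertex opposite to both members of any pair of vertices of the same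
colour. -/
theorem exists_finite_opposite (hG : IsGeneralizedPolygon n G) (c : G.Coloring Bool) (v : V) :
    ∃ U : Set V, U.Finite ∧ ∀ p q, c p = c q → ∃ u ∈ U, G.dist u p = n ∧ G.dist u q = n := by
  choose w hw hvw using hG.exists_three_adj
  -- Here `k` bounds half the amount by which the two distances fall short of `2n`. Moving to a
  -- neighbour farther from both `p` and `q` lowers it by one. The three chosen neighbours at each
  -- vertex form a finite tree of candidates that serves all pairs simultaneously.
  have key : ∀ k : ℕ, ∀ v : V, ∃ U : Set V, U.Finite ∧ ∀ p q, c p = c q →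
      2 * n ≤ G.dist v p + G.dist v q + 2 * k → ∃ u ∈ U, G.dist u p = n ∧ G.dist u q = n := by
    intro k
    induction k with
    | zero =>
      intro v
      refine ⟨{v}, finite_singleton v, fun p q _ h => ⟨v, rfl, ?_⟩⟩
      have h1 := hG.dist_le v p
      have h2 := hG.dist_le v q
      constructor <;> omega
    | succ k ih =>
      intro v
      choose U hU hUo using ih
      refine ⟨{v} ∪ (⋃ i, U (w v i)) ∪ ⋃ i, ⋃ j, U (w (w v i) j),
        ((finite_singleton v).union (finite_iUnion fun i => hU _)).union
          (finite_iUnion fun i => finite_iUnion fun j => hU _), fun p q hpq h => ?_⟩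
      -- When `v` is already opposite `p`, two moves are needed: the first gains distance from `q`
      -- and drops that from `p` to `n - 1`. By parity `q` is then still not opposite, so the second
      -- move gains on both.
      have step : ∀ p q, c p = c q → 2 * n ≤ G.dist v p + G.dist v q + 2 * (k + 1) →
          G.dist v p = n → G.dist v q ≠ n →
          ∃ i j, ∃ u ∈ U (w (w v i) j), G.dist u p = n ∧ G.dist u q = n := by
        intro p q hpq h hpn hqn
        have hq := hG.dist_le v q
        have hpar : Even (G.dist v p) ↔ Even (G.dist v q) := by
          rw [hG.even_dist_iff c, hG.even_dist_iff c, hpq]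
        obtain ⟨i, hi, -⟩ := hG.exists_farther (hw v) (hvw v) (p := q) (q := q)
          (by omega) (by omega)
        have hip : G.dist (w v i) p + 1 = n := by
          have := hG.dist_adj (hvw v i) p
          have := hG.dist_le (w v i) p
          omega
        have hne : G.dist v q + 1 ≠ n := fun he => by
          rw [hpn, ← he, Nat.even_add_one] at hpar
          tauto
        obtain ⟨j, hjp, hjq⟩ := hG.exists_farther (hw (w v i)) (hvw (w v i)) (p := p) (q := q)
          (by omega) (by omega)
        exact ⟨i, j, hUo (w (w v i) j) p q hpq (by omega)⟩
      have hp := hG.dist_le v p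
      have hq := hG.dist_le v q
      by_cases hpn : G.dist v p = n
      · by_cases hqn : G.dist v q = n
        · exact ⟨v, Or.inl (Or.inl rfl), hpn, hqn⟩
        · obtain ⟨i, j, u, hu, huo⟩ := step p q hpq h hpn hqn
          exact ⟨u, Or.inr (mem_iUnion₂.2 ⟨i, j, hu⟩), huo⟩
      · by_cases hqn : G.dist v q = n
        · obtain ⟨i, j, u, hu, huo⟩ := step q p hpq.symm (by omega) hqn hpn
          exact ⟨u, Or.inr (mem_iUnion₂.2 ⟨i, j, hu⟩), huo.symm⟩
        · obtain ⟨i, hip, hiq⟩ := hG.exists_farther (hw v) (hvw v) (p := p) (q := q)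
            (by omega) (by omega)
          obtain ⟨u, hu, huo⟩ := hUo (w v i) p q hpq (by omega)
          exact ⟨u, Or.inl (Or.inr (mem_iUnion.2 ⟨i, hu⟩)), huo⟩
  obtain ⟨U, hU, h⟩ := key n v
  exact ⟨U, hU, fun p q hpq => h p q hpq (by omega)⟩

end IsGeneralizedPolygon

end Metric

end GenPolygon

namespace GenPolygon

open Set

/-! ### Towers of clean arcs and loose ends with large closed sets -/

section Towers

universe u

variable {V : Type u} {n : ℕ} {G : SimpleGraph V}

/-- Every pair of vertices of the same colour has a common opposite vertex in `U`. -/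
def IsOppositeSet (n : ℕ) (G : SimpleGraph V) (c : G.Coloring Bool) (U : Set V) : Prop :=
  ∀ p q, c p = c q → ∃ u ∈ U, G.dist u p = n ∧ G.dist u q = n

theorem IsEar.eq_or_eq_of_adj {A : Set V} {k : ℕ} {p : ℕ → V} (h : IsEar G A k p) (hk : k + 1 = n)
    (hf : IsFreeIn n G A (p 0)) {i : ℕ} (h0 : 0 < i) (hi : i < k) {v : V}
    (hv : v ∈ A ∪ p '' Ioo 0 k) (hiv : G.Adj (p i) v) : v = p (i - 1) ∨ v = p (i + 1) := by
  have hval := (h.isCleanArcPathIn hk (h.not_isClosedOver hf)).valency_eq ⟨i, by omega⟩ h0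
    (by simp; omega)
  refine eq_or_eq_of_valencyIn_eq_two hval (h.mem_union (by omega)) (h.mem_union (by omega))
    (fun he => ?_) ?_ (h.adj i hi) hv hiv
  · have := h.injOn (by simp; omega) (by simp; omega) he
    omega
  · have := h.adj (i - 1) (by omega)
    rw [Nat.sub_add_cancel h0] at this
    exact this.symm

/-- Choose `u ∈ U` opposite both `a` and `b`; then `s` is at distance `n - 1` from `u`. The second
vertex of a geodesic from `s` to `u` is at distance `n - 2`, so it is neither `a` nor `b` and lies
outside `T`. The ear that begins there has length at least `n - 1` since `s` is free, hence is the
whole geodesic. -/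
theorem IsGeneralizedPolygon.exists_isEar (hG : IsGeneralizedPolygon n G) (hn : 3 ≤ n)
    {c : G.Coloring Bool} {U T : Set V} (hU : IsOppositeSet n G c U) (hUT : U ⊆ T) {s a b : V}
    (hs : IsFreeIn n G T s) (hsa : G.Adj s a) (hsb : G.Adj s b)
    (hT : ∀ v ∈ T, G.Adj s v → v = a ∨ v = b) :
    ∃ p : ℕ → V, IsEar G T (n - 1) p ∧ p 0 = s ∧ p (n - 1) ∈ U := by
  have hab : c a = c b := by
    have h1 := c.valid hsa
    have h2 := c.valid hsb
    cases h : c s <;> cases h' : c a <;> cases h'' : c b <;> simp_all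
  obtain ⟨u, hu, hua, hub⟩ := hU a b hab
  rw [SimpleGraph.dist_comm] at hua hub
  have hsu : G.dist s u = n - 1 := by
    have := hG.dist_adj hsa u
    have := hG.dist_le s u
    omega
  obtain ⟨p, h0, hl, hadj, hd, hinj⟩ := exists_geodesic (hG.reachable s u)
  rw [hsu] at hl hadj hd hinj
  have h1 : p 1 ∉ T := by
    intro h1
    have hd1 := hd 1 (by omega)
    have := hadj 0 (by omega)
    rw [h0] at this
    rcases hT _ h1 this with h | h <;> rw [h] at hd1 <;> omega
  obtain ⟨k, hk, hear⟩ := IsEar.exists_of_path hinj hadj (by omega) (h0 ▸ hs.1) h1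
    (hl ▸ hUT hu)
  have := hear.le_of_isFreeIn (h0 ▸ hs)
  obtain rfl : k = n - 1 := by omega
  exact ⟨p, hear, h0, hl ▸ hu⟩

/-- If a finite set `D` closed over `A₀ ∪ Z` contains `w`, and `D ∪ Z` leaves `T` at the
vertices of `T` outside `A₁` only through an edge at `w`, then `D` has at least `N` elements
in `T` outside `A₁`. -/
def HasDepth (n : ℕ) (G : SimpleGraph V) (A₀ A₁ T : Set V) (w : V) (N : ℕ) : Prop :=
  ∀ (D Z : Set V) (w' : V), D.Finite → IsClosedOver n G (A₀ ∪ Z) D → Disjoint Z T → w ∈ D →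
    w' ∈ D ∪ Z → w' ∉ T →
    (∀ t ∈ T, t ∉ A₁ → ∀ v ∈ D ∪ Z, v ∉ T → G.Adj t v → t = w ∧ v = w') →
    N ≤ (D ∩ (T \ A₁)).ncard

/-- A finite extension `T` of `A₁` all of whose new vertices are free, with a last vertex `w` of
given depth. -/
structure IsTower (n : ℕ) (G : SimpleGraph V) (A₀ A₁ : Set V) (N : ℕ) (T : Set V) (w : V) :
    Prop where
  finite : T.Finite
  subset : A₁ ⊆ T
  mem : w ∈ T
  notMem : w ∉ A₁
  free : ∀ t ∈ T, t ∉ A₁ → IsFreeIn n G T t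
  exists_adj : ∃ a b, G.Adj w a ∧ G.Adj w b ∧ ∀ v ∈ T, G.Adj w v → v = a ∨ v = b
  hasDepth : HasDepth n G A₀ A₁ T w N

variable {A₀ A₁ T U : Set V} {p : ℕ → V} {w : V} {N : ℕ}

theorem IsEar.isTower (hn : 3 ≤ n) (h : IsEar G T (n - 1) p) (hf : IsFreeIn n G T (p 0))
    (hT : T.Finite) (hA : A₁ ⊆ T) (hfree : ∀ t ∈ T, t ∉ A₁ → IsFreeIn n G T t)
    (hd : HasDepth n G A₀ A₁ (T ∪ p '' Ioo 0 (n - 1)) (p 1) N) :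
    IsTower n G A₀ A₁ N (T ∪ p '' Ioo 0 (n - 1)) (p 1) := by
  have hk : n - 1 + 1 = n := by omega
  refine ⟨hT.union IsEar.finite_interior, hA.trans subset_union_left, Or.inr h.one_mem,
    fun h1 => h.notMem 1 (by omega) (by omega) (hA h1), ?_,
    ⟨p 0, p 2, h.adj_one.symm, h.adj 1 (by omega), fun v hv h1v =>
      h.eq_or_eq_of_adj hk hf (by omega) (by omega) hv h1v⟩, hd⟩
  rintro t (ht | ht) htA
  · exact h.isFreeIn_union hf hk (hfree t ht htA)
  · exact h.isFreeIn_interior hf hk ht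

/-- An arc attached at a free vertex is joined to `T` only at its two ends, and the far end lies in
`A₁`. -/
theorem IsTower.eq_of_adj (ht : IsTower n G A₀ A₁ N T w) (hn : 3 ≤ n)
    (h : IsEar G T (n - 1) p) (h0 : p 0 = w) (hl : p (n - 1) ∈ A₁) {t v : V} (htT : t ∈ T)
    (htA : t ∉ A₁) (hv : v ∈ p '' Ioo 0 (n - 1)) (htv : G.Adj t v) : t = w ∧ v = p 1 := by
  have hf : IsFreeIn n G T (p 0) := h0 ▸ ht.free w ht.mem ht.notMem
  obtain ⟨i, ⟨hi0, hi⟩, rfl⟩ := hv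
  rcases h.eq_or_eq_of_adj (by omega) hf hi0 hi (Or.inl htT) htv.symm with rfl | rfl
  · rcases (by omega : i = 1 ∨ 1 < i) with rfl | hi1
    · exact ⟨h0, rfl⟩
    · exact absurd htT (h.notMem _ (by omega) (by omega))
  · rcases (by omega : i + 1 = n - 1 ∨ i + 1 < n - 1) with he | hi1
    · rw [he] at htA; exact absurd hl htA
    · exact absurd htT (h.notMem _ (by omega) (by omega))

/-- A closed set that contains `p 1` must also contain `w = p 0`. The depth of the old tower then
applies to `w`, with `p 1` as its outside neighbour, and `p 1` itself is one more element. -/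
theorem IsTower.hasDepth_succ (ht : IsTower n G A₀ A₁ N T w) (hn : 3 ≤ n) (hA : A₀ ⊆ A₁)
    (h : IsEar G T (n - 1) p) (h0 : p 0 = w) (hl : p (n - 1) ∈ A₀) :
    HasDepth n G A₀ A₁ (T ∪ p '' Ioo 0 (n - 1)) (p 1) (N + 1) := by
  have hf : IsFreeIn n G T (p 0) := h0 ▸ ht.free w ht.mem ht.notMem
  have hk : n - 1 + 1 = n := by omega
  intro D Z w' hD hcl hZ h1D hw' hw'T hedge
  have hA₀T : A₀ ⊆ T := hA.trans ht.subset
  have hSA : ∀ i, 0 < i → i < n - 1 → p i ∉ A₀ ∪ Z := by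
    rintro i hi0 hi (hiA | hiZ)
    · exact h.notMem i hi0 hi (hA₀T hiA)
    · exact hZ.le_bot ⟨hiZ, Or.inr ⟨i, ⟨hi0, hi⟩, rfl⟩⟩
  have hwA : w ∉ A₀ ∪ Z := by
    rintro (hwA | hwZ)
    · exact ht.notMem (hA hwA)
    · exact hZ.le_bot ⟨hwZ, Or.inl ht.mem⟩
  have hadjP : ∀ i, 0 < i → i < n - 1 → ∀ v ∈ A₀ ∪ Z ∪ D, G.Adj (p i) v →
      v = p (i - 1) ∨ v = p (i + 1) ∨ (p i = p 1 ∧ v = w') := by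
    intro i hi0 hi v hv hiv
    by_cases hvT : v ∈ T ∪ p '' Ioo 0 (n - 1)
    · rcases h.eq_or_eq_of_adj hk hf hi0 hi hvT hiv with h | h
      exacts [Or.inl h, Or.inr (Or.inl h)]
    · refine Or.inr (Or.inr (hedge _ (Or.inr ⟨i, ⟨hi0, hi⟩, rfl⟩)
        (fun hi' => h.notMem i hi0 hi (ht.subset hi')) v ?_ hvT hiv))
      rcases hv with (hv | hv) | hv
      · exact absurd (Or.inl (hA₀T hv)) hvT
      · exact Or.inr hv
      · exact Or.inl hv
  -- If `w ∉ D`, the only possible neighbours of `p 1` are `w'` and `p 2`, and both must be present.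
  -- Each later `p i` likewise needs its successor, so `D` contains all of the interior, and `(w', p
  -- 1, …, p (n - 1))` is a path whose interior is a clean arc in `D`.
  have hwD : w ∈ D := by
    by_contra hwD
    have hwP : p 0 ∉ A₀ ∪ Z ∪ D := by
      rw [h0]; rintro (hw | hw)
      exacts [hwA hw, hwD hw]
    have h1v : ∀ v ∈ A₀ ∪ Z ∪ D, G.Adj (p 1) v → v = w' ∨ v = p 2 := by
      intro v hv h1v
      rcases hadjP 1 (by omega) (by omega) v hv h1v with rfl | h | h
      exacts [absurd hv hwP, Or.inr h, Or.inl h.2]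
    have hne : ∀ i ≤ n - 1, w' ≠ p i := by
      rintro i hi rfl; exact hw'T (h.mem_union hi)
    obtain ⟨a, ha, b, hb, hab, h1a, h1b⟩ :=
      exists_of_one_lt_valencyIn (hcl.one_lt_valencyIn h1D)
    have hP2 : p 2 ∈ A₀ ∪ Z ∪ D ∧ w' ∈ A₀ ∪ Z ∪ D ∧ G.Adj (p 1) w' := by
      rcases h1v a ha h1a with rfl | rfl <;> rcases h1v b hb h1b with rfl | rfl
      · exact absurd rfl hab
      · exact ⟨hb, ha, h1a⟩
      · exact ⟨ha, hb, h1b⟩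
      · exact absurd rfl hab
    have hval1 : valencyIn G (A₀ ∪ Z ∪ D) (p 1) = 2 :=
      valencyIn_eq_two hP2.2.1 hP2.1 (hne 2 (by omega)) hP2.2.2 (h.adj 1 (by omega)) h1v
    have hi2 : ∀ i, 2 ≤ i → i < n - 1 → p i ∈ A₀ ∪ Z ∪ D →
        p (i + 1) ∈ A₀ ∪ Z ∪ D ∧ valencyIn G (A₀ ∪ Z ∪ D) (p i) = 2 := by
      intro i hi2 hi hiP
      have hiD : p i ∈ D := hiP.resolve_left (hSA i (by omega) hi)
      have hiv : ∀ v ∈ A₀ ∪ Z ∪ D, G.Adj (p i) v → v = p (i - 1) ∨ v = p (i + 1) := by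
        intro v hv hiv
        rcases hadjP i (by omega) hi v hv hiv with h' | h' | h'
        · exact Or.inl h'
        · exact Or.inr h'
        · have := h.injOn (by simp; omega) (by simp; omega) h'.1
          omega
      obtain ⟨a, ha, b, hb, hab, hia, hib⟩ :=
        exists_of_one_lt_valencyIn (hcl.one_lt_valencyIn hiD)
      rcases hiv a ha hia with rfl | rfl <;> rcases hiv b hb hib with rfl | rfl
      · exact absurd rfl hab
      · exact ⟨hb, valencyIn_eq_two ha hb hab hia hib hiv⟩
      · exact ⟨ha, valencyIn_eq_two hb ha hab.symm hib hia hiv⟩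
      · exact absurd rfl hab
    have hiP : ∀ i, 2 ≤ i → i ≤ n - 1 → p i ∈ A₀ ∪ Z ∪ D := by
      intro i hi
      induction i, hi using Nat.le_induction with
      | base => intro _; exact hP2.1
      | succ i hi ih => intro hi'; exact (hi2 i hi (by omega) (ih (by omega))).1
    have hiP' : ∀ i, 1 ≤ i → i ≤ n - 1 → p i ∈ A₀ ∪ Z ∪ D := by
      intro i hi1 hi
      rcases hi1.eq_or_lt with rfl | hi2
      exacts [Or.inr h1D, hiP i hi2 hi]
    refine hcl.no_cleanArc ⟨fun i => if i.val = 0 then w' else p i, ⟨?_, ?_, ?_, ?_⟩, ?_⟩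
    · intro i j hij
      by_cases hi : i.val = 0 <;> by_cases hj : j.val = 0 <;> simp only [hi, hj, if_true,
        if_false] at hij
      · ext; omega
      · exact absurd hij (hne _ (by omega))
      · exact absurd hij.symm (hne _ (by omega))
      · exact Fin.ext (h.injOn (by simp; omega) (by simp; omega) hij)
    · intro i
      by_cases hi : i.val = 0
      · simp only [hi, if_true]; exact hP2.2.1
      · simp only [hi, if_false]; exact hiP' i (by omega) (by omega)
    · intro i j hij
      by_cases hi : i.val = 0
      · have hj : j.val = 1 := by omega
        simp only [hi, hj, if_true, one_ne_zero, if_false]; exact hP2.2.2.symm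
      · simp only [hi, if_false, ← hij, Nat.add_one_ne_zero]
        exact h.adj _ (by omega)
    · intro i hi0 hi
      simp only [hi0.ne', if_false]
      rcases (by omega : i.val = 1 ∨ 2 ≤ i.val) with hi1 | hi2'
      · rw [hi1]; exact hval1
      · exact (hi2 i hi2' (by omega) (hiP _ hi2' (by omega))).2
    · intro i hi0 hi
      simp only [hi0.ne', if_false]
      exact (hiP' i hi0 (by omega)).resolve_left (hSA i hi0 (by omega))
  have hN := ht.hasDepth D Z (p 1) hD hcl (hZ.mono_right subset_union_left) hwD (Or.inl h1D)
    (h.notMem 1 (by omega) (by omega)) (by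
      intro t htT htA v hv hvT htv
      by_cases hvS : v ∈ p '' Ioo 0 (n - 1)
      · exact ht.eq_of_adj hn h h0 (hA hl) htT htA hvS htv
      · have := hedge t (Or.inl htT) htA v hv (by rintro (h | h); exacts [hvT h, hvS h]) htv
        exact absurd (this.1 ▸ htT) (h.notMem 1 (by omega) (by omega)))
  calc N + 1 ≤ (D ∩ (T \ A₁)).ncard + 1 := by omega
    _ = (insert (p 1) (D ∩ (T \ A₁))).ncard := by
      rw [ncard_insert_of_notMem _ (hD.subset inter_subset_left)]
      exact fun hp => h.notMem 1 (by omega) (by omega) hp.2.1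
    _ ≤ _ := by
      refine ncard_le_ncard ?_ (hD.subset inter_subset_left)
      rintro v (rfl | ⟨hvD, hvT, hvA⟩)
      · exact ⟨h1D, Or.inr h.one_mem, fun h1 => h.notMem 1 (by omega) (by omega) (ht.subset h1)⟩
      · exact ⟨hvD, Or.inl hvT, hvA⟩

theorem IsTower.exists_isEar (ht : IsTower n G A₀ A₁ N T w) (hG : IsGeneralizedPolygon n G)
    (hn : 3 ≤ n) {c : G.Coloring Bool} (hU : IsOppositeSet n G c U) (hUA : U ⊆ A₁) :
    ∃ p : ℕ → V, IsEar G T (n - 1) p ∧ p 0 = w ∧ p (n - 1) ∈ U := by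
  obtain ⟨a, b, ha, hb, hab⟩ := ht.exists_adj
  exact hG.exists_isEar hn hU (hUA.trans ht.subset) (ht.free w ht.mem ht.notMem) ha hb hab

theorem IsTower.exists_succ (ht : IsTower n G A₀ A₁ N T w) (hG : IsGeneralizedPolygon n G)
    (hn : 3 ≤ n) {c : G.Coloring Bool} (hU : IsOppositeSet n G c U) (hUA : U ⊆ A₀)
    (hA : A₀ ⊆ A₁) : ∃ T' w', IsTower n G A₀ A₁ (N + 1) T' w' ∧ c w' ≠ c w := by
  obtain ⟨p, hp, h0, hl⟩ := ht.exists_isEar hG hn hU (hUA.trans hA)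
  have hf : IsFreeIn n G T (p 0) := h0 ▸ ht.free w ht.mem ht.notMem
  exact ⟨_, p 1, hp.isTower hn hf ht.finite ht.subset ht.free
    (ht.hasDepth_succ hn hA hp h0 (hUA hl)), (h0 ▸ c.valid hp.adj_one).symm⟩

theorem IsTower.mono {M : ℕ} (ht : IsTower n G A₀ A₁ N T w) (hM : M ≤ N) :
    IsTower n G A₀ A₁ M T w :=
  { ht with hasDepth := fun D Z w' h1 h2 h3 h4 h5 h6 h7 =>
      hM.trans (ht.hasDepth D Z w' h1 h2 h3 h4 h5 h6 h7) }

/-- Start with one arc at a free vertex of valency at most 2 and iterate `IsTower.exists_succ`. The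
last vertex changes colour at each step, so an extra step supplies the other colour at depth 0, and
the induction keeps both colours available. -/
theorem IsOpenGraph.exists_isTower (hO : IsOpenGraph n G) (hG : IsGeneralizedPolygon n G)
    (hn : 3 ≤ n) {c : G.Coloring Bool} (hU : IsOppositeSet n G c U) (hUA : U ⊆ A₀)
    (hA₀ : A₀.Finite) (hne : A₀.Nonempty) : ∃ A₁, A₀ ⊆ A₁ ∧ ∀ (N : ℕ) (κ : Bool), ∃ T w,
      IsTower n G A₀ A₁ N T w ∧ c w = κ := by
  obtain ⟨A₁, hA, hA₁, s, hs, hval⟩ := hO.exists_isFreeIn hn hA₀ hne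
  -- If `s` has fewer than two neighbours in `A₁`, then `a` and `b` are taken equal, and possibly
  -- outside `A₁`.
  have hab : ∃ a b, G.Adj s a ∧ G.Adj s b ∧ ∀ v ∈ A₁, G.Adj s v → v = a ∨ v = b := by
    by_cases h1 : ∃ a ∈ A₁, G.Adj s a
    · obtain ⟨a, haA, ha⟩ := h1
      by_cases h2 : ∃ b ∈ A₁, G.Adj s b ∧ b ≠ a
      · obtain ⟨b, hbA, hb, hba⟩ := h2
        refine ⟨a, b, ha, hb, fun v hv hsv => ?_⟩
        by_contra! hne
        have := three_le_valencyIn haA hbA hv hba.symm hne.1.symm hne.2.symm ha hb hsv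
        exact absurd (this.trans hval) (by decide)
      · push Not at h2
        exact ⟨a, a, ha, ha, fun v hv hsv => Or.inl (h2 v hv hsv)⟩
    · push Not at h1
      obtain ⟨w, -, hw⟩ := hG.exists_three_adj s
      exact ⟨w 0, w 0, hw 0, hw 0, fun v hv hsv => absurd hsv (h1 v hv)⟩
  obtain ⟨a, b, ha, hb, hab⟩ := hab
  obtain ⟨p, hp, h0, hl⟩ := hG.exists_isEar hn hU (hUA.trans hA) hs ha hb hab
  have htow := hp.isTower (A₀ := A₀) (A₁ := A₁) (N := 0) hn (h0 ▸ hs) hA₁ Subset.rfl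
    (fun t ht htA => absurd ht htA) (fun _ _ _ _ _ _ _ _ _ _ => Nat.zero_le _)
  refine ⟨A₁, hA, fun N => ?_⟩
  induction N with
  | zero =>
    intro κ
    by_cases hκ : c (p 1) = κ
    · exact ⟨_, _, htow, hκ⟩
    · obtain ⟨T, w, ht, hw⟩ := htow.exists_succ hG hn hU hUA hA
      refine ⟨T, w, ht.mono (Nat.zero_le _), ?_⟩
      cases h : c (p 1) <;> cases h' : c w <;> cases κ <;> simp_all
  | succ N ih =>
    intro κ
    obtain ⟨T, w, ht, hw⟩ := ih (!κ)
    obtain ⟨T', w', ht', hw'⟩ := ht.exists_succ hG hn hU hUA hA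
    refine ⟨T', w', ht', ?_⟩
    cases h' : c w' <;> cases κ <;> simp_all

/-- In an open generalized polygon there are, over any large enough finite set `A₀`, loose ends
`z` such that every finite set closed over `A₀ ∪ {z}` and adjacent to `z` is large. -/
theorem IsOpenGraph.exists_generic (hO : IsOpenGraph n G) (hG : IsGeneralizedPolygon n G)
    (hn : 3 ≤ n) [Nonempty V] (c : G.Coloring Bool) : ∃ U : Set V, U.Finite ∧
      ∀ A₀ : Set V, A₀.Finite → U ⊆ A₀ → ∀ (m : ℕ) (κ : Bool), ∃ u ∈ U, c u = κ ∧ ∃ z ∉ A₀,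
        G.Adj u z ∧ (∀ a ∈ A₀, G.Adj a z → a = u) ∧ ∀ D : Set V, D.Finite →
          IsClosedOver n G (A₀ ∪ {z}) D → (∃ d ∈ D, G.Adj z d) → m ≤ D.ncard := by
  obtain ⟨v⟩ := ‹Nonempty V›
  obtain ⟨U, hUf, hU⟩ := hG.exists_finite_opposite c v
  refine ⟨U, hUf, fun A₀ hA₀ hUA m κ => ?_⟩
  obtain ⟨u, hu, -⟩ := hU v v rfl
  obtain ⟨A₁, hA, htow⟩ := hO.exists_isTower hG hn hU hUA hA₀ ⟨u, hUA hu⟩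
  -- The colour of `w` is chosen so that the end of a path of length `n - 1` has colour `κ`. That
  -- end is `u`, and `z` will be the last interior vertex `p (n - 2)` of the arc from `w` to `u`.
  obtain ⟨T, w, ht, hw⟩ := htow m (if Even (n - 1) then κ else !κ)
  obtain ⟨p, hp, h0, hl⟩ := ht.exists_isEar hG hn hU (hUA.trans hA)
  have hf : IsFreeIn n G T (p 0) := h0 ▸ ht.free w ht.mem ht.notMem
  have hk : n - 1 + 1 = n := by omega
  have hA₀T : A₀ ⊆ T := hA.trans ht.subset
  have hwA : w ∉ A₀ := fun h => ht.notMem (hA h)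
  have hzA : ∀ a ∈ T, G.Adj (p (n - 2)) a → a = p (n - 3) ∨ a = p (n - 1) := by
    intro a ha haz
    have := hp.eq_or_eq_of_adj hk hf (i := n - 2) (by omega) (by omega) (Or.inl ha) haz
    rwa [(by omega : n - 2 - 1 = n - 3), (by omega : n - 2 + 1 = n - 1)] at this
  have h3A : p (n - 3) ∉ A₀ := by
    rcases Nat.eq_zero_or_pos (n - 3) with h3 | h3
    · rw [h3, h0]; exact hwA
    · exact fun h => hp.notMem _ h3 (by omega) (hA₀T h)
  have hcol : c (p (n - 1)) = κ := by
    obtain ⟨q, hq, -⟩ := exists_walk_of_path (n - 1) hp.adj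
    have := c.even_length_iff_congr q
    rw [hq, h0, hw, ← Bool.eq_iff_iff] at this
    by_cases he : Even (n - 1)
    · simp only [he, if_true, true_iff] at this; exact this.symm
    · simp only [he, if_false, false_iff] at this
      cases κ <;> cases h : c (p (n - 1)) <;> simp_all
  refine ⟨p (n - 1), hl, hcol, p (n - 2),
    fun h => hp.notMem _ (by omega) (by omega) (hA₀T h), ?_, ?_, ?_⟩
  · have := hp.adj (n - 2) (by omega)
    rw [(by omega : n - 2 + 1 = n - 1)] at this
    exact this.symm
  · intro a ha haz
    rcases hzA a (hA₀T ha) haz.symm with rfl | rfl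
    exacts [absurd ha h3A, rfl]
  · intro D hD hcl ⟨d, hd, hzd⟩
    set S := p '' Ioo 0 (n - 1) with hS
    have hbase : A₀ ∪ {p (n - 2)} ⊆ T ∪ S := union_subset_union hA₀T
      (singleton_subset_iff.2 ⟨n - 2, ⟨by omega, by omega⟩, rfl⟩)
    have hcl' := hcl.diff hn hbase
    -- The part of `D` outside `T ∪ S` is closed over `T ∪ S`, so no free vertex is adjacent to it.
    have hstay : ∀ t, IsFreeIn n G (T ∪ S) t → ∀ v ∈ D, G.Adj t v → v ∈ T ∪ S := by
      intro t ht v hv htv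
      by_contra hvT
      exact ht.2 _ (hD.subset sdiff_subset) hcl' v ⟨hv, hvT⟩ htv
    have hfS : ∀ i, 0 < i → i < n - 1 → IsFreeIn n G (T ∪ S) (p i) := fun i hi0 hi =>
      hp.isFreeIn_interior hf hk ⟨i, ⟨hi0, hi⟩, rfl⟩
    have hdA : ∀ v ∈ D, v ∉ A₀ := fun v hv hvA => hcl.disjoint.le_bot ⟨Or.inl hvA, hv⟩
    have hadj : ∀ i, 0 < i → i < n - 1 → ∀ v ∈ A₀ ∪ {p (n - 2)} ∪ D, G.Adj (p i) v →
        v = p (i - 1) ∨ v = p (i + 1) := by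
      intro i hi0 hi v hv hiv
      refine hp.eq_or_eq_of_adj hk hf hi0 hi ?_ hiv
      rcases hv with hv | hv
      · exact hbase hv
      · exact hstay _ (hfS i hi0 hi) v hv hiv
    -- The neighbours of `z` in question lie on the arc, and `p (n - 1)` is in the base. So `D`
    -- contains `p (n - 3)`, and from there it is forced back along the arc, each vertex needing
    -- both of its arc neighbours, until it reaches `w`.
    have h3D : p (n - 3) ∈ D := by
      rcases hadj (n - 2) (by omega) (by omega) d (Or.inr hd) hzd with h | h
      · rwa [h, (by omega : n - 2 - 1 = n - 3)] at hd
      · rw [h, (by omega : n - 2 + 1 = n - 1)] at hd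
        exact absurd (hUA hl) (hdA _ hd)
    have hdesc : ∀ i, i ≤ n - 3 → p (n - 3 - i) ∈ D := by
      intro i
      induction i with
      | zero => intro _; exact h3D
      | succ i ih =>
        intro hi
        obtain ⟨a, ha, b, hb, hab, hia, hib⟩ :=
          exists_of_one_lt_valencyIn (hcl.one_lt_valencyIn (ih (by omega)))
        have hmem : p (n - 3 - (i + 1)) ∈ A₀ ∪ {p (n - 2)} ∪ D := by
          have ha' := hadj _ (by omega) (by omega) a ha hia
          have hb' := hadj _ (by omega) (by omega) b hb hib
          rw [(by omega : n - 3 - i - 1 = n - 3 - (i + 1))] at ha' hb'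
          rcases ha' with ha' | ha' <;> rcases hb' with hb' | hb'
          · exact absurd (ha'.trans hb'.symm) hab
          · exact ha' ▸ ha
          · exact hb' ▸ hb
          · exact absurd (ha'.trans hb'.symm) hab
        rcases hmem with (hmem | hmem) | hmem
        · rcases Nat.eq_zero_or_pos (n - 3 - (i + 1)) with h | h
          · rw [h, h0] at hmem; exact absurd hmem hwA
          · exact absurd (hA₀T hmem) (hp.notMem _ h (by omega))
        · have := hp.injOn (by simp; omega) (by simp; omega) hmem
          omega
        · exact hmem
    have hwD : w ∈ D := by
      have := hdesc (n - 3) le_rfl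
      rwa [Nat.sub_self, h0] at this
    -- For `n = 3` the vertex `p 1` is `z` itself; this is why `HasDepth` allows `w'` to lie in `Z`.
    have h1D : p 1 ∈ D ∪ {p (n - 2)} := by
      rcases hn.eq_or_lt with rfl | hn
      · exact Or.inr rfl
      · have := hdesc (n - 4) (by omega)
        rw [(by omega : n - 3 - (n - 4) = 1)] at this
        exact Or.inl this
    have hdepth := ht.hasDepth D {p (n - 2)} (p 1) hD hcl
      (disjoint_singleton_left.2 (hp.notMem _ (by omega) (by omega))) hwD h1D
      (hp.notMem _ (by omega) (by omega)) (by
        intro t htT htA v hv hvT htv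
        refine ht.eq_of_adj hn hp h0 (hA (hUA hl)) htT htA ?_ htv
        have hvTS : v ∈ T ∪ S := by
          rcases hv with hv | hv
          · exact hstay t (hp.isFreeIn_union hf hk (ht.free t htT htA)) v hv htv
          · exact hbase (Or.inr hv)
        exact hvTS.resolve_left hvT)
    exact hdepth.trans (ncard_le_ncard inter_subset_left hD)

end Towers

end GenPolygon

namespace GenPolygon

open Set FirstOrder FirstOrder.Language Filter

/-! ### Partial embeddings of structures -/

section Models

universe u v

variable {n : ℕ}

namespace IsOpenGeneralizedPolygon

variable {M : Type u} [polygonLang.Structure M]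

theorem isLine_iff (hM : IsOpenGeneralizedPolygon n M) (x : M) : IsLine x ↔ ¬ IsPoint x := by
  have h1 := hM.point_or_line x
  have h2 := hM.not_point_and_line x
  tauto

theorem isPoint_iff_of_incident (hM : IsOpenGeneralizedPolygon n M) {x y : M}
    (h : Incident x y) : IsPoint x ↔ ¬ IsPoint y := by
  rw [hM.incident_cross x y h, hM.isLine_iff]

theorem adj_iff_incident (hM : IsOpenGeneralizedPolygon n M) (x y : M) :
    (incidenceGraph M).Adj x y ↔ Incident x y := by
  rw [incidenceGraph, SimpleGraph.fromRel_adj]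
  constructor
  · rintro ⟨-, h | h⟩
    exacts [h, hM.incident_symm _ _ h]
  · intro h
    refine ⟨?_, Or.inl h⟩
    rintro rfl
    have := hM.isPoint_iff_of_incident h
    tauto

theorem isPoint_iff_of_adj (hM : IsOpenGeneralizedPolygon n M) {x y : M}
    (h : (incidenceGraph M).Adj x y) : IsPoint x ↔ ¬ IsPoint y :=
  hM.isPoint_iff_of_incident ((hM.adj_iff_incident x y).1 h)

theorem exists_coloring (hM : IsOpenGeneralizedPolygon n M) :
    ∃ c : (incidenceGraph M).Coloring Bool, ∀ x, c x = true ↔ IsPoint x := by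
  classical
  refine ⟨SimpleGraph.Coloring.mk (fun x => decide (IsPoint x)) fun {x y} h => ?_, fun x => ?_⟩
  · have := hM.isPoint_iff_of_adj h
    simp only [ne_eq, decide_eq_decide]
    tauto
  · exact decide_eq_true_iff

theorem even_dist_iff (hM : IsOpenGeneralizedPolygon n M) (x y : M) :
    Even ((incidenceGraph M).dist x y) ↔ (IsPoint x ↔ IsPoint y) := by
  obtain ⟨c, hc⟩ := hM.exists_coloring
  rw [hM.isGeneralizedPolygon.even_dist_iff c, Bool.eq_iff_iff, hc, hc]

end IsOpenGeneralizedPolygon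

/-- On `X` the map `f` is injective and preserves and reflects adjacency and the type of
vertices. -/
structure IsPartialEmbedding {M : Type u} [polygonLang.Structure M] {N : Type v}
    [polygonLang.Structure N] (f : M → N) (X : Set M) : Prop where
  injOn : InjOn f X
  adj : ∀ x ∈ X, ∀ y ∈ X, (incidenceGraph M).Adj x y ↔ (incidenceGraph N).Adj (f x) (f y)
  isPoint : ∀ x ∈ X, IsPoint x ↔ IsPoint (f x)

theorem IsPartialEmbedding.isClosedOver_iff {M : Type u} [polygonLang.Structure M] {N : Type v}
    [polygonLang.Structure N] {f : M → N} {X A D : Set M} (h : IsPartialEmbedding f X)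
    (hX : A ∪ D ⊆ X) : IsClosedOver n (incidenceGraph N) (f '' A) (f '' D) ↔
      IsClosedOver n (incidenceGraph M) A D :=
  isClosedOver_image_iff h.injOn h.adj hX

section Embeddings

variable {M : Type u} [polygonLang.Structure M] {N : Type v} [polygonLang.Structure N]

theorem _root_.FirstOrder.Language.Embedding.isPartialEmbedding (g : M ↪[polygonLang] N)
    (X : Set M) : IsPartialEmbedding g X := by
  have hI : ∀ x y, Incident (g x) (g y) ↔ Incident x y := by
    intro x y
    have := g.map_rel PolygonRel.adj ![x, y]
    rwa [(by ext i; fin_cases i <;> rfl : g ∘ ![x, y] = ![g x, g y])] at this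
  refine ⟨g.injective.injOn, fun x _ y _ => ?_, fun x _ => ?_⟩
  · simp only [incidenceGraph, SimpleGraph.fromRel_adj, hI, ne_eq, g.injective.eq_iff]
  · have := g.map_rel PolygonRel.point ![x]
    rw [(by ext i; fin_cases i; rfl : g ∘ ![x] = ![g x])] at this
    exact this.symm

theorem _root_.FirstOrder.Language.ElementaryEmbedding.isPartialEmbedding
    (g : M ↪ₑ[polygonLang] N) (X : Set M) : IsPartialEmbedding g X :=
  g.toEmbedding.isPartialEmbedding X

/-- A partial embedding of open generalized polygons defined everywhere is an embedding. -/
def IsPartialEmbedding.toEmbedding {f : M → N} (h : IsPartialEmbedding f univ)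
    (hM : IsOpenGeneralizedPolygon n M) (hN : IsOpenGeneralizedPolygon n N) :
    M ↪[polygonLang] N where
  toFun := f
  inj' := injOn_univ.1 h.injOn
  map_fun' := fun f _ => Empty.elim f
  map_rel' := by
    intro k r x
    cases r with
    | point =>
      have := (h.isPoint (x 0) trivial).symm
      rwa [IsPoint, IsPoint, (by ext i; fin_cases i; rfl : ![x 0] = x),
        (by ext i; fin_cases i; rfl : ![f (x 0)] = f ∘ x)] at this
    | line =>
      have := not_congr (h.isPoint (x 0) trivial).symm
      rwa [← hM.isLine_iff, ← hN.isLine_iff, IsLine, IsLine,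
        (by ext i; fin_cases i; rfl : ![x 0] = x),
        (by ext i; fin_cases i; rfl : ![f (x 0)] = f ∘ x)] at this
    | adj =>
      have := (h.adj (x 0) trivial (x 1) trivial).symm
      rwa [hM.adj_iff_incident, hN.adj_iff_incident, Incident, Incident,
        (by ext i; fin_cases i <;> rfl : ![x 0, x 1] = x),
        (by ext i; fin_cases i <;> rfl : ![f (x 0), f (x 1)] = f ∘ x)] at this

end Embeddings

theorem nonempty_of_isGeneralizedPolygon {V : Type u} {G : SimpleGraph V} (hn : 3 ≤ n)
    (hG : IsGeneralizedPolygon n G) : Nonempty V := by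
  by_contra h
  rw [not_nonempty_iff] at h
  have h0 : G.ediam ≤ (0 : ℕ) := SimpleGraph.ediam_le_iff.2 fun a => isEmptyElim a
  rw [hG.ediam_eq] at h0
  have : n ≤ 0 := by exact_mod_cast h0
  omega

/-! ### Ultraproducts and finite closed sets in them -/

section Ultraproducts

variable {I : Type v} (𝒰 : Ultrafilter I) (N : I → Type u)

/-- The ultraproduct of a family of structures. -/
abbrev UProd : Type (max u v) := (𝒰 : Filter I).Product N

/-- The class of a family of elements. -/
def UProd.mk (x : ∀ i, N i) : UProd 𝒰 N := (x : (𝒰 : Filter I).Product N)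

/-- A family of representatives of an element of an ultraproduct. -/
noncomputable def UProd.rep (x : UProd 𝒰 N) : ∀ i, N i := Quotient.out x

variable {𝒰 N}

theorem UProd.mk_rep (x : UProd 𝒰 N) : UProd.mk 𝒰 N (UProd.rep 𝒰 N x) = x := Quotient.out_eq x

variable [∀ i, polygonLang.Structure (N i)] [∀ i, Nonempty (N i)]

theorem UProd.diag_mk {ι : Type} (x : ι → ∀ i, N i) (a : AtomIdx ι) :
    diag (fun j => UProd.mk 𝒰 N (x j)) a ↔ ∀ᶠ i in 𝒰, diag (fun j => x j i) a := by
  simp only [← realize_atomFormula]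
  exact Ultraproduct.realize_formula_cast (atomFormula a) x

theorem UProd.mk_eq_mk {x y : ∀ i, N i} :
    UProd.mk 𝒰 N x = UProd.mk 𝒰 N y ↔ ∀ᶠ i in 𝒰, x i = y i :=
  UProd.diag_mk (𝒰 := 𝒰) ![x, y] (.inl (0, 1))

theorem UProd.isPoint_mk {x : ∀ i, N i} :
    IsPoint (UProd.mk 𝒰 N x) ↔ ∀ᶠ i in 𝒰, IsPoint (x i) :=
  UProd.diag_mk (𝒰 := 𝒰) ![x] (.inr (.inr (.inl 0)))

theorem UProd.incident_mk {x y : ∀ i, N i} :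
    Incident (UProd.mk 𝒰 N x) (UProd.mk 𝒰 N y) ↔ ∀ᶠ i in 𝒰, Incident (x i) (y i) :=
  UProd.diag_mk (𝒰 := 𝒰) ![x, y] (.inr (.inl (0, 1)))

theorem UProd.adj_mk {x y : ∀ i, N i} :
    (incidenceGraph (UProd 𝒰 N)).Adj (UProd.mk 𝒰 N x) (UProd.mk 𝒰 N y) ↔
      ∀ᶠ i in 𝒰, (incidenceGraph (N i)).Adj (x i) (y i) := by
  simp only [incidenceGraph, SimpleGraph.fromRel_adj, UProd.incident_mk, ne_eq, UProd.mk_eq_mk,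
    Filter.eventually_and, Ultrafilter.eventually_or, Ultrafilter.eventually_not]

theorem UProd.eventually_rep_eq (x : ∀ i, N i) :
    ∀ᶠ i in 𝒰, UProd.rep 𝒰 N (UProd.mk 𝒰 N x) i = x i :=
  UProd.mk_eq_mk.1 (UProd.mk_rep _)

/-- This is Łoś's theorem applied to the finitely many atomic statements about `X`. -/
theorem UProd.eventually_isPartialEmbedding {X : Set (UProd 𝒰 N)} (hX : X.Finite) :
    ∀ᶠ i in 𝒰, IsPartialEmbedding (fun x => UProd.rep 𝒰 N x i) X := by
  have hiff : ∀ {p : Prop} {q : I → Prop}, (p ↔ ∀ᶠ i in 𝒰, q i) → ∀ᶠ i in 𝒰, (p ↔ q i) := by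
    intro p q h
    by_cases hp : p
    · filter_upwards [h.1 hp] with i hi using by tauto
    · filter_upwards [Ultrafilter.eventually_not.2 (fun hq => hp (h.2 hq))] with i hi using by tauto
  have h1 : ∀ᶠ i in 𝒰, ∀ x ∈ X, ∀ y ∈ X, (x = y ↔ UProd.rep 𝒰 N x i = UProd.rep 𝒰 N y i) := by
    refine (eventually_all_finite hX).2 fun x _ => (eventually_all_finite hX).2 fun y _ => hiff ?_
    rw [← UProd.mk_eq_mk, UProd.mk_rep, UProd.mk_rep]
  have h2 : ∀ᶠ i in 𝒰, ∀ x ∈ X, ∀ y ∈ X, ((incidenceGraph (UProd 𝒰 N)).Adj x y ↔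
      (incidenceGraph (N i)).Adj (UProd.rep 𝒰 N x i) (UProd.rep 𝒰 N y i)) := by
    refine (eventually_all_finite hX).2 fun x _ => (eventually_all_finite hX).2 fun y _ => hiff ?_
    rw [← UProd.adj_mk, UProd.mk_rep, UProd.mk_rep]
  have h3 : ∀ᶠ i in 𝒰, ∀ x ∈ X, (IsPoint x ↔ IsPoint (UProd.rep 𝒰 N x i)) := by
    refine (eventually_all_finite hX).2 fun x _ => hiff ?_
    rw [← UProd.isPoint_mk, UProd.mk_rep]
  filter_upwards [h1, h2, h3] with i h1 h2 h3
  exact ⟨fun x hx y hy h => (h1 x hx y hy).2 h, h2, h3⟩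

/-- A family of elementary embeddings induces one into the ultraproduct. -/
def UProd.elementaryEmbedding {M : Type u} [polygonLang.Structure M]
    (g : ∀ i, M ↪ₑ[polygonLang] N i) : M ↪ₑ[polygonLang] UProd 𝒰 N where
  toFun a := UProd.mk 𝒰 N fun i => g i a
  map_formula' := by
    intro k φ x
    have h := Ultraproduct.realize_formula_cast (u := 𝒰) φ fun j i => g i (x j)
    have h2 : (∀ᶠ i in 𝒰, φ.Realize fun j => g i (x j)) ↔ φ.Realize x := by
      rw [← Filter.eventually_const (f := (𝒰 : Filter I)) (p := φ.Realize x)]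
      exact Filter.eventually_congr (Eventually.of_forall fun i => (g i).map_formula φ x)
    exact h.trans h2

/-- If the maps `f i` are embeddings on large sets, then a finite set of the ultraproduct that is
closed over the image of a finite set, and lives in the images of these large sets, meets the
image of the limit map. -/
theorem UProd.exists_mem_of_isClosedOver {M : Type u} [polygonLang.Structure M] (hn : 3 ≤ n)
    (hM : IsOpenGeneralizedPolygon n M) {f : ∀ i, M → N i} {X : I → Set M} {B : Set M}
    (hB : B.Finite) (hBX : ∀ᶠ i in 𝒰, B ⊆ X i)
    (hf : ∀ᶠ i in 𝒰, IsPartialEmbedding (f i) (X i)) {E : Set (UProd 𝒰 N)} (hE : E.Finite)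
    (hne : E.Nonempty)
    (hEX : ∀ᶠ i in 𝒰, ∀ e ∈ E, UProd.rep 𝒰 N e i ∈ f i '' X i)
    (hcl : IsClosedOver n (incidenceGraph (UProd 𝒰 N))
      ((fun b => UProd.mk 𝒰 N fun i => f i b) '' B) E)
    (hadj : ∀ b ∈ B, ∃ e ∈ E,
      (incidenceGraph (UProd 𝒰 N)).Adj (UProd.mk 𝒰 N fun i => f i b) e) :
    ∃ b, (UProd.mk 𝒰 N fun i => f i b) ∈ E := by
  obtain ⟨K, hK, hhit⟩ := hM.isOpenGraph.exists_finite_hitting hn hB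
  set F : M → UProd 𝒰 N := fun b => UProd.mk 𝒰 N fun i => f i b with hF
  -- In almost every coordinate `E` pulls back along `f i` to a set of `M` closed over `B`, which
  -- meets the hitting set `K`. Since `K` and `E` are finite, the ultrafilter selects a single pair
  -- `h ∈ K`, `e ∈ E`.
  have hev : ∀ᶠ i in 𝒰, ∃ h ∈ K, ∃ e ∈ E, f i h = UProd.rep 𝒰 N e i := by
    have hrep : ∀ᶠ i in 𝒰, ∀ b ∈ B, UProd.rep 𝒰 N (F b) i = f i b :=
      (eventually_all_finite hB).2 fun b _ => UProd.eventually_rep_eq _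
    filter_upwards [UProd.eventually_isPartialEmbedding ((hB.image F).union hE), hBX, hf, hEX,
      hrep] with i hρ hBX hf hEX hrep
    set ρ : UProd 𝒰 N → N i := fun x => UProd.rep 𝒰 N x i with hρdef
    have hBim : ρ '' (F '' B) = f i '' B := by
      rw [image_image]; exact image_congr hrep
    have hcl1 := (hρ.isClosedOver_iff (n := n) Subset.rfl).2 hcl
    rw [hBim] at hcl1
    set E' : Set M := X i ∩ f i ⁻¹' (ρ '' E) with hE'
    have hEim : f i '' E' = ρ '' E := by
      rw [hE', image_inter_preimage]
      refine inter_eq_right.2 ?_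
      rintro _ ⟨e, he, rfl⟩; exact hEX e he
    have hE'X : E' ⊆ X i := inter_subset_left
    rw [← hEim, hf.isClosedOver_iff (union_subset hBX hE'X)] at hcl1
    have hE'f : E'.Finite := by
      refine Finite.of_finite_image (f := f i) ?_ (hf.injOn.mono hE'X)
      rw [hEim]; exact hE.image ρ
    have hE'n : E'.Nonempty := by
      rw [← image_nonempty (f := f i), hEim]; exact hne.image ρ
    obtain ⟨h, ⟨hhX, e, he, heq⟩, hhK⟩ := hhit E' hE'f hE'n hcl1 (by
      intro b hb
      obtain ⟨e, he, hbe⟩ := hadj b hb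
      have : ρ e ∈ f i '' E' := hEim ▸ mem_image_of_mem ρ he
      obtain ⟨d, hd, hde⟩ := this
      refine ⟨d, hd, (hf.adj _ (hBX hb) _ (hE'X hd)).2 ?_⟩
      rw [hde, ← hrep b hb]
      exact (hρ.adj _ (Or.inl (mem_image_of_mem F hb)) _ (Or.inr he)).1 hbe)
    exact ⟨h, hhK, e, he, heq.symm⟩
  obtain ⟨h, -, hev⟩ := (Ultrafilter.eventually_exists_mem_iff hK).1 hev
  obtain ⟨e, he, hev⟩ := (Ultrafilter.eventually_exists_mem_iff hE).1 hev
  refine ⟨h, ?_⟩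
  have : UProd.mk 𝒰 N (fun i => f i h) = UProd.mk 𝒰 N (UProd.rep 𝒰 N e) := UProd.mk_eq_mk.2 hev
  rwa [this, UProd.mk_rep]

end Ultraproducts

end Models

end GenPolygon

namespace GenPolygon

open Set FirstOrder FirstOrder.Language Filter

/-! ### Generic neighbours in elementary extensions -/

section LooseEnds

universe u

variable {n : ℕ} {M : Type u} [polygonLang.Structure M]

/-- Some elementary extension `N` of `M` has a vertex `x` outside `M` whose only neighbour in `M`
is `d`, such that `M ∪ {x}` is strong in `N`. -/
def HasGenericNeighbor (n : ℕ) (M : Type u) [polygonLang.Structure M] (d : M) : Prop :=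
  ∃ (N : Type u) (_ : polygonLang.Structure N) (g : M ↪ₑ[polygonLang] N) (x : N),
    x ∉ range g ∧ (incidenceGraph N).Adj (g d) x ∧
    (∀ a, (incidenceGraph N).Adj (g a) x → a = d) ∧
    IsStrong n (incidenceGraph N) (range g ∪ {x}) univ

/-- The new vertex is the class, in an ultrapower indexed by a finite base and a size bound, of the
loose ends given by `IsOpenGraph.exists_generic`. Only the colour of its neighbour is under control,
not yet the neighbour itself. -/
theorem IsOpenGeneralizedPolygon.exists_hasGenericNeighbor (hn : 3 ≤ n)
    (hM : IsOpenGeneralizedPolygon n M) (d : M) :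
    ∃ u : M, (IsPoint u ↔ IsPoint d) ∧ HasGenericNeighbor n M u := by
  classical
  have := nonempty_of_isGeneralizedPolygon hn hM.isGeneralizedPolygon
  obtain ⟨c, hc⟩ := hM.exists_coloring
  obtain ⟨U, hU, hgen⟩ := hM.isOpenGraph.exists_generic hM.isGeneralizedPolygon hn c
  have hA : ∀ i : Finset M × ℕ, (U ∪ (i.1 : Set M)).Finite := fun i => hU.union i.1.finite_toSet
  choose w hwU hwc z hzA hwz hzu hzD using fun i : Finset M × ℕ =>
    hgen (U ∪ (i.1 : Set M)) (hA i) subset_union_left i.2 (c d)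
  set 𝒰 : Ultrafilter (Finset M × ℕ) := Ultrafilter.of atTop with h𝒰
  have hge : ∀ i₀ : Finset M × ℕ, ∀ᶠ i in 𝒰, i₀ ≤ i := fun i₀ =>
    Ultrafilter.of_le atTop (eventually_ge_atTop i₀)
  have hgeM : ∀ a : M, ∀ᶠ i : Finset M × ℕ in 𝒰, a ∈ U ∪ (i.1 : Set M) := fun a => by
    filter_upwards [hge ({a}, 0)] with i hi
    exact Or.inr (hi.1 (Finset.mem_singleton_self a))
  have hwev : ∀ᶠ i in 𝒰, ∃ u ∈ U, w i = u := Eventually.of_forall fun i => ⟨w i, hwU i, rfl⟩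
  -- The attaching vertices vary in the finite set `U`, so they are constant on a set of the
  -- ultrafilter.
  obtain ⟨u, hu, hwu⟩ := (Ultrafilter.eventually_exists_mem_iff hU).1 hwev
  have hud : c u = c d := by
    obtain ⟨i, hi⟩ := hwu.exists
    rw [← hi, hwc]
  refine ⟨u, by rw [← hc, ← hc, hud], ?_⟩
  set g : M ↪ₑ[polygonLang] UProd 𝒰 (fun _ : Finset M × ℕ => M) :=
    UProd.elementaryEmbedding (fun _ => ElementaryEmbedding.refl polygonLang M) with hg
  have hga : ∀ a, g a = UProd.mk 𝒰 _ fun _ => a := fun a => rfl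
  set x : UProd 𝒰 (fun _ : Finset M × ℕ => M) := UProd.mk 𝒰 _ z with hx
  have hxg : x ∉ range g := by
    rintro ⟨a, ha⟩
    rw [hga, hx, UProd.mk_eq_mk] at ha
    obtain ⟨i, hi, hi'⟩ := (ha.and (hgeM a)).exists
    exact hzA i (hi ▸ hi')
  have hxu : ∀ a, (incidenceGraph (UProd 𝒰 _)).Adj (g a) x → a = u := by
    intro a ha
    rw [hga, hx, UProd.adj_mk] at ha
    obtain ⟨i, ⟨hi, hi'⟩, hi''⟩ := ((ha.and (hgeM a)).and hwu).exists
    rw [← hi'']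
    exact hzu i a hi' hi
  refine ⟨UProd 𝒰 _, inferInstance, g, x, hxg, ?_, hxu, ?_⟩
  · rw [hga, hx, UProd.adj_mk]
    filter_upwards [hwu] with i hi
    exact hi ▸ hwz i
  rw [isStrong_univ_iff]
  intro E hE hne hcl
  obtain ⟨B, hB, hBf, hclB, hBadj⟩ := hcl.exists_finite hE
  have hEg : ∀ a, g a ∉ E := fun a ha => hcl.disjoint.le_bot ⟨Or.inl ⟨a, rfl⟩, ha⟩
  -- If `E` is adjacent to `x`, then in a suitable coordinate its image off the base is closed over
  -- the base and adjacent to `z i`, so it has more than `E.ncard` elements. Otherwise `x ∉ B`,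
  -- since every vertex of `B` is adjacent to `E`; then `E` is closed over a part of `M`, and the
  -- hitting sets force it to meet `M`.
  by_cases hxE : ∃ e ∈ E, (incidenceGraph (UProd 𝒰 _)).Adj x e
  · obtain ⟨e, he, hxe⟩ := hxE
    have h1 : ∀ᶠ i : Finset M × ℕ in 𝒰, ∀ b ∈ B, UProd.rep 𝒰 _ b i ∈ U ∪ (i.1 : Set M) ∪ {z i} := by
      refine (eventually_all_finite hBf).2 fun b hb => ?_
      rcases hB hb with ⟨a, rfl⟩ | rfl
      · filter_upwards [UProd.eventually_rep_eq (𝒰 := 𝒰) fun _ => a, hgeM a] with i hi hi'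
        rw [hga, hi]; exact Or.inl hi'
      · filter_upwards [UProd.eventually_rep_eq (𝒰 := 𝒰) z] with i hi
        exact Or.inr hi
    have h2 : ∀ᶠ i in 𝒰, UProd.rep 𝒰 _ e i ≠ u := by
      have : ¬ (UProd.mk 𝒰 _ (UProd.rep 𝒰 _ e) = g u) := by
        rw [UProd.mk_rep]; rintro rfl; exact hEg u he
      rw [hga, UProd.mk_eq_mk] at this
      exact Ultrafilter.eventually_not.2 this
    have h3 : ∀ᶠ i in 𝒰, (incidenceGraph M).Adj (z i) (UProd.rep 𝒰 _ e i) := by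
      rw [← UProd.adj_mk, UProd.mk_rep]; exact hxe
    obtain ⟨i, ⟨⟨⟨⟨⟨h1, h2⟩, h3⟩, h4⟩, h5⟩, h6⟩⟩ := (((((h1.and h2).and h3).and
      (UProd.eventually_isPartialEmbedding (hBf.union hE))).and hwu).and
      (hge (∅, E.ncard + 1))).exists
    set ρ : UProd 𝒰 (fun _ : Finset M × ℕ => M) → M := fun x => UProd.rep 𝒰 _ x i with hρ
    have hcl1 := ((h4.isClosedOver_iff (n := n) Subset.rfl).2 hclB).diff hn
      (C := U ∪ (i.1 : Set M) ∪ {z i}) (by rintro _ ⟨b, hb, rfl⟩; exact h1 b hb)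
    have hle := hzD i _ ((hE.image ρ).subset sdiff_subset) hcl1 ⟨ρ e, ⟨mem_image_of_mem ρ he, by
      rintro (h | h)
      · exact h2 ((hzu i _ h h3.symm).trans h5)
      · exact h3.ne h.symm⟩, h3⟩
    have hle2 : (ρ '' E \ (U ∪ (i.1 : Set M) ∪ {z i})).ncard ≤ E.ncard :=
      (ncard_le_ncard sdiff_subset (hE.image ρ)).trans (ncard_image_le hE)
    have h6' : E.ncard + 1 ≤ i.2 := h6.2
    omega
  · have hBg : B ⊆ range g := by
      intro b hb
      refine (hB hb).resolve_right ?_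
      rintro rfl
      exact hxE (hBadj _ hb)
    have hBim : g '' (g ⁻¹' B) = B := image_preimage_eq_of_subset hBg
    obtain ⟨b, hb⟩ := UProd.exists_mem_of_isClosedOver (𝒰 := 𝒰) (N := fun _ => M) hn hM
      (f := fun _ => id) (X := fun _ => univ) (B := g ⁻¹' B)
      (hBf.preimage g.injective.injOn) (Eventually.of_forall fun _ => subset_univ _)
      (Eventually.of_forall fun _ => ⟨injOn_id _, fun _ _ _ _ => Iff.rfl, fun _ _ => Iff.rfl⟩)
      hE hne (Eventually.of_forall fun _ _ _ => ⟨_, trivial, rfl⟩) (by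
        change IsClosedOver n _ (g '' (g ⁻¹' B)) E
        rw [hBim]; exact hclB) (fun b hb => hBadj _ hb)
    exact hEg b hb

/-- A nonempty part of the interior of an ear of length `n - 1` over `A` is not closed over `A`
if its vertices have no further neighbours. -/
theorem IsEar.not_isClosedOver_of_subset {V : Type u} {G : SimpleGraph V} {A E : Set V}
    {q : ℕ → V} (hn : 3 ≤ n) (h : IsEar G A (n - 1) q) (hE : E ⊆ q '' Ioo 0 (n - 1))
    (hne : E.Nonempty) (hadj : ∀ i, 0 < i → i < n - 1 → ∀ v ∈ A ∪ E, G.Adj (q i) v →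
      v = q (i - 1) ∨ v = q (i + 1)) : ¬ IsClosedOver n G A E := by
  intro hcl
  -- Each vertex of `E` needs both of its neighbours on the ear, so one vertex in `E` brings in the
  -- entire interior, which is then a clean arc.
  have step : ∀ i, 0 < i → i < n - 1 → q i ∈ E → q (i - 1) ∈ A ∪ E ∧ q (i + 1) ∈ A ∪ E ∧
      valencyIn G (A ∪ E) (q i) = 2 := by
    intro i hi0 hi hiE
    obtain ⟨a, ha, b, hb, hab, hia, hib⟩ :=
      exists_of_one_lt_valencyIn (hcl.one_lt_valencyIn hiE)
    have hv := hadj i hi0 hi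
    rcases hv a ha hia with rfl | rfl <;> rcases hv b hb hib with rfl | rfl
    · exact absurd rfl hab
    · exact ⟨ha, hb, valencyIn_eq_two ha hb hab hia hib hv⟩
    · exact ⟨hb, ha, valencyIn_eq_two hb ha hab.symm hib hia hv⟩
    · exact absurd rfl hab
  obtain ⟨e, he⟩ := hne
  obtain ⟨i, ⟨hi0, hi⟩, rfl⟩ := hE he
  have up : ∀ j, i + j < n - 1 → q (i + j) ∈ E := by
    intro j
    induction j with
    | zero => intro _; exact he
    | succ j ih =>
      intro hj
      exact (step (i + j) (by omega) (by omega) (ih (by omega))).2.1.resolve_left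
        (h.notMem _ (by omega) hj)
  have down : ∀ j, j < i → q (i - j) ∈ E := by
    intro j
    induction j with
    | zero => intro _; exact he
    | succ j ih =>
      intro hj
      exact (step (i - j) (by omega) (by omega) (ih (by omega))).1.resolve_left
        (h.notMem _ (by omega) (by omega))
  have all : ∀ j, 0 < j → j < n - 1 → q j ∈ E := by
    intro j hj0 hj
    rcases le_total i j with hij | hij
    · have := up (j - i) (by omega)
      rwa [Nat.add_sub_cancel' hij] at this
    · have := down (i - j) (by omega)
      rwa [Nat.sub_sub_self hij] at this
  refine hcl.no_cleanArc ⟨fun i => q i, ⟨fun i j hij => Fin.ext (h.injOn (by simp; omega)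
    (by simp; omega) hij), fun i => ?_, fun i j hij => ?_, fun i hi0 hi => ?_⟩,
    fun i hi0 hi => all i hi0 (by omega)⟩
  · rcases Nat.eq_zero_or_pos i.val with hi | hi
    · exact Or.inl (hi ▸ h.zero_mem)
    · rcases (by omega : i.val < n - 1 ∨ i.val = n - 1) with hi' | hi'
      · exact Or.inr (all _ hi hi')
      · exact Or.inl (hi' ▸ h.last_mem)
  · rw [← hij]; exact h.adj _ (by omega)
  · exact (step i hi0 (by omega) (all i hi0 (by omega))).2.2

/-- A path between vertices of different distance parity that leaves a strong set `C` is an ear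
of length `n - 1`. -/
theorem IsStrong.isEar_of_path {V : Type u} {G : SimpleGraph V} {C : Set V}
    (hC : IsStrong n G C univ) {p : ℕ → V} {l i : ℕ} (hp : InjOn p (Iic l))
    (hadj : ∀ i < l, G.Adj (p i) (p (i + 1))) (h0 : p 0 ∈ C) (hl : p l ∈ C) (hln : l + 1 ≤ n)
    (hil : i ≤ l) (hi : p i ∉ C) : l + 1 = n ∧ IsEar G C l p := by
  obtain ⟨a, k, hak, hear⟩ := IsEar.exists_of_path_of_notMem hp hadj h0 hl hil hi
  have := hear.le_of_isFreeIn (n := n) (hC.isFreeIn hear.zero_mem)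
  obtain rfl : a = 0 := by omega
  obtain rfl : k = l := by omega
  refine ⟨by omega, ?_⟩
  simpa using hear

/-- Let `z` be a generic neighbour of the opposite vertex `c`. A geodesic from `d` to `z` is a clean
arc of length `n - 1` over `M ∪ {z}`, and its first interior vertex is a generic neighbour of `d`.
This is the projectivity between the neighbours of opposite vertices. -/
theorem HasGenericNeighbor.of_dist_eq (hn : 3 ≤ n) (hM : M ⊨ openPolygonTheory n) {c d : M}
    (hc : HasGenericNeighbor n M c) (hcd : (incidenceGraph M).dist d c = n) :
    HasGenericNeighbor n M d := by
  obtain ⟨N, _, g, z, hz, hcz, hzc, hstr⟩ := hc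
  have hN : N ⊨ openPolygonTheory n := (g.theory_model_iff _).1 hM
  have hM' := isOpenGeneralizedPolygon_of_model hn hM
  have hN' := isOpenGeneralizedPolygon_of_model hn hN
  have hge := g.isPartialEmbedding univ
  set G := incidenceGraph N with hG
  have hlt : G.dist (g d) z + 1 ≤ n := by
    have hle := hN'.isGeneralizedPolygon.dist_le (g d) z
    have h1 := hN'.even_dist_iff (g d) z
    have h2 := hM'.even_dist_iff d c
    have h3 := hN'.isPoint_iff_of_adj hcz
    rw [hcd, hge.isPoint d trivial, hge.isPoint c trivial] at h2
    have : G.dist (g d) z ≠ n := by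
      intro he
      rw [← hG, he] at h1
      tauto
    change G.dist (g d) z ≤ n at hle
    omega
  obtain ⟨p, h0, hl, hadj, -, hinj⟩ := exists_geodesic (hN'.isGeneralizedPolygon.reachable (g d) z)
  obtain ⟨l, hldef⟩ : ∃ l, G.dist (g d) z = l := ⟨_, rfl⟩
  rw [← hG, hldef] at hl hadj hinj
  rw [hldef] at hlt
  have hl0 : 0 < l := by
    rcases Nat.eq_zero_or_pos l with h | h
    · have : z = g d := by rw [← hl, h, h0]
      exact absurd ⟨d, this.symm⟩ hz
    · exact h
  -- Were the geodesic contained in `M ∪ {z}`, it would enter `z` from `c`, giving a path from `d`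
  -- to `c` in `M` of length less than `n`.
  have hexit : ∃ i ≤ l, p i ∉ range g ∪ {z} := by
    by_contra! hin
    have hr : ∀ i < l, p i ∈ range g := by
      intro i hi
      refine (hin i hi.le).resolve_right fun h => ?_
      have := hinj (by simp; omega) (by simp) (h.trans hl.symm)
      omega
    have : ∀ i, ∃ a, i < l → g a = p i := by
      intro i
      by_cases hi : i < l
      · obtain ⟨a, ha⟩ := hr i hi
        exact ⟨a, fun _ => ha⟩
      · exact ⟨d, fun h => absurd h hi⟩
    choose q hq using this
    have hlast : q (l - 1) = c := by
      refine hzc _ ?_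
      rw [hq _ (by omega)]
      have := hadj (l - 1) (by omega)
      rw [Nat.sub_add_cancel hl0] at this
      exact hl ▸ this
    have hfirst : q 0 = d := g.injective ((hq 0 hl0).trans h0)
    have := dist_le_of_path (G := incidenceGraph M) (p := q) (l - 1) (fun i hi => by
      rw [hge.adj _ trivial _ trivial, hq i (by omega), hq (i + 1) (by omega)]
      exact hadj i (by omega))
    rw [hfirst, hlast, hcd] at this
    omega
  obtain ⟨i, hil, hi⟩ := hexit
  obtain ⟨hln, hear⟩ := hstr.isEar_of_path hinj hadj (Or.inl ⟨d, h0.symm⟩) (Or.inr hl) hlt hil hi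
  have hln' : l = n - 1 := by omega
  rw [hln'] at hear
  have hlz : p (n - 1) = z := by rw [← hln']; exact hl
  have hk : n - 1 + 1 = n := by omega
  have hf := hstr.isFreeIn hear.zero_mem
  have h1 : p 1 ∉ range g ∪ {z} := hear.notMem 1 (by omega) (by omega)
  refine ⟨N, inferInstance, g, p 1, fun h => h1 (Or.inl h), h0 ▸ hear.adj_one, ?_, ?_⟩
  · intro a ha
    rcases hear.eq_or_eq_of_adj hk hf (i := 1) (by omega) (by omega) (Or.inl (Or.inl ⟨a, rfl⟩))
      ha.symm with h | h
    · exact g.injective (h.trans h0)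
    · rcases (by omega : 2 = n - 1 ∨ 2 < n - 1) with h2 | h2
      · exact absurd ⟨a, h.trans ((congrArg p h2).trans hlz)⟩ hz
      · exact absurd (Or.inl ⟨a, h⟩) (hear.notMem 2 (by omega) h2)
  · rw [isStrong_univ_iff]
    intro E hE hne hcl
    have hpg : ∀ i, 0 < i → i ≤ n - 1 → p i ∉ range g := by
      intro i hi0 hi
      rcases hi.eq_or_lt with rfl | hi
      · rwa [hlz]
      · exact fun h => hear.notMem i hi0 hi (Or.inl h)
    have hsub : range g ∪ {p 1} ⊆ range g ∪ {z} ∪ p '' Ioo 0 (n - 1) := by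
      rintro v (hv | rfl)
      exacts [Or.inl (Or.inl hv), Or.inr hear.one_mem]
    have hEsub : E ⊆ range g ∪ {z} ∪ p '' Ioo 0 (n - 1) := by
      have h := isStrong_univ_iff.1 (hear.isStrong_union hstr hk)
        (E \ (range g ∪ {z} ∪ p '' Ioo 0 (n - 1))) (hE.subset sdiff_subset)
      by_contra hno
      exact h (sdiff_nonempty.2 hno) (hcl.diff hn hsub)
    -- Over `M ∪ {p 1}` the rest of the arc, continued through `z` to `c`, is again an ear of length
    -- `n - 1`. By `hEsub` the set `E` is part of its interior, and therefore not closed.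
    set q : ℕ → N := fun j => if j < n - 1 then p (j + 1) else g c with hq
    have hqp : ∀ j, j < n - 1 → q j = p (j + 1) := fun j hj => if_pos hj
    have hqc : q (n - 1) = g c := if_neg (lt_irrefl _)
    have hqear : IsEar G (range g ∪ {p 1}) (n - 1) q := by
      refine ⟨by omega, ?_, ?_, Or.inr (hqp 0 (by omega)), Or.inl ⟨c, hqc.symm⟩, ?_⟩
      · intro i hi j hj hij
        simp only [mem_Iic] at hi hj
        rcases hi.lt_or_eq with hi | rfl <;> rcases hj.lt_or_eq with hj | rfl
        · rw [hqp i hi, hqp j hj] at hij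
          have := hear.injOn (by simp; omega) (by simp; omega) hij
          omega
        · rw [hqp i hi, hqc] at hij
          exact absurd ⟨c, hij.symm⟩ (hpg _ (by omega) (by omega))
        · rw [hqp j hj, hqc] at hij
          exact absurd ⟨c, hij⟩ (hpg _ (by omega) (by omega))
        · rfl
      · intro i hi
        rcases (by omega : i + 1 < n - 1 ∨ i + 1 = n - 1) with h | h
        · rw [hqp i hi, hqp _ h]; exact hear.adj _ h
        · rw [hqp i hi, h, hqc, hlz]; exact hcz.symm
      · rintro i hi0 hi (h | h)
        · rw [hqp i hi] at h; exact hpg _ (by omega) (by omega) h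
        · rw [mem_singleton_iff, hqp i hi] at h
          have := hear.injOn (by simp; omega) (by simp; omega) h
          omega
    refine hqear.not_isClosedOver_of_subset hn ?_ hne ?_ hcl
    · intro e he
      have heA : e ∉ range g ∪ {p 1} := fun h => hcl.disjoint.le_bot ⟨h, he⟩
      rcases hEsub he with (h | h) | ⟨i, ⟨hi0, hi⟩, rfl⟩
      · exact absurd (Or.inl h) heA
      · refine ⟨n - 2, ⟨by omega, by omega⟩, ?_⟩
        rw [hqp _ (by omega), (by omega : n - 2 + 1 = n - 1), hlz]
        exact h.symm
      · rcases (by omega : i = 1 ∨ 1 < i) with rfl | hi1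
        · exact absurd (Or.inr rfl) heA
        · exact ⟨i - 1, ⟨by omega, by omega⟩, by rw [hqp _ (by omega), Nat.sub_add_cancel hi0]⟩
    · intro i hi0 hi v hv hiv
      have hvT : v ∈ range g ∪ {z} ∪ p '' Ioo 0 (n - 1) := hv.elim (fun h => hsub h)
        (fun h => hEsub h)
      rw [hqp i hi] at hiv
      rw [hqp (i - 1) (by omega), Nat.sub_add_cancel hi0]
      rcases (by omega : i + 1 < n - 1 ∨ i + 1 = n - 1) with hi1 | hi1
      · rw [hqp (i + 1) hi1]
        exact hear.eq_or_eq_of_adj hk hf (by omega) hi1 hvT hiv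
      · rw [hi1, hlz] at hiv
        rw [hi1, hqc]
        rcases hvT with (⟨a, rfl⟩ | rfl) | ⟨j, ⟨hj0, hj⟩, rfl⟩
        · exact Or.inr (congrArg g (hzc a hiv.symm))
        · exact absurd rfl hiv.ne
        · left
          rcases hear.eq_or_eq_of_adj hk hf hj0 hj (Or.inl (Or.inr rfl)) hiv.symm with h | h <;>
            have h' := hear.injOn (by simp) (by simp; omega) (hlz.trans h)
          · omega
          · rw [(by omega : j = i)]

/-- Vertices of the same colour have a common opposite vertex, so genericity is carried from some
vertex of the colour of `d` to `d` in two steps. -/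
theorem hasGenericNeighbor (hn : 3 ≤ n) (hM : M ⊨ openPolygonTheory n) (d : M) :
    HasGenericNeighbor n M d := by
  have hM' := isOpenGeneralizedPolygon_of_model hn hM
  obtain ⟨c, hcd, hc⟩ := hM'.exists_hasGenericNeighbor hn d
  obtain ⟨κ, hκ⟩ := hM'.exists_coloring
  obtain ⟨U, -, hU⟩ := hM'.isGeneralizedPolygon.exists_finite_opposite κ d
  obtain ⟨u, -, h1, h2⟩ := hU c d (by rw [Bool.eq_iff_iff, hκ, hκ, hcd])
  rw [SimpleGraph.dist_comm] at h2
  exact (hc.of_dist_eq hn hM h1).of_dist_eq hn hM h2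

end LooseEnds

end GenPolygon

namespace GenPolygon

open Set FirstOrder FirstOrder.Language Filter

/-! ### Generic vertices without neighbours in the model -/

section IsolatedVertices

universe u v

variable {n : ℕ} {M : Type u} [polygonLang.Structure M]

/-- A transitivity of strongness. A finite set closed over `g '' C ∪ {x}` lies in the image of `M`
because `M ∪ {x}` is strong, and it contains no neighbour of `x` since those in `M` belong to `C`.
Thus it is closed over `C` already in `M`. -/
theorem IsPartialEmbedding.isStrong_image_union {N : Type v} [polygonLang.Structure N]
    (hn : 3 ≤ n) {g : M → N} (hg : IsPartialEmbedding g univ) {C : Set M}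
    (hC : IsStrong n (incidenceGraph M) C univ) {x : N}
    (hstr : IsStrong n (incidenceGraph N) (range g ∪ {x}) univ)
    (hadj : ∀ a, (incidenceGraph N).Adj (g a) x → a ∈ C) :
    IsStrong n (incidenceGraph N) (g '' C ∪ {x}) univ := by
  rw [isStrong_univ_iff]
  intro D hD hne hcl
  have hxD : x ∉ D := fun h => hcl.disjoint.le_bot ⟨Or.inr rfl, h⟩
  have hDg : D ⊆ range g := by
    have hsub : D ⊆ range g ∪ {x} := by
      by_contra hno
      exact isStrong_univ_iff.1 hstr (D \ (range g ∪ {x})) (hD.subset sdiff_subset)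
        (sdiff_nonempty.2 hno) (hcl.diff hn (union_subset_union_left _ (image_subset_range g C)))
    intro d hd
    refine (hsub hd).resolve_right ?_
    rintro rfl
    exact hxD hd
  have hDim : g '' (g ⁻¹' D) = D := image_preimage_eq_of_subset hDg
  have h1 : IsClosedOver n (incidenceGraph N) (g '' C) (g '' (g ⁻¹' D)) := by
    rw [hDim]
    refine hcl.of_not_adj ?_
    rintro _ rfl d hd hxd
    obtain ⟨a, rfl⟩ := hDg hd
    exact hcl.disjoint.le_bot ⟨Or.inl ⟨a, hadj a hxd.symm, rfl⟩, hd⟩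
  refine isStrong_univ_iff.1 hC (g ⁻¹' D) (hD.preimage (hg.injOn.mono (subset_univ _))) ?_
    ((hg.isClosedOver_iff (subset_univ _)).1 h1)
  rw [← image_nonempty (f := g), hDim]
  exact hne

/-- A chain of `k` successive generic loose ends over `M`, starting at `d`. -/
theorem exists_looseEnd_chain (hn : 3 ≤ n) (hM : M ⊨ openPolygonTheory n) (d : M) (k : ℕ) :
    ∃ (N : Type u) (_ : polygonLang.Structure N) (g : M ↪ₑ[polygonLang] N) (p : ℕ → N),
      p 0 = g d ∧ (∀ i < k, (incidenceGraph N).Adj (p i) (p (i + 1))) ∧ InjOn p (Iic k) ∧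
      (∀ i, 0 < i → i ≤ k → p i ∉ range g) ∧
      (∀ i, 0 < i → i ≤ k → ∀ v ∈ range g ∪ p '' Ioc 0 k, (incidenceGraph N).Adj (p i) v →
        v = p (i - 1) ∨ i < k ∧ v = p (i + 1)) ∧
      IsStrong n (incidenceGraph N) (range g ∪ p '' Ioc 0 k) univ := by
  induction k with
  | zero =>
    refine ⟨M, inferInstance, ElementaryEmbedding.refl polygonLang M, fun _ => d, rfl,
      fun i hi => absurd hi (Nat.not_lt_zero i), ?_, fun i h0 h1 => by omega,
      fun i h0 h1 => by omega, ?_⟩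
    · intro i hi j hj _
      simp only [mem_Iic] at hi hj
      omega
    · rw [isStrong_univ_iff]
      rintro D - ⟨x, hx⟩ hcl
      exact hcl.disjoint.le_bot ⟨Or.inl ⟨x, rfl⟩, hx⟩
  | succ k ih =>
    obtain ⟨N, _, g, p, h0, hadj, hinj, hpg, hnbr, hstr⟩ := ih
    have hN : N ⊨ openPolygonTheory n := (g.theory_model_iff _).1 hM
    -- The new vertex is generic over all of `N`, so its only neighbour among the earlier vertices
    -- of the chain and those of `M` is `p k`.
    obtain ⟨N', _, g', x, hx, hpx, hxp, hstr'⟩ := hasGenericNeighbor hn hN (p k)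
    have hg' := g'.isPartialEmbedding univ
    set q : ℕ → N' := fun i => if i ≤ k then g' (p i) else x with hq
    have hqp : ∀ i, i ≤ k → q i = g' (p i) := fun i hi => if_pos hi
    have hqx : q (k + 1) = x := if_neg (by omega)
    have hpkC : p k ∈ range g ∪ p '' Ioc 0 k := by
      rcases Nat.eq_zero_or_pos k with rfl | hk
      · exact Or.inl ⟨d, h0.symm⟩
      · exact Or.inr ⟨k, ⟨hk, le_rfl⟩, rfl⟩
    have hset : range (g'.comp g) ∪ q '' Ioc 0 (k + 1) = g' '' (range g ∪ p '' Ioc 0 k) ∪ {x} := by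
      ext v
      constructor
      · rintro (⟨a, rfl⟩ | ⟨i, ⟨hi0, hi⟩, rfl⟩)
        · exact Or.inl ⟨g a, Or.inl ⟨a, rfl⟩, rfl⟩
        · rcases hi.lt_or_eq with hi | rfl
          · rw [hqp i (by omega)]
            exact Or.inl ⟨p i, Or.inr ⟨i, ⟨hi0, by omega⟩, rfl⟩, rfl⟩
          · exact Or.inr hqx
      · rintro (⟨_, ⟨a, rfl⟩ | ⟨i, ⟨hi0, hi⟩, rfl⟩, rfl⟩ | rfl)
        · exact Or.inl ⟨a, rfl⟩
        · exact Or.inr ⟨i, ⟨hi0, by omega⟩, hqp i hi⟩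
        · exact Or.inr ⟨k + 1, ⟨by omega, le_rfl⟩, hqx⟩
    refine ⟨N', inferInstance, g'.comp g, q, ?_, ?_, ?_, ?_, ?_, ?_⟩
    · rw [hqp 0 (Nat.zero_le k), h0]; rfl
    · intro i hi
      rcases (by omega : i < k ∨ i = k) with hi | rfl
      · rw [hqp i hi.le, hqp (i + 1) hi, ← hg'.adj _ trivial _ trivial]
        exact hadj i hi
      · rw [hqp i le_rfl, hqx]; exact hpx
    · intro i hi j hj hij
      simp only [mem_Iic] at hi hj
      rcases hi.lt_or_eq with hi | rfl <;> rcases hj.lt_or_eq with hj | rfl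
      · rw [hqp i (by omega), hqp j (by omega)] at hij
        exact hinj (by simp; omega) (by simp; omega) (g'.injective hij)
      · rw [hqp i (by omega), hqx] at hij
        exact absurd ⟨_, hij⟩ hx
      · rw [hqp j (by omega), hqx] at hij
        exact absurd ⟨_, hij.symm⟩ hx
      · rfl
    · rintro i hi0 hi ⟨a, ha⟩
      rcases hi.lt_or_eq with hi | rfl
      · rw [hqp i (by omega)] at ha
        exact hpg i hi0 (by omega) ⟨a, g'.injective ha⟩
      · rw [hqx] at ha
        exact hx ⟨g a, ha⟩
    · intro i hi0 hi v hv hiv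
      rw [hset] at hv
      rcases hi.lt_or_eq with hi | rfl
      · rw [hqp i (by omega)] at hiv
        rw [hqp (i - 1) (by omega)]
        rcases hv with ⟨w, hw, rfl⟩ | rfl
        · rw [← hg'.adj _ trivial _ trivial] at hiv
          rcases hnbr i hi0 (by omega) w hw hiv with h | ⟨h, h'⟩
          · exact Or.inl (congrArg g' h)
          · exact Or.inr ⟨hi, by rw [hqp _ (by omega), h']⟩
        · right
          have := hinj (by simp; omega) (by simp) (hxp _ hiv)
          exact ⟨hi, by rw [this, hqx]⟩
      · rw [hqx] at hiv
        left
        rw [Nat.add_sub_cancel, hqp k le_rfl]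
        rcases hv with ⟨w, -, rfl⟩ | rfl
        · exact congrArg g' (hxp w hiv.symm)
        · exact absurd rfl hiv.ne
    · rw [hset]
      exact hg'.isStrong_image_union hn hstr hstr' fun a ha => hxp a ha ▸ hpkC

/-- Some elementary extension of `M` has a vertex of prescribed type that is adjacent to no vertex
of `M` and generates a strong extension. -/
theorem exists_generic_isolated (hn : 3 ≤ n) (hM : M ⊨ openPolygonTheory n) (b : Prop) :
    ∃ (N : Type u) (_ : polygonLang.Structure N) (g : M ↪ₑ[polygonLang] N) (x : N),
      x ∉ range g ∧ (IsPoint x ↔ b) ∧ (∀ a, ¬ (incidenceGraph N).Adj (g a) x) ∧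
      IsStrong n (incidenceGraph N) (range g ∪ {x}) univ := by
  have hM' := isOpenGeneralizedPolygon_of_model hn hM
  have := nonempty_of_isGeneralizedPolygon hn hM'.isGeneralizedPolygon
  -- The type of `d` is chosen so that the vertex `n - 1` steps along the chain has the prescribed
  -- type.
  obtain ⟨d, hd⟩ : ∃ d : M, IsPoint d ↔ (b ↔ Even (n - 1)) := by
    obtain ⟨d⟩ := this
    by_cases h : IsPoint d ↔ (b ↔ Even (n - 1))
    · exact ⟨d, h⟩
    · obtain ⟨w, -, hw⟩ := hM'.isGeneralizedPolygon.exists_three_adj d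
      have := hM'.isPoint_iff_of_adj (hw 0)
      exact ⟨w 0, by tauto⟩
  obtain ⟨N, _, g, p, h0, hadj, hinj, hpg, hnbr, hstr⟩ := exists_looseEnd_chain hn hM d (n - 1)
  have hN := isOpenGeneralizedPolygon_of_model hn ((g.theory_model_iff _).1 hM)
  have hpt : ∀ i ≤ n - 1, (IsPoint (p i) ↔ (IsPoint d ↔ Even i)) := by
    intro i
    induction i with
    | zero => intro _; rw [h0, ← (g.isPartialEmbedding univ).isPoint d trivial]; simp
    | succ i ih =>
      intro hi
      have h1 := ih (by omega)
      have h2 := hN.isPoint_iff_of_adj (hadj i hi)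
      rw [Nat.even_add_one]
      tauto
  refine ⟨N, inferInstance, g, p (n - 1), hpg _ (by omega) le_rfl, ?_, ?_, ?_⟩
  · rw [hpt _ le_rfl]; tauto
  · intro a ha
    rcases hnbr (n - 1) (by omega) le_rfl _ (Or.inl ⟨a, rfl⟩) ha.symm with h | h
    · exact hpg (n - 1 - 1) (by omega) (by omega) ⟨a, h⟩
    · omega
  · rw [isStrong_univ_iff]
    intro E hE hne hcl
    have hmem : ∀ i, 0 < i → i ≤ n - 1 → p i ∈ range g ∪ p '' Ioc 0 (n - 1) :=
      fun i hi0 hi => Or.inr ⟨i, ⟨hi0, hi⟩, rfl⟩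
    have hsub : range g ∪ {p (n - 1)} ⊆ range g ∪ p '' Ioc 0 (n - 1) := by
      rintro v (hv | rfl)
      exacts [Or.inl hv, hmem _ (by omega) le_rfl]
    have hEsub : E ⊆ range g ∪ p '' Ioc 0 (n - 1) := by
      by_contra hno
      exact isStrong_univ_iff.1 hstr (E \ (range g ∪ p '' Ioc 0 (n - 1)))
        (hE.subset sdiff_subset) (sdiff_nonempty.2 hno) (hcl.diff hn hsub)
    -- The chain from `d` to `p (n - 1)` is an ear of length `n - 1` over `M ∪ {p (n - 1)}` without
    -- further edges, so dropping its interior from the strong set preserves strongness.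
    have hear : IsEar (incidenceGraph N) (range g ∪ {p (n - 1)}) (n - 1) p := by
      refine ⟨by omega, hinj, hadj, Or.inl ⟨d, h0.symm⟩, Or.inr rfl, ?_⟩
      rintro i hi0 hi (h | h)
      · exact hpg i hi0 hi.le h
      · have := hinj (by simp; omega) (by simp) h
        omega
    refine hear.not_isClosedOver_of_subset hn ?_ hne ?_ hcl
    · intro e he
      rcases hEsub he with h | ⟨i, ⟨hi0, hi⟩, rfl⟩
      · exact absurd ⟨Or.inl h, he⟩ (fun h => hcl.disjoint.le_bot h)
      · rcases hi.lt_or_eq with hi | rfl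
        · exact ⟨i, ⟨hi0, hi⟩, rfl⟩
        · exact absurd ⟨Or.inr rfl, he⟩ (fun h => hcl.disjoint.le_bot h)
    · intro i hi0 hi v hv hiv
      exact (hnbr i hi0 hi.le v (hv.elim (fun h => hsub h) (fun h => hEsub h)) hiv).imp id
        And.right

end IsolatedVertices

end GenPolygon

namespace GenPolygon

open Set FirstOrder FirstOrder.Language Filter

/-! ### Embedding strong extensions into elementary extensions -/

section Absorption

universe u v

variable {n : ℕ}

section Extension

variable {M : Type u} [polygonLang.Structure M] {N : Type v} [polygonLang.Structure N]

theorem IsOpenGeneralizedPolygon.isPoint_path_iff (hM : IsOpenGeneralizedPolygon n M) {p : ℕ → M}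
    {k : ℕ} (hadj : ∀ i < k, (incidenceGraph M).Adj (p i) (p (i + 1))) {i : ℕ} (hi : i ≤ k) :
    IsPoint (p i) ↔ (IsPoint (p 0) ↔ Even i) := by
  induction i with
  | zero => simp
  | succ i ih =>
    have h1 := ih (by omega)
    have h2 := hM.isPoint_iff_of_adj (hadj i hi)
    rw [Nat.even_add_one]
    tauto

open Classical in
theorem IsPartialEmbedding.insert {h : M → N} {X : Set M} (hh : IsPartialEmbedding h X) {v : M}
    (hv : v ∉ X) {x : N} (hx : x ∉ h '' X) (hpt : IsPoint v ↔ IsPoint x)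
    (hadj : ∀ a ∈ X, (incidenceGraph M).Adj a v ↔ (incidenceGraph N).Adj (h a) x) :
    IsPartialEmbedding (Function.update h v x) (X ∪ {v}) := by
  have hX : ∀ a ∈ X, Function.update h v x a = h a := fun a ha =>
    Function.update_of_ne (ne_of_mem_of_not_mem ha hv) _ _
  have hvx : Function.update h v x v = x := Function.update_self _ _ _
  refine ⟨?_, ?_, ?_⟩
  · rintro a (ha | rfl) b (hb | rfl) hab
    · rw [hX a ha, hX b hb] at hab
      exact hh.injOn ha hb hab
    · rw [hX a ha, hvx] at hab
      exact absurd ⟨a, ha, hab⟩ hx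
    · rw [hX b hb, hvx] at hab
      exact absurd ⟨b, hb, hab.symm⟩ hx
    · rfl
  · rintro a (ha | rfl) b (hb | rfl)
    · rw [hX a ha, hX b hb]; exact hh.adj a ha b hb
    · rw [hX a ha, hvx]; exact hadj a ha
    · rw [hX b hb, hvx, SimpleGraph.adj_comm, hadj b hb, SimpleGraph.adj_comm]
    · simp
  · rintro a (ha | rfl)
    · rw [hX a ha]; exact hh.isPoint a ha
    · rw [hvx]; exact hpt

/-- A partial embedding extends across ears whose interior vertices have no further neighbours. -/
theorem IsPartialEmbedding.exists_extend_ear (hM : IsOpenGeneralizedPolygon n M)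
    (hN : IsOpenGeneralizedPolygon n N) {h : M → N} {X : Set M} (hh : IsPartialEmbedding h X)
    {k : ℕ} {q : ℕ → M} {p : ℕ → N} (hq : IsEar (incidenceGraph M) X k q)
    (hp : IsEar (incidenceGraph N) (h '' X) k p) (h0 : h (q 0) = p 0) (hk : h (q k) = p k)
    (hqn : ∀ i, 0 < i → i < k → ∀ v ∈ X ∪ q '' Ioo 0 k, (incidenceGraph M).Adj (q i) v →
      v = q (i - 1) ∨ v = q (i + 1))
    (hpn : ∀ i, 0 < i → i < k → ∀ v ∈ h '' X ∪ p '' Ioo 0 k, (incidenceGraph N).Adj (p i) v →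
      v = p (i - 1) ∨ v = p (i + 1)) :
    ∃ h' : M → N, EqOn h' h X ∧ IsPartialEmbedding h' (X ∪ q '' Ioo 0 k) ∧
      h' '' (X ∪ q '' Ioo 0 k) = h '' X ∪ p '' Ioo 0 k := by
  classical
  have hinjq : InjOn q (Ioo 0 k) := hq.injOn.mono fun i hi => hi.2.le
  obtain ⟨h', hX, hint⟩ : ∃ h' : M → N, EqOn h' h X ∧ ∀ i ∈ Ioo 0 k, h' (q i) = p i := by
    refine ⟨fun y => if y ∈ q '' Ioo 0 k then p (Function.invFunOn q (Ioo 0 k) y) else h y,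
      fun y hy => if_neg fun hyq => disjoint_left.1 hq.disjoint hy hyq, fun i hi => ?_⟩
    have : q i ∈ q '' Ioo 0 k := ⟨i, hi, rfl⟩
    simp only [if_pos this]
    rw [hinjq.leftInvOn_invFunOn hi]
  have hall : ∀ i ≤ k, h' (q i) = p i := by
    intro i hi
    rcases Nat.eq_zero_or_pos i with rfl | hi0
    · rw [hX hq.zero_mem, h0]
    · rcases hi.lt_or_eq with hi | rfl
      · exact hint i ⟨hi0, hi⟩
      · rw [hX hq.last_mem, hk]
  have him : h' '' (q '' Ioo 0 k) = p '' Ioo 0 k := by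
    rw [image_image]
    exact image_congr hint
  have himX : h' '' (X ∪ q '' Ioo 0 k) = h '' X ∪ p '' Ioo 0 k := by
    rw [image_union, hX.image_eq, him]
  have hinj : InjOn h' (X ∪ q '' Ioo 0 k) := by
    rw [injOn_union hq.disjoint]
    refine ⟨(hX.injOn_iff).2 hh.injOn, ?_, ?_⟩
    · rintro _ ⟨i, hi, rfl⟩ _ ⟨j, hj, rfl⟩ hij
      rw [hint i hi, hint j hj] at hij
      rw [hp.injOn hi.2.le hj.2.le hij]
    · rintro a ha _ ⟨i, hi, rfl⟩ hai
      rw [hX ha, hint i hi] at hai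
      exact hp.notMem i hi.1 hi.2 ⟨a, ha, hai⟩
  have hadj : ∀ i ∈ Ioo 0 k, ∀ y ∈ X ∪ q '' Ioo 0 k,
      ((incidenceGraph M).Adj (q i) y ↔ (incidenceGraph N).Adj (p i) (h' y)) := by
    intro i hi y hy
    obtain ⟨hi0, hik⟩ := hi
    have e1 := hq.adj (i - 1) (by omega)
    have e2 := hp.adj (i - 1) (by omega)
    rw [Nat.sub_add_cancel hi0] at e1 e2
    constructor
    · intro hiy
      rcases hqn i hi0 hik y hy hiy with rfl | rfl
      · rw [hall _ (by omega)]; exact e2.symm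
      · rw [hall _ (by omega)]; exact hp.adj i hik
    · intro hiy
      rcases hpn i hi0 hik _ (himX ▸ mem_image_of_mem h' hy) hiy with he | he
      · rw [← hall _ (by omega)] at he
        rw [hinj hy (hq.mem_union (by omega)) he]; exact e1.symm
      · rw [← hall _ (by omega)] at he
        rw [hinj hy (hq.mem_union (by omega)) he]; exact hq.adj i hik
  refine ⟨h', hX, ⟨hinj, ?_, ?_⟩, himX⟩
  · rintro x hx y hy
    rcases hx with hx | ⟨i, hi, rfl⟩
    · rcases hy with hy | ⟨j, hj, rfl⟩
      · rw [hX hx, hX hy]; exact hh.adj x hx y hy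
      · rw [SimpleGraph.adj_comm, hadj j hj x (Or.inl hx), hint j hj, SimpleGraph.adj_comm]
    · rw [hadj i hi y hy, hint i hi]
  · rintro x (hx | ⟨i, hi, rfl⟩)
    · rw [hX hx]; exact hh.isPoint x hx
    · rw [hint i hi, hM.isPoint_path_iff hq.adj hi.2.le, hN.isPoint_path_iff hp.adj hi.2.le,
        hh.isPoint _ hq.zero_mem, h0]

end Extension

variable {A B : Type u} [polygonLang.Structure A] [polygonLang.Structure B]

/-- With its interior removed, a clean arc becomes an ear over what remains; this is the form used
to undo the removal in an induction on `D`. -/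
theorem IsCleanArcPathIn.exists_isEar {V : Type v} {G : SimpleGraph V} {P D : Set V} {x : Fin n → V}
    (hn : 3 ≤ n) (hx : IsCleanArcPathIn n G (P ∪ D) x) (hPD : Disjoint P D)
    (hxD : ∀ i : Fin n, 0 < i.val → i.val + 1 < n → x i ∈ D) :
    ∃ q : ℕ → V, q '' Ioo 0 (n - 1) ⊆ D ∧ IsEar G (P ∪ D \ q '' Ioo 0 (n - 1)) (n - 1) q ∧
      ∀ i, 0 < i → i < n - 1 → ∀ v ∈ P ∪ D, G.Adj (q i) v → v = q (i - 1) ∨ v = q (i + 1) := by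
  set q : ℕ → V := fun i => if hi : i < n then x ⟨i, hi⟩ else x ⟨0, by omega⟩ with hq
  have hqx : ∀ i (hi : i < n), q i = x ⟨i, hi⟩ := fun i hi => dif_pos hi
  have hinj : InjOn q (Iic (n - 1)) := by
    intro i hi j hj hij
    simp only [mem_Iic] at hi hj
    rw [hqx i (by omega), hqx j (by omega)] at hij
    exact Fin.mk.inj_iff.1 (hx.injective hij)
  have hadj : ∀ i < n - 1, G.Adj (q i) (q (i + 1)) := by
    intro i hi
    rw [hqx i (by omega), hqx (i + 1) (by omega)]
    exact hx.adj _ _ rfl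
  have hmem : ∀ i ≤ n - 1, q i ∈ P ∪ D := by
    intro i hi
    rw [hqx i (by omega)]; exact hx.mem _
  have hint : ∀ i, 0 < i → i < n - 1 → q i ∈ D := by
    intro i hi0 hi
    rw [hqx i (by omega)]; exact hxD _ hi0 (by simp; omega)
  have hend : ∀ i ≤ n - 1, (i = 0 ∨ i = n - 1) → q i ∈ P ∪ D \ q '' Ioo 0 (n - 1) := by
    intro i hi hie
    refine (hmem i hi).imp id fun h => ⟨h, ?_⟩
    rintro ⟨j, ⟨hj0, hj⟩, hji⟩
    have := hinj hj.le hi hji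
    omega
  refine ⟨q, ?_, ⟨by omega, hinj, hadj, hend 0 (by omega) (Or.inl rfl),
    hend _ le_rfl (Or.inr rfl), ?_⟩, ?_⟩
  · rintro _ ⟨i, hi, rfl⟩
    exact hint i hi.1 hi.2
  · rintro i hi0 hi (h | h)
    · exact hPD.le_bot ⟨h, hint i hi0 hi⟩
    · exact h.2 ⟨i, ⟨hi0, hi⟩, rfl⟩
  · intro i hi0 hi v hv hiv
    have hval := hx.valency_eq ⟨i, by omega⟩ hi0 (by simp; omega)
    rw [← hqx i (by omega)] at hval
    have e1 := hadj (i - 1) (by omega)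
    rw [Nat.sub_add_cancel hi0] at e1
    refine eq_or_eq_of_valencyIn_eq_two hval (hmem _ (by omega)) (hmem _ (by omega)) ?_ e1.symm
      (hadj i hi) hv hiv
    intro he
    have := hinj (by simp; omega) (by simp; omega) he
    omega

/-- Geodesics in `N` between the endpoints of an ear of `B` provide ears of `N`. -/
theorem exists_isEar_image (hB : IsOpenGeneralizedPolygon n B) {N : Type u}
    [polygonLang.Structure N] (hN : IsOpenGeneralizedPolygon n N) {h : B → N} {X : Set B}
    (hh : IsPartialEmbedding h X) (hstr : IsStrong n (incidenceGraph N) (h '' X) univ)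
    {q : ℕ → B} (hq : IsEar (incidenceGraph B) X (n - 1) q) :
    ∃ p, IsEar (incidenceGraph N) (h '' X) (n - 1) p ∧ h (q 0) = p 0 ∧
      h (q (n - 1)) = p (n - 1) := by
  have h2 := hq.two_le
  obtain ⟨p, h0, hl, hadj, -, hinj⟩ := exists_geodesic
    (hN.isGeneralizedPolygon.reachable (h (q 0)) (h (q (n - 1))))
  have hle := hN.isGeneralizedPolygon.dist_le (h (q 0)) (h (q (n - 1)))
  have heven := hN.even_dist_iff (h (q 0)) (h (q (n - 1)))
  obtain ⟨l, hldef⟩ : ∃ l, (incidenceGraph N).dist (h (q 0)) (h (q (n - 1))) = l := ⟨_, rfl⟩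
  rw [hldef] at hl hadj hinj hle heven
  -- The endpoints are joined by a path of length `n - 1` in `B`, so the parity of their types
  -- excludes distance `n`.
  have hln : l + 1 ≤ n := by
    have h1 := hB.isPoint_path_iff hq.adj le_rfl
    rw [hh.isPoint _ hq.zero_mem, hh.isPoint _ hq.last_mem] at h1
    have : l ≠ n := by
      rintro rfl
      have h3 : Even l ↔ ¬ Even (l - 1) := by
        rw [← Nat.even_add_one, Nat.sub_add_cancel (by omega)]
      tauto
    omega
  -- A geodesic inside the image would pull back to a path in `X` with the endpoints of `q`. The
  -- total length is below `2n`, so it would be `q`, whose interior avoids `X`.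
  have hexit : ∃ i ≤ l, p i ∉ h '' X := by
    by_contra! hin
    have : ∀ i, ∃ a, i ≤ l → a ∈ X ∧ h a = p i := by
      intro i
      by_cases hi : i ≤ l
      · obtain ⟨a, ha⟩ := hin i hi
        exact ⟨a, fun _ => ha⟩
      · exact ⟨q 0, fun h => absurd h hi⟩
    choose r hr using this
    have hr0 : r 0 = q 0 :=
      hh.injOn (hr 0 (Nat.zero_le l)).1 hq.zero_mem ((hr 0 (Nat.zero_le l)).2.trans h0)
    have hrl : r l = q (n - 1) := hh.injOn (hr l le_rfl).1 hq.last_mem ((hr l le_rfl).2.trans hl)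
    obtain ⟨hlk, heq⟩ := path_eq_of_lt_egirth (m := 2 * n)
      (hB.isGeneralizedPolygon.egirth_eq.symm.le) hq.injOn hq.adj (q := r) (l := l) (by
        intro i hi j hj hij
        refine hinj hi hj ?_
        rw [← (hr i hi).2, ← (hr j hj).2, hij]) (by
        intro i hi
        rw [hh.adj _ (hr i hi.le).1 _ (hr (i + 1) hi).1, (hr i hi.le).2, (hr (i + 1) hi).2]
        exact hadj i hi) hr0.symm hrl.symm (by omega)
    refine hq.notMem 1 (by omega) (by omega) ?_
    rw [heq 1 (by omega)]
    exact (hr 1 (by omega)).1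
  obtain ⟨i, hil, hi⟩ := hexit
  obtain ⟨hln', hear⟩ := hstr.isEar_of_path hinj hadj (h0 ▸ mem_image_of_mem h hq.zero_mem)
    (hl ▸ mem_image_of_mem h hq.last_mem) hln hil hi
  obtain rfl : l = n - 1 := by omega
  exact ⟨p, hear, h0.symm, hl.symm⟩

open Classical in
-- Induction on the size of `D`. Since `D` is not closed over the image of `A`, it contains a loose
-- end or a clean arc. The rest is embedded by induction; a loose end is then realized by a generic
-- vertex of a further elementary extension, and a clean arc by a geodesic already present in `N`.
theorem exists_extension_of_finite (hn : 3 ≤ n) (hA : A ⊨ openPolygonTheory n)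
    (hB : B ⊨ openPolygonTheory n) {f : A → B} (hf : IsPartialEmbedding f univ)
    (hstr : IsStrong n (incidenceGraph B) (range f) univ) :
    ∀ (m : ℕ) (D : Set B), D.Finite → D.ncard = m → Disjoint (range f) D →
      ∃ (N : Type u) (_ : polygonLang.Structure N) (g : A ↪ₑ[polygonLang] N) (h : B → N),
        (∀ a, h (f a) = g a) ∧ IsPartialEmbedding h (range f ∪ D) ∧
        IsStrong n (incidenceGraph N) (h '' (range f ∪ D)) univ := by
  have hA' := isOpenGeneralizedPolygon_of_model hn hA
  have hB' := isOpenGeneralizedPolygon_of_model hn hB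
  have := nonempty_of_isGeneralizedPolygon hn hA'.isGeneralizedPolygon
  have hfi : Function.Injective f := injOn_univ.1 hf.injOn
  intro m
  induction m using Nat.strong_induction_on with
  | _ m ih =>
  intro D hD hm hdisj
  rcases D.eq_empty_or_nonempty with rfl | hne
  · have hinv : ∀ a, Function.invFun f (f a) = a := Function.leftInverse_invFun hfi
    refine ⟨A, inferInstance, ElementaryEmbedding.refl polygonLang A, Function.invFun f, hinv,
      ⟨?_, ?_, ?_⟩, ?_⟩
    · rintro _ (⟨a, rfl⟩ | h) _ (⟨b, rfl⟩ | h') hab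
      · rw [hinv, hinv] at hab; rw [hab]
      · exact h'.elim
      · exact h.elim
      · exact h.elim
    · rintro _ (⟨a, rfl⟩ | h) _ (⟨b, rfl⟩ | h')
      · rw [hinv, hinv]; exact (hf.adj a trivial b trivial).symm
      · exact h'.elim
      · exact h.elim
      · exact h.elim
    · rintro _ (⟨a, rfl⟩ | h)
      · rw [hinv]; exact (hf.isPoint a trivial).symm
      · exact h.elim
    · rw [isStrong_univ_iff]
      rintro E - ⟨e, he⟩ hcl
      exact hcl.disjoint.le_bot ⟨⟨f e, Or.inl ⟨e, rfl⟩, hinv e⟩, he⟩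
  have hncl := isStrong_univ_iff.1 hstr D hD hne
  by_cases hle : ∃ v ∈ D, IsLooseEndIn (incidenceGraph B) (range f ∪ D) v
  · obtain ⟨v, hvD, -, hval⟩ := hle
    obtain ⟨N, _, g, h, hfg, hh, hhs⟩ := ih (D \ {v}).ncard
      (hm ▸ ncard_sdiff_singleton_lt_of_mem hvD hD) (D \ {v}) (hD.subset sdiff_subset) rfl
      (hdisj.mono_right sdiff_subset)
    have hN : N ⊨ openPolygonTheory n := (g.theory_model_iff _).1 hA
    set X := range f ∪ D \ {v} with hX
    have hvX : v ∉ X := by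
      rintro (hv | hv)
      · exact hdisj.le_bot ⟨hv, hvD⟩
      · exact hv.2 rfl
    have hXv : range f ∪ D = X ∪ {v} := by
      rw [hX, union_assoc, sdiff_union_of_subset (singleton_subset_iff.2 hvD)]
    -- Loose ends of valency 1 and 0 are treated alike: what is needed is a new vertex `x`, strong
    -- together with all of `N`, whose neighbours in `N` are exactly the images of those of `v`.
    suffices H : ∃ (N' : Type u) (_ : polygonLang.Structure N') (g' : N ↪ₑ[polygonLang] N')
        (x : N'), x ∉ range g' ∧ (IsPoint x ↔ IsPoint v) ∧
        (∀ a, (incidenceGraph N').Adj (g' a) x ↔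
          ∃ w ∈ X, (incidenceGraph B).Adj w v ∧ a = h w) ∧
        IsStrong n (incidenceGraph N') (range g' ∪ {x}) univ by
      obtain ⟨N', _, g', x, hx, hpt, hadj, hs⟩ := H
      have hg' := g'.isPartialEmbedding univ
      have hcomp : IsPartialEmbedding (fun b => g' (h b)) X := by
        refine ⟨fun a ha b hb hab => hh.injOn ha hb (g'.injective hab), fun a ha b hb => ?_,
          fun a ha => ?_⟩
        · rw [hh.adj a ha b hb, hg'.adj _ trivial _ trivial]
        · rw [hh.isPoint a ha, hg'.isPoint _ trivial]
      refine ⟨N', inferInstance, g'.comp g, Function.update (fun b => g' (h b)) v x, ?_, ?_, ?_⟩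
      · intro a
        rw [Function.update_of_ne, hfg]
        · rfl
        · intro he
          exact hvX (Or.inl ⟨a, he⟩)
      · rw [hXv]
        refine hcomp.insert hvX (fun ⟨a, _, ha⟩ => hx ⟨h a, ha⟩) hpt.symm ?_
        intro a ha
        rw [hadj]
        constructor
        · intro hav; exact ⟨a, ha, hav, rfl⟩
        · rintro ⟨w, hw, hwv, haw⟩
          rwa [hh.injOn ha hw haw]
      · have him : Function.update (fun b => g' (h b)) v x '' (range f ∪ D) =
            g' '' (h '' X) ∪ {x} := by
          rw [hXv, image_union, image_singleton, Function.update_self, image_image]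
          congr 1
          refine image_congr fun a ha => Function.update_of_ne ?_ _ _
          rintro rfl
          exact hvX ha
        rw [him]
        refine hg'.isStrong_image_union hn hhs hs ?_
        intro a ha
        obtain ⟨w, hw, -, rfl⟩ := (hadj a).1 ha
        exact ⟨w, hw, rfl⟩
    by_cases hw : ∃ w ∈ X, (incidenceGraph B).Adj w v
    · obtain ⟨w, hwX, hwv⟩ := hw
      have huniq : ∀ w' ∈ X, (incidenceGraph B).Adj w' v → w' = w := by
        intro w' hw' hwv'
        by_contra hne'
        refine absurd (one_lt_valencyIn (S := range f ∪ D) ?_ ?_ hne' hwv'.symm hwv.symm)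
          (not_lt.2 hval)
        · rw [hXv]; exact Or.inl hw'
        · rw [hXv]; exact Or.inl hwX
      obtain ⟨N', _, g', x, hx, hwx, hxw, hs⟩ := hasGenericNeighbor hn hN (h w)
      have hN' := isOpenGeneralizedPolygon_of_model hn ((g'.theory_model_iff _).1 hN)
      refine ⟨N', inferInstance, g', x, hx, ?_, fun a => ⟨fun ha => ⟨w, hwX, hwv, hxw a ha⟩, ?_⟩,
        hs⟩
      · have h1 := hN'.isPoint_iff_of_adj hwx
        have h2 := hB'.isPoint_iff_of_adj hwv
        rw [← (g'.isPartialEmbedding univ).isPoint _ trivial, ← hh.isPoint w hwX] at h1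
        tauto
      · rintro ⟨w', hw', hwv', rfl⟩
        rw [huniq w' hw' hwv']; exact hwx
    · obtain ⟨N', _, g', x, hx, hpt, hnadj, hs⟩ := exists_generic_isolated hn hN (IsPoint v)
      exact ⟨N', inferInstance, g', x, hx, hpt, fun a => ⟨fun ha => absurd ha (hnadj a),
        fun ⟨w, hwX, hwv, _⟩ => absurd ⟨w, hwX, hwv⟩ hw⟩, hs⟩
  · obtain ⟨x, hx, hxD⟩ : ∃ x : Fin n → B, IsCleanArcPathIn n (incidenceGraph B) (range f ∪ D) x ∧
        ∀ i : Fin n, 0 < i.val → i.val + 1 < n → x i ∈ D := by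
      by_contra hno
      exact hncl ⟨hdisj, hle, hno⟩
    obtain ⟨q, hqD, hq, hqn⟩ := hx.exists_isEar hn hdisj hxD
    obtain ⟨N, _, g, h, hfg, hh, hhs⟩ := ih (D \ q '' Ioo 0 (n - 1)).ncard
      (hm ▸ ncard_lt_ncard ((ssubset_iff_of_subset sdiff_subset).2
        ⟨q 1, hqD hq.one_mem, fun h => h.2 hq.one_mem⟩) hD) (D \ q '' Ioo 0 (n - 1))
      (hD.subset sdiff_subset) rfl (hdisj.mono_right sdiff_subset)
    have hN := isOpenGeneralizedPolygon_of_model hn ((g.theory_model_iff _).1 hA)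
    obtain ⟨p, hp, h0, hl⟩ := exists_isEar_image hB' hN hh hhs hq
    have hXq : range f ∪ D \ q '' Ioo 0 (n - 1) ∪ q '' Ioo 0 (n - 1) = range f ∪ D := by
      rw [union_assoc, sdiff_union_of_subset hqD]
    have hk : n - 1 + 1 = n := by omega
    obtain ⟨h', hX, hh', him⟩ := hh.exists_extend_ear hB' hN hq hp h0 hl
      (by rw [hXq]; exact hqn)
      (fun i hi0 hi v hv hiv => hp.eq_or_eq_of_adj hk (hhs.isFreeIn hp.zero_mem) hi0 hi hv hiv)
    rw [hXq] at hh' him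
    refine ⟨N, inferInstance, g, h', fun a => ?_, hh', ?_⟩
    · rw [hX (Or.inl ⟨a, rfl⟩), hfg]
    · rw [him]
      exact hp.isStrong_union hhs hk

/-- A strong extension of a model embeds strongly into an elementary extension of the model. -/
theorem exists_extension (hn : 3 ≤ n) (hA : A ⊨ openPolygonTheory n)
    (hB : B ⊨ openPolygonTheory n) {f : A → B} (hf : IsPartialEmbedding f univ)
    (hstr : IsStrong n (incidenceGraph B) (range f) univ) :
    ∃ (N : Type u) (_ : polygonLang.Structure N) (g : A ↪ₑ[polygonLang] N) (h : B → N),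
      (∀ a, h (f a) = g a) ∧ IsPartialEmbedding h univ ∧
      IsStrong n (incidenceGraph N) (range h) univ := by
  have hA' := isOpenGeneralizedPolygon_of_model hn hA
  have hB' := isOpenGeneralizedPolygon_of_model hn hB
  have := nonempty_of_isGeneralizedPolygon hn hA'.isGeneralizedPolygon
  -- One extension for each finite subset of `B`. Every vertex of `B` is in the domain `X i` for
  -- almost all `i`, so the maps `h i` have a limit defined on all of `B`.
  choose N hNstr g h hfg hh hhs using fun i : Finset B =>
    exists_extension_of_finite hn hA hB hf hstr _ ((i : Set B) \ range f)
      (i.finite_toSet.subset sdiff_subset) rfl disjoint_sdiff_right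
  have hNne : ∀ i, Nonempty (N i) := fun i => this.map (g i)
  set X : Finset B → Set B := fun i => range f ∪ (i : Set B) \ range f with hX
  set 𝒰 : Ultrafilter (Finset B) := Ultrafilter.of atTop with h𝒰
  have hXev : ∀ b : B, ∀ᶠ i in 𝒰, b ∈ X i := fun b => by
    have : ∀ᶠ i in 𝒰, ({b} : Finset B) ≤ i := Ultrafilter.of_le atTop (eventually_ge_atTop _)
    filter_upwards [this] with i hi
    simp only [hX, union_sdiff_self]
    exact Or.inr (hi (Finset.mem_singleton_self b))
  set F : B → UProd 𝒰 N := fun b => UProd.mk 𝒰 N fun i => h i b with hF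
  have hiff : ∀ {p : Prop} {q : Finset B → Prop}, (∀ᶠ i in 𝒰, (p ↔ q i)) →
      (p ↔ ∀ᶠ i in 𝒰, q i) := by
    intro p q h
    constructor
    · intro hp
      filter_upwards [h] with i hi using hi.1 hp
    · intro hq
      obtain ⟨i, hi, hi'⟩ := (h.and hq).exists
      exact hi.2 hi'
  have hFe : IsPartialEmbedding F univ := by
    refine ⟨fun a _ b _ hab => ?_, fun a _ b _ => ?_, fun a _ => ?_⟩
    · obtain ⟨i, ⟨hi, ha⟩, hb⟩ := (((UProd.mk_eq_mk.1 hab).and (hXev a)).and (hXev b)).exists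
      exact (hh i).injOn ha hb hi
    · rw [hF, UProd.adj_mk]
      refine hiff ?_
      filter_upwards [hXev a, hXev b] with i ha hb using (hh i).adj a ha b hb
    · rw [hF, UProd.isPoint_mk]
      refine hiff ?_
      filter_upwards [hXev a] with i ha using (hh i).isPoint a ha
  refine ⟨UProd 𝒰 N, inferInstance, UProd.elementaryEmbedding g, F, fun a => ?_, hFe, ?_⟩
  · exact UProd.mk_eq_mk.2 (Eventually.of_forall fun i => hfg i a)
  rw [isStrong_univ_iff]
  intro E hE hne hcl
  obtain ⟨A₀, hA₀, hA₀f, hclA, hadj⟩ := hcl.exists_finite hE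
  have hFinj : Function.Injective F := injOn_univ.1 hFe.injOn
  have him : F '' (F ⁻¹' A₀) = A₀ := image_preimage_eq_of_subset hA₀
  have hfin : (F ⁻¹' A₀).Finite := hA₀f.preimage hFinj.injOn
  have hsubX : ∀ᶠ i in 𝒰, F ⁻¹' A₀ ⊆ X i := (eventually_all_finite hfin).2 fun b _ => hXev b
  -- Strongness in each coordinate places the representatives of `E` in the image of `h i`, and the
  -- hitting sets of `B` then yield an element of `E` in the image of `F`.
  obtain ⟨b, hb⟩ := UProd.exists_mem_of_isClosedOver (𝒰 := 𝒰) hn hB' (f := h) (X := X)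
    hfin hsubX (Eventually.of_forall hh) hE hne (by
      have hrep : ∀ᶠ i in 𝒰, ∀ b ∈ F ⁻¹' A₀, UProd.rep 𝒰 N (F b) i = h i b :=
        (eventually_all_finite hfin).2 fun b _ => UProd.eventually_rep_eq _
      filter_upwards [UProd.eventually_isPartialEmbedding (hA₀f.union hE), hsubX, hrep]
        with i hρ hsub hrep
      have h1 := (hρ.isClosedOver_iff (n := n) Subset.rfl).2 hclA
      have h2 := h1.diff hn (C := h i '' X i) (by
        rw [← him]
        rintro _ ⟨_, ⟨b, hb, rfl⟩, rfl⟩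
        exact ⟨b, hsub hb, (hrep b hb).symm⟩)
      intro e he
      by_contra hno
      exact isStrong_univ_iff.1 (hhs i) _ ((hE.image _).subset sdiff_subset)
        ⟨_, mem_image_of_mem _ he, hno⟩ h2) (by
      change IsClosedOver n _ (F '' (F ⁻¹' A₀)) E
      rw [him]; exact hclA) (fun b hb => hadj _ hb)
  exact hcl.disjoint.le_bot ⟨⟨b, rfl⟩, hb⟩

end Absorption

end GenPolygon

namespace GenPolygon

open Set FirstOrder FirstOrder.Language

/-! ### The equivalences -/

section Main

universe u

variable {n : ℕ}

/-- Strong embeddings of models preserve all formulas. -/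
theorem realize_iff_of_isStrong (hn : 3 ≤ n) {α : Type*} {k : ℕ}
    (φ : polygonLang.BoundedFormula α k) : ∀ {M N : Type u} [polygonLang.Structure M]
    [polygonLang.Structure N] (_ : M ⊨ openPolygonTheory n) (_ : N ⊨ openPolygonTheory n)
    {f : M → N} (_ : IsPartialEmbedding f univ)
    (_ : IsStrong n (incidenceGraph N) (range f) univ) (v : α → M) (xs : Fin k → M),
    φ.Realize (f ∘ v) (f ∘ xs) ↔ φ.Realize v xs := by
  induction φ with
  | falsum => intros; rfl
  | equal t₁ t₂ =>
    intro M N _ _ hM hN f hf _ v xs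
    set e := hf.toEmbedding (isOpenGeneralizedPolygon_of_model hn hM)
      (isOpenGeneralizedPolygon_of_model hn hN)
    change (t₁.realize (Sum.elim (e ∘ v) (e ∘ xs)) = t₂.realize (Sum.elim (e ∘ v) (e ∘ xs))) ↔ _
    rw [← Sum.comp_elim, HomClass.realize_term, HomClass.realize_term, e.injective.eq_iff]
    rfl
  | rel R ts =>
    intro M N _ _ hM hN f hf _ v xs
    set e := hf.toEmbedding (isOpenGeneralizedPolygon_of_model hn hM)
      (isOpenGeneralizedPolygon_of_model hn hN)
    change Structure.RelMap R (fun i => (ts i).realize (Sum.elim (e ∘ v) (e ∘ xs))) ↔ _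
    simp only [← Sum.comp_elim, HomClass.realize_term]
    exact e.map_rel R fun i => (ts i).realize (Sum.elim v xs)
  | imp φ ψ ih₁ ih₂ =>
    intro M N _ _ hM hN f hf hs v xs
    rw [BoundedFormula.realize_imp, BoundedFormula.realize_imp, ih₁ hM hN hf hs,
      ih₂ hM hN hf hs]
  | all φ ih =>
    intro M N _ _ hM hN f hf hs v xs
    rw [BoundedFormula.realize_all, BoundedFormula.realize_all]
    constructor
    · intro h a
      rw [← ih hM hN hf hs, Fin.comp_snoc]
      exact h (f a)
    -- The embedding of `M` in `N'` is elementary, so `N'` satisfies the universal formula, in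
    -- particular at `h' b`. The induction hypothesis for the strong embedding of `N` in `N'`
    -- returns this to `b`.
    · intro h b
      obtain ⟨N', _, g, h', hfg, hh, hhs⟩ := exists_extension hn hM hN hf hs
      have hN' : N' ⊨ openPolygonTheory n := (g.theory_model_iff _).1 hM
      have hall := (g.map_boundedFormula φ.all v xs).2 (BoundedFormula.realize_all.2 h)
      have hg : ⇑g = h' ∘ f := funext fun a => (hfg a).symm
      rw [BoundedFormula.realize_all, hg] at hall
      rw [← ih hN hN' hh hhs, Fin.comp_snoc]
      exact hall (h' b)

theorem isElementary_of_isStrong (hn : 3 ≤ n) {B : Type u} [polygonLang.Structure B]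
    (A : polygonLang.Substructure B) (hA : A ⊨ openPolygonTheory n)
    (hB : B ⊨ openPolygonTheory n) (h : IsStrong n (incidenceGraph B) (A : Set B) univ) :
    A.IsElementary := by
  intro k φ x
  have hr : range A.subtype = A := Subtype.range_coe
  have := realize_iff_of_isStrong hn φ hA hB (A.subtype.isPartialEmbedding univ)
    (by rw [hr]; exact h) x default
  rw [Unique.eq_default (A.subtype ∘ default)] at this
  exact this

theorem subset_acl {L : Language} {B : Type u} [L.Structure B] (A : Set B) : A ⊆ acl L A := by
  intro a ha
  refine ⟨{a}, ?_, finite_singleton a, rfl⟩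
  refine definable_iff_exists_formula_sum.2
    ⟨(Term.var (Sum.inl ⟨a, ha⟩)).equal (Term.var (Sum.inr 0)), ?_⟩
  ext v
  simp [Formula.realize_equal, eq_comm]

/-- Elementary substructures are algebraically closed. -/
theorem acl_eq_of_isElementary {L : Language} {B : Type u} [L.Structure B]
    (A : L.Substructure B) (hA : A.IsElementary) : (A : Set B) = acl L (A : Set B) := by
  classical
  refine (subset_acl _).antisymm ?_
  rintro b ⟨S, hS, hfin, hb⟩
  by_contra hbA
  obtain ⟨φ, hφ⟩ := definable_iff_exists_formula_sum.1 hS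
  have hφ' : ∀ x, x ∈ S ↔ φ.Realize (Sum.elim (fun a : (A : Set B) => (a : B)) fun _ => x) :=
    fun x => Set.ext_iff.1 hφ fun _ => x
  set C : Set (A : Set B) := {c | (c : B) ∈ S} with hC
  have hCf : Finite C := hfin.preimage Subtype.val_injective.injOn
  set e : A ↪ₑ[L] B := (ElementarySubstructure.mk A hA).subtype with he
  -- `χ` defines the solutions of `φ` different from the finitely many that lie in `A`. The element
  -- `b` satisfies it in `B`, so by elementarity some element of `A` does, which is absurd.
  set χ : L.Formula ((A : Set B) ⊕ Fin 1) := φ ⊓ Formula.iInf fun c : C =>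
    ((Term.var (Sum.inl c.1)).equal (Term.var (Sum.inr 0))).not with hχ
  have h1 := e.map_formula (χ.iExs (Fin 1)) (fun a : (A : Set B) => a)
  have h2 : (χ.iExs (Fin 1)).Realize (e ∘ fun a : (A : Set B) => a) := by
    rw [Formula.realize_iExs]
    refine ⟨fun _ => b, ?_⟩
    rw [hχ, Formula.realize_inf, Formula.realize_iInf]
    refine ⟨(hφ' b).1 hb, fun c => ?_⟩
    rw [Formula.realize_not, Formula.realize_equal]
    intro hcb
    have hcb : ((c.1 : B)) = b := hcb
    exact hbA (hcb ▸ c.1.2)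
  rw [h1, Formula.realize_iExs] at h2
  obtain ⟨y, hy⟩ := h2
  rw [hχ, Formula.realize_inf, Formula.realize_iInf] at hy
  have h3 := (e.map_formula φ _).2 hy.1
  have hyS : ((y 0 : A) : B) ∈ S := by
    rw [hφ']
    convert h3 using 1
    funext i
    rcases i with i | i
    · rfl
    · rw [Subsingleton.elim i 0]; rfl
  have := hy.2 ⟨y 0, hyS⟩
  rw [Formula.realize_not, Formula.realize_equal] at this
  exact this rfl

/-- If all hitting sets of a family of tuples have at least `r` elements, then there are only
finitely many with exactly `r` elements. -/
theorem finite_minimal_hitting {V : Type u} {m : ℕ} (r : ℕ) : ∀ T : Set (Fin m → V),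
    (∀ H : Finset V, (∀ w ∈ T, ∃ i, w i ∈ H) → r ≤ H.card) →
    {H : Finset V | H.card = r ∧ ∀ w ∈ T, ∃ i, w i ∈ H}.Finite := by
  classical
  induction r with
  | zero =>
    intro T _
    refine (finite_singleton (∅ : Finset V)).subset ?_
    rintro H ⟨h, -⟩
    exact Finset.card_eq_zero.1 h
  | succ r ih =>
    intro T hT
    obtain ⟨w, hw⟩ : T.Nonempty := by
      by_contra hne
      rw [not_nonempty_iff_eq_empty] at hne
      have := hT ∅ (by simp [hne])
      simp at this
    -- A hitting set of size `r + 1` contains some entry `w i` of the fixed tuple `w`. Deleting it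
    -- leaves a set of size `r` that hits all tuples avoiding `w i`, and no smaller set hits these.
    have hfin : ∀ i, {H : Finset V | H.card = r ∧
        ∀ w' ∈ {w' ∈ T | w i ∉ range w'}, ∃ j, w' j ∈ H}.Finite := by
      refine fun i => ih _ fun H hH => ?_
      have := hT (insert (w i) H) fun w' hw' => by
        by_cases h : w i ∈ range w'
        · obtain ⟨j, hj⟩ := h
          exact ⟨j, hj ▸ Finset.mem_insert_self _ _⟩
        · obtain ⟨j, hj⟩ := hH w' ⟨hw', h⟩
          exact ⟨j, Finset.mem_insert_of_mem hj⟩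
      have := Finset.card_insert_le (w i) H
      omega
    refine (finite_iUnion fun i => (hfin i).image (insert (w i))).subset ?_
    rintro H ⟨hHr, hH⟩
    obtain ⟨i, hi⟩ := hH w hw
    refine mem_iUnion.2 ⟨i, H.erase (w i), ⟨?_, ?_⟩, Finset.insert_erase hi⟩
    · rw [Finset.card_erase_of_mem hi, hHr, Nat.add_sub_cancel]
    · rintro w' ⟨hw', hwi⟩
      obtain ⟨j, hj⟩ := hH w' hw'
      exact ⟨j, Finset.mem_erase.2 ⟨fun h => hwi ⟨j, h⟩, hj⟩⟩

/-- If finitely many elements meet all tuples with the quantifier-free type of `d` over a finite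
part of `A`, then `d` meets the algebraic closure of `A`. -/
theorem exists_mem_acl {B : Type u} [polygonLang.Structure B] {A : Set B} {k m : ℕ}
    {a : Fin k → B} (ha : ∀ i, a i ∈ A) (d : Fin m → B) {K : Set B} (hK : K.Finite)
    (hhit : ∀ w : Fin m → B, diag (Sum.elim a w) = diag (Sum.elim a d) → ∃ i, w i ∈ K) :
    ∃ i, d i ∈ acl polygonLang A := by
  classical
  set T : Set (Fin m → B) := {w | diag (Sum.elim a w) = diag (Sum.elim a d)} with hT
  have hex : ∃ r, ∃ H : Finset B, H.card = r ∧ ∀ w ∈ T, ∃ i, w i ∈ H :=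
    ⟨_, hK.toFinset, rfl, fun w hw => by simpa using hhit w hw⟩
  obtain ⟨r, ⟨H, hHr, hH⟩, hmin⟩ : ∃ r, (∃ H : Finset B, H.card = r ∧ ∀ w ∈ T, ∃ i, w i ∈ H) ∧
      ∀ H : Finset B, (∀ w ∈ T, ∃ i, w i ∈ H) → r ≤ H.card :=
    ⟨Nat.find hex, Nat.find_spec hex, fun H hH => Nat.find_min' hex ⟨H, rfl, hH⟩⟩
  have hfin := finite_minimal_hitting r T hmin
  obtain ⟨i, hi⟩ := hH d rfl
  -- This is the union of the hitting sets of minimum size `r`, each enumerated by some `u`;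
  -- minimality forces the image of `u` to have exactly `r` elements. It is definable from `a`, it
  -- is finite by `finite_minimal_hitting`, and `d` meets it because `d` belongs to the family.
  set S : Set B := {b | ∃ u : Fin r → B, (∃ j, u j = b) ∧
    ∀ w : Fin m → B, w ∈ T → ∃ i j, u j = w i} with hS
  refine ⟨i, S, ?_, ?_, ?_⟩
  · refine definable_iff_exists_formula_sum.2 ⟨Formula.iExs (Fin r)
      ((Formula.iSup fun j : Fin r =>
          (Term.var (Sum.inr j)).equal (Term.var (Sum.inl (Sum.inr 0)))) ⊓
        Formula.iAlls (Fin m) (((typeFormula {diag (Sum.elim a d)}).relabel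
          (Sum.elim (fun i => Sum.inl (Sum.inl (Sum.inl ⟨a i, ha i⟩))) Sum.inr)).imp
          (Formula.iSup fun i : Fin m => Formula.iSup fun j : Fin r =>
            (Term.var (Sum.inl (Sum.inr j))).equal (Term.var (Sum.inr i))))), ?_⟩
    ext v
    simp only [Formula.realize_iExs, Formula.realize_inf, Formula.realize_iSup,
      Formula.realize_iAlls, Formula.realize_imp, Formula.realize_relabel, realize_typeFormula,
      Formula.realize_equal, Term.realize_var, Sum.elim_inl, Sum.elim_inr, mem_ofPred_eq, hS, hT,
      mem_singleton_iff]
    refine exists_congr fun u => and_congr Iff.rfl (forall_congr' fun w => imp_congr ?_ Iff.rfl)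
    rw [eq_iff_iff.1 (congrArg (fun x => diag x = _) ?_)]
    funext i
    rcases i with i | i <;> rfl
  · refine (hfin.biUnion fun H _ => H.finite_toSet).subset ?_
    rintro b ⟨u, ⟨j, rfl⟩, hu⟩
    have hhits : ∀ w ∈ T, ∃ i, w i ∈ Finset.univ.image u := by
      intro w hw
      obtain ⟨i, j, hij⟩ := hu w hw
      exact ⟨i, Finset.mem_image.2 ⟨j, Finset.mem_univ j, hij⟩⟩
    refine mem_biUnion (x := Finset.univ.image u) ⟨?_, hhits⟩ (by simp)
    refine le_antisymm ?_ (hmin _ hhits)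
    exact Finset.card_image_le.trans_eq (by simp)
  · set u : Fin r → B := fun j => (H.equivFin.symm (Fin.cast hHr.symm j) : B) with hu
    have hur : ∀ b ∈ H, ∃ j, u j = b := fun b hb =>
      ⟨Fin.cast hHr (H.equivFin ⟨b, hb⟩), by simp [hu]⟩
    refine ⟨u, hur _ hi, fun w hw => ?_⟩
    obtain ⟨i, hi⟩ := hH w hw
    exact ⟨i, hur _ hi⟩

theorem isPartialEmbedding_of_diag_eq {B : Type u} [polygonLang.Structure B] {ι : Type}
    {v w : ι → B} (h : diag v = diag w) :
    ∃ f : B → B, (∀ i, f (v i) = w i) ∧ IsPartialEmbedding f (range v) := by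
  classical
  have heq : ∀ i j, v i = v j ↔ w i = w j := fun i j =>
    iff_of_eq (congrFun h (.inl (i, j)))
  have hf : ∀ i, Function.extend v w id (v i) = w i := fun i =>
    Function.FactorsThrough.extend_apply (fun i j hij => (heq i j).1 hij) id i
  refine ⟨Function.extend v w id, hf, ?_, ?_, ?_⟩
  · rintro _ ⟨i, rfl⟩ _ ⟨j, rfl⟩ hij
    rw [hf, hf] at hij
    exact (heq i j).2 hij
  · rintro _ ⟨i, rfl⟩ _ ⟨j, rfl⟩
    rw [hf, hf]
    exact adj_of_diag_eq h i j
  · rintro _ ⟨i, rfl⟩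
    rw [hf]
    exact iff_of_eq (congrFun h (.inr (.inr (.inl i))))

/-- Algebraically closed sets are strong. -/
theorem isStrong_of_eq_acl (hn : 3 ≤ n) {B : Type u} [polygonLang.Structure B]
    (hB : IsOpenGeneralizedPolygon n B) {A : Set B} (hA : A = acl polygonLang A) :
    IsStrong n (incidenceGraph B) A univ := by
  rw [isStrong_univ_iff]
  intro D hD hne hcl
  obtain ⟨A₀, hA₀, hA₀f, hclA, hadj⟩ := hcl.exists_finite hD
  obtain ⟨K, hK, hhit⟩ := hB.isOpenGraph.exists_finite_hitting hn hA₀f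
  obtain ⟨k, a, -, rfl⟩ := hA₀f.fin_param
  obtain ⟨m, d, -, rfl⟩ := hD.fin_param
  -- A tuple with the quantifier-free type of `d` over `a` also enumerates a set that is closed over
  -- `range a` and adjacent to all of it, so it meets `K`.
  obtain ⟨i, hi⟩ := exists_mem_acl (fun i => hA₀ ⟨i, rfl⟩) d hK fun w hw => by
    obtain ⟨f, hfv, hf⟩ := isPartialEmbedding_of_diag_eq hw.symm
    have hfa : f '' range a = range a := by
      rw [← range_comp]; congr 1; funext i; exact hfv (.inl i)
    have hfd : f '' range d = range w := by
      rw [← range_comp]; congr 1; funext i; exact hfv (.inr i)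
    rw [Sum.elim_range] at hf
    have h1 := (hf.isClosedOver_iff (n := n) Subset.rfl).2 hclA
    rw [hfa, hfd] at h1
    obtain ⟨_, ⟨i, rfl⟩, hiK⟩ := hhit (range w) (finite_range w)
      (by rw [← hfd]; exact hne.image f) h1 (by
        rintro _ ⟨i, rfl⟩
        obtain ⟨_, ⟨j, rfl⟩, hij⟩ := hadj (a i) ⟨i, rfl⟩
        refine ⟨w j, ⟨j, rfl⟩, ?_⟩
        have := (hf.adj (a i) (Or.inl ⟨i, rfl⟩) (d j) (Or.inr ⟨j, rfl⟩)).1 hij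
        rwa [show f (a i) = a i from hfv (.inl i), show f (d j) = w j from hfv (.inr j)] at this)
    exact ⟨i, hiK⟩
  exact disjoint_left.1 hcl.disjoint (hA ▸ hi : d i ∈ A) ⟨i, rfl⟩

/-- A generalized sub-polygon is equal to its closure if and only if it is strong. -/
theorem eq_Cl_iff_isStrong {V : Type u} {G : SimpleGraph V} {A : Set V}
    (hA : IsGeneralizedPolygon n (G.induce A)) : A = Cl n G A ↔ IsStrong n G A univ := by
  have hgen : generated n G A = A :=
    Subset.antisymm (sInter_subset_of_mem (⟨Subset.rfl, hA⟩ :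
      A ∈ {S | A ⊆ S ∧ IsGeneralizedPolygon n (G.induce S)})) (subset_sInter fun _ h => h.1)
  rw [isStrong_univ_iff]
  constructor
  · rintro h D hD ⟨d, hd⟩ hcl
    have : d ∈ clStage n G A 1 := by
      rw [clStage, clStage, hgen]
      exact Or.inr ⟨D, ⟨hD, hcl⟩, hd⟩
    have hdA : d ∈ A := by
      rw [h]; exact mem_iUnion.2 ⟨1, this⟩
    exact hcl.disjoint.le_bot ⟨hdA, hd⟩
  · intro h
    have hhat : hat n G A = A := by
      refine union_eq_left.2 ?_
      rintro d ⟨D, ⟨hD, hcl⟩, hd⟩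
      exact absurd hcl (h D hD ⟨d, hd⟩)
    have : ∀ i, clStage n G A i = A := by
      intro i
      induction i with
      | zero => rfl
      | succ i ih => rw [clStage, ih, hgen, hhat]
    rw [Cl, iUnion_congr this, iUnion_const]

theorem induce_incidenceGraph {B : Type u} [polygonLang.Structure B]
    (A : polygonLang.Substructure B) :
    (incidenceGraph B).induce (A : Set B) = incidenceGraph A := by
  ext x y
  exact ((A.subtype.isPartialEmbedding univ).adj x trivial y trivial).symm

end Main

end GenPolygon

open FirstOrder GenPolygon

theorem mainTheorem4 {n : ℕ} (hn : 3 ≤ n)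
    {B : Type*} [polygonLang.Structure B] (A : polygonLang.Substructure B)
    (hA : A ⊨ openPolygonTheory n) (hB : B ⊨ openPolygonTheory n) :
    List.TFAE
      [(A : Set B) = acl polygonLang (A : Set B),
       (A : Set B) = Cl n (incidenceGraph B) (A : Set B),
       IsStrong n (incidenceGraph B) (A : Set B) Set.univ,
       A.IsElementary] := by
  have hA' := (isOpenGeneralizedPolygon_of_model hn hA).isGeneralizedPolygon
  rw [← induce_incidenceGraph] at hA'
  tfae_have 1 → 3 := isStrong_of_eq_acl hn (isOpenGeneralizedPolygon_of_model hn hB)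
  tfae_have 3 → 4 := isElementary_of_isStrong hn A hA hB
  tfae_have 4 → 1 := acl_eq_of_isElementary A
  tfae_have 2 ↔ 3 := eq_Cl_iff_isStrong hA'
  tfae_finish
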